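/- Let $\gamma\subset\mathbb{R}^2$ be an analytic Jordan curve, i.e. the image of a real-analytic map $\mathbb{R}\to\mathbb{R}^2$ of period $1$, injective on $[0,1)$ and with nowhere vanishing derivative. Let $\gamma^{\mathrm{int}}$ and $\gamma^{\mathrm{ext}}$ be the sets of points off $\gamma$ that lie in a bounded, respectively unbounded, connected component of $\mathbb{R}^2\setminus\gamma$. By a tubular neighborhood of $\gamma$ we mean the image $\Omega=\Phi(\mathbb{R}/\mathbb{Z}\times(-1,1))$ of the open annulus under a map $\Phi$ which is real-analytic near the closed annulus $\mathbb{R}/\mathbb{Z}\times[-1,1]$, is injective and has invertible differential on the closed annulus, and is such that $\Phi(\cdot,0)$ is the given parametrization of $\gamma$; thus $\Omega$ is a bounded domain bounded by two disjoint analytic Jordan curves. Then there are a tubular neighborhood $\Omega$ of $\gamma$ and a function $\psi$, real-analytic in a neighborhood of $\overline\Omega$, such that $\psi$ is constant on $\partial\Omega$, $\psi\ge 0$ in $\Omega$, and $$\begin{cases}\Delta\psi=2+\psi^{5/2}&\text{in }\Omega\cap\gamma^{\mathrm{int}},\\ \Delta\psi=2-\psi^{5/2}&\text{in }\Omega\cap\gamma^{\mathrm{ext}},\end{cases}\qquad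 \psi=\frac{\partial\psi}{\partial n}=0\ \text{ on }\gamma,$$ where $n$ is the unit normal of $\gamma$. Moreover, $\psi$ is the stream function of a steady Euler flow in $\Omega$, i.e. $\nabla^\perp\psi\cdot\nabla\Delta\psi=0$ in $\Omega$, where $\nabla^\perp=(-\partial_2,\partial_1)$; the domain $\Omega$ is not simply connected; there is no function $F:\mathbb{R}\to\mathbb{R}$ with $\Delta\psi=F(\psi)$ in $\Omega$; and if $\gamma$ is not a circle, then $\psi$ is not radial in $\Omega$ about any point. Hence the statement that a real-analytic steady Euler stream function, constant on the boundary of a bounded analytic domain, is either radial or a solution of an equation $\Delta\psi=F(\psi)$, fails on multiply connected domains. -/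

import Mathlib

open Set

/-- The Euclidean plane `ℝ²`. -/
abbrev Plane : Type := EuclideanSpace ℝ (Fin 2)

/-- `γ` is a regular real-analytic parametrization, of period `1`, of an analytic Jordan curve;
the curve itself is the set `range γ`. -/
structure IsAnalyticJordanCurve (γ : ℝ → Plane) : Prop where
  analytic : AnalyticOnNhd ℝ γ univ
  periodic : Function.Periodic γ 1
  injOn : InjOn γ (Ico 0 1)
  regular : ∀ s, deriv γ s ≠ 0

/-- The unit normal of the parametrized curve `γ` at parameter `s`: the unit tangent
`γ' / |γ'|` rotated by a right angle. -/
noncomputable def unitNormal (γ : ℝ → Plane) (s : ℝ) : Plane :=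
  ‖deriv γ s‖⁻¹ • !₂[-(deriv γ s 1), deriv γ s 0]

/-- The interior of a Jordan curve `Γ`: the points off `Γ` lying in a bounded connected
component of the complement of `Γ`. -/
def jordanInterior (Γ : Set Plane) : Set Plane :=
  {x | x ∈ Γᶜ ∧ Bornology.IsBounded (connectedComponentIn Γᶜ x)}

/-- The exterior of a Jordan curve `Γ`: the points off `Γ` lying in an unbounded connected
component of the complement of `Γ`. -/
def jordanExterior (Γ : Set Plane) : Set Plane :=
  {x | x ∈ Γᶜ ∧ ¬ Bornology.IsBounded (connectedComponentIn Γᶜ x)}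

/-- `Ω` is a (regular, analytic) tubular neighborhood of the closed curve `γ` of period `1`:
there is an analytic embedding `Φ` of the closed annulus `ℝ/ℤ × [-1, 1]` into the plane
(analytic on a neighborhood of the closed annulus, with invertible differential there), which
restricts to `γ` on the zero section `t = 0` and maps the open annulus `ℝ/ℤ × (-1, 1)` onto `Ω`.
Thus `Ω` is a bounded domain whose boundary consists of the two disjoint analytic Jordan curves
`Φ (·, -1)` and `Φ (·, 1)`. -/
def IsTubularNeighborhood (γ : ℝ → Plane) (Ω : Set Plane) : Prop :=
  ∃ Φ : ℝ × ℝ → Plane,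
    AnalyticOnNhd ℝ Φ (univ ×ˢ Icc (-1) 1) ∧
    (∀ s, ∀ t ∈ Icc (-1 : ℝ) 1, Φ (s + 1, t) = Φ (s, t)) ∧
    InjOn Φ (Ico 0 1 ×ˢ Icc (-1) 1) ∧
    (∀ p ∈ (univ : Set ℝ) ×ˢ Icc (-1 : ℝ) 1, Function.Bijective (fderiv ℝ Φ p)) ∧
    (∀ s, Φ (s, 0) = γ s) ∧
    Φ '' (univ ×ˢ Ioo (-1) 1) = Ω

/-- The partial derivative `∂ᵢ f (x)`. -/
noncomputable def partialDeriv (i : Fin 2) (f : Plane → ℝ) (x : Plane) : ℝ :=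
  fderiv ℝ f x (EuclideanSpace.single i 1)

/-- The Poisson bracket `{f, g} = ∇^⊥ f · ∇ g`, where `∇^⊥ = (-∂₂, ∂₁)`. -/
noncomputable def poissonBracket (f g : Plane → ℝ) (x : Plane) : ℝ :=
  -(partialDeriv 1 f x) * partialDeriv 0 g x + partialDeriv 0 f x * partialDeriv 1 g x

/-- `ψ` is radial on `Ω` about some center: its value at `x ∈ Ω` depends only on the distance
from `x` to the center. -/
def IsRadialOn (ψ : Plane → ℝ) (Ω : Set Plane) : Prop :=
  ∃ c : Plane, ∀ x ∈ Ω, ∀ y ∈ Ω, dist x c = dist y c → ψ x = ψ y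

/-!
Extend `γ` to a holomorphic periodic map `G`, injective modulo the period on a strip `|Im z| < r`,
and look for `ψ` with `ψ (G z) = y² V(z)`, where `y = Im z`. When `z` and `z̄` are treated as
independent variables, the equation `Δψ = 2 ± y⁵ V^{5/2}` with zero Cauchy data on `γ` becomes a
fixed-point equation for an integral operator on holomorphic functions `V` near the diagonal of
`ℂ × ℂ`, with values in the right half-plane. Picard iteration on a thin strip solves it.

Put `W = y √V`. Then `W` is real-analytic, `ψ = W²` and `Δψ = 2 ± W⁵`. As `W` changes sign across
`γ` while `√ψ = |W|`, the single equation is `Δψ = 2 + ψ^{5/2}` on one side of `γ` and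
`Δψ = 2 - ψ^{5/2}` on the other. The level sets of `W` foliate a neighbourhood of `γ` and bound the
tubular neighbourhood; the values `W = ±w` give the same `ψ` but different `Δψ`.
-/

section

open Filter Topology MeasureTheory Complex
open scoped ComplexConjugate

/-! ### Holomorphic dependence on parameters -/

section ParametricIntegral

variable {E : Type*} [NormedAddCommGroup E] [NormedSpace ℂ E] [CompleteSpace E]

theorem analyticOnNhd_continuousMap_of_eval {K : Type*} [TopologicalSpace K] [CompactSpace K]
    {U : Set ℂ} (hU : IsOpen U) {F : ℂ → C(K, E)} (hF : ContinuousOn F U)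
    (hd : ∀ k, DifferentiableOn ℂ (fun z => F z k) U) : AnalyticOnNhd ℂ F U := by
  intro c hc
  obtain ⟨ρ, hρ, hsub⟩ := Metric.nhds_basis_closedBall.mem_iff.1 (hU.mem_nhds hc)
  lift ρ to NNReal using hρ.le
  have hFs : ContinuousOn F (Metric.sphere c ρ) :=
    hF.mono (Metric.sphere_subset_closedBall.trans hsub)
  have hps := hasFPowerSeriesOn_cauchy_integral (hFs.circleIntegrable hρ.le) (by exact_mod_cast hρ)
  refine (hps.congr fun w hw => ?_).analyticAt
  replace hw : w ∈ Metric.ball c (ρ : ℝ) := by simpa using hw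
  ext k
  have hcauchy := (((hd k).mono hsub).diffContOnCl_ball
    Subset.rfl).two_pi_i_inv_smul_circleIntegral_sub_inv_smul hw
  have hkernel : CircleIntegrable (fun z => (z - w)⁻¹ • F z) c ρ := by
    refine ContinuousOn.circleIntegrable hρ.le
      (.smul (.inv₀ (f := fun z => z - w) (by fun_prop) fun z hz h0 => ?_) hFs)
    exact (Metric.mem_ball.1 hw).ne (by rw [← sub_eq_zero.1 h0]; exact hz)
  have heval : (∮ z in C(c, ρ), (z - w)⁻¹ • F z) k = ∮ z in C(c, ρ), (z - w)⁻¹ • F z k := by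
    have h := ((ContinuousMap.evalCLM ℂ k).restrictScalars ℝ).intervalIntegral_comp_comm
      hkernel.out
    exact h.symm.trans (by simp [circleIntegral])
  rw [ContinuousMap.smul_apply, heval, hcauchy]

/-- Integration over `[a, b]`, as a continuous linear map on `C([a, b], E)`. -/
noncomputable def intervalIntegralCLM (E : Type*) [NormedAddCommGroup E] [NormedSpace ℂ E]
    {a b : ℝ} (hab : a ≤ b) : C(Icc a b, E) →L[ℂ] E :=
  LinearMap.mkContinuous
    { toFun := fun F => ∫ t in a..b, IccExtend hab F t
      map_add' := fun F G => intervalIntegral.integral_add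
        (F.continuous.Icc_extend'.intervalIntegrable a b)
        (G.continuous.Icc_extend'.intervalIntegrable a b)
      map_smul' := fun c F => intervalIntegral.integral_smul c (IccExtend hab F) }
    |b - a| fun F => by
      rw [mul_comm]
      exact intervalIntegral.norm_integral_le_of_norm_le_const fun t _ => F.norm_coe_le_norm _

theorem intervalIntegralCLM_eq {E : Type*} [NormedAddCommGroup E] [NormedSpace ℂ E] {a b : ℝ}
    (hab : a ≤ b) {F : C(Icc a b, E)} {h : ℝ → E} (hF : ∀ t : Icc a b, F t = h t) :
    intervalIntegralCLM E hab F = ∫ t in a..b, h t := by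
  refine intervalIntegral.integral_congr fun t ht => ?_
  rw [uIcc_of_le hab] at ht
  exact (IccExtend_of_mem hab F ht).trans (hF ⟨t, ht⟩)

theorem continuousOn_slice {X Y Z : Type*} [TopologicalSpace X] [TopologicalSpace Y]
    [TopologicalSpace Z] {s : Set X} {t : Set Y} {h : X → Y → Z}
    (hh : ContinuousOn (Function.uncurry h) (s ×ˢ t)) {x : X} (hx : x ∈ s) :
    ContinuousOn (h x) t :=
  hh.comp (Continuous.prodMk_right x).continuousOn fun _ hy => ⟨hx, hy⟩

theorem continuousOn_intervalIntegral {E : Type*} [NormedAddCommGroup E] [NormedSpace ℂ E]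
    {X : Type*} [TopologicalSpace X] {U : Set X} {h : X → ℝ → E} {a b : ℝ} (hab : a ≤ b)
    (hh : ContinuousOn (Function.uncurry h) (U ×ˢ Icc a b)) :
    ContinuousOn (fun x => ∫ t in a..b, h x t) U :=
  ((intervalIntegralCLM E hab).continuous.comp_continuousOn
    (ContinuousMap.continuousOn_mkD_restrict_of_uncurry h 0 hh)).congr fun _ hx =>
      (intervalIntegralCLM_eq hab fun _ =>
        ContinuousMap.mkD_apply_of_continuousOn (continuousOn_slice hh hx)).symm

/-- The restriction of `h` to `[a, b]` as a bundled continuous map, with junk value `0` if `h` is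
not continuous there. -/
noncomputable def restrictIcc {E : Type*} [NormedAddCommGroup E] (a b : ℝ) (h : ℝ → E) :
    C(Icc a b, E) :=
  ContinuousMap.mkD ((Icc a b).domRestrict h) 0

theorem restrictIcc_apply {E : Type*} [NormedAddCommGroup E] {a b : ℝ} {h : ℝ → E}
    (hh : ContinuousOn h (Icc a b)) (t : Icc a b) : restrictIcc a b h t = h t :=
  ContinuousMap.mkD_apply_of_continuousOn hh

theorem analyticOnNhd_restrictIcc {U : Set ℂ} (hU : IsOpen U) {h : ℂ → ℝ → E} {a b : ℝ}
    (hh : ContinuousOn (Function.uncurry h) (U ×ˢ Icc a b))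
    (hd : ∀ t ∈ Icc a b, DifferentiableOn ℂ (fun z => h z t) U) :
    AnalyticOnNhd ℂ (fun z => restrictIcc a b (h z)) U :=
  analyticOnNhd_continuousMap_of_eval hU
    (ContinuousMap.continuousOn_mkD_restrict_of_uncurry h 0 hh) fun t =>
      (hd t t.2).congr fun _ hz => restrictIcc_apply (continuousOn_slice hh hz) t

theorem hasDerivAt_intervalIntegral {U : Set ℂ} (hU : IsOpen U) {h : ℂ → ℝ → E} {h' : ℝ → E}
    {a b : ℝ} (hab : a ≤ b) (hh : ContinuousOn (Function.uncurry h) (U ×ˢ Icc a b))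
    (hd : ∀ t ∈ Icc a b, DifferentiableOn ℂ (fun z => h z t) U) {z : ℂ} (hz : z ∈ U)
    (hh' : ∀ t ∈ Icc a b, HasDerivAt (fun z => h z t) (h' t) z) :
    HasDerivAt (fun z => ∫ t in a..b, h z t) (∫ t in a..b, h' t) z := by
  set F : ℂ → C(Icc a b, E) := fun z => restrictIcc a b (h z)
  have hFh : ∀ z ∈ U, ∀ t, F z t = h z t := fun z hz =>
    restrictIcc_apply (continuousOn_slice hh hz)
  have hF : HasDerivAt F (deriv F z) z :=
    (analyticOnNhd_restrictIcc hU hh hd z hz).differentiableAt.hasDerivAt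
  have hFh' : ∀ t : Icc a b, deriv F z t = h' t := fun t =>
    ((((ContinuousMap.evalCLM ℂ t).hasFDerivAt.comp_hasDerivAt z hF).congr_of_eventuallyEq
      (eventually_of_mem (hU.mem_nhds hz) fun w hw => (hFh w hw t).symm)).unique (hh' t t.2) :)
  rw [← intervalIntegralCLM_eq hab hFh']
  exact ((intervalIntegralCLM E hab).hasFDerivAt.comp_hasDerivAt z hF).congr_of_eventuallyEq
    (eventually_of_mem (hU.mem_nhds hz) fun w hw => (intervalIntegralCLM_eq hab (hFh w hw)).symm)

theorem differentiableOn_intervalIntegral {U : Set ℂ} (hU : IsOpen U) {h : ℂ → ℝ → E} {a b : ℝ}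
    (hab : a ≤ b) (hh : ContinuousOn (Function.uncurry h) (U ×ˢ Icc a b))
    (hd : ∀ t ∈ Icc a b, DifferentiableOn ℂ (fun z => h z t) U) :
    DifferentiableOn ℂ (fun z => ∫ t in a..b, h z t) U := fun _ hz =>
  (hasDerivAt_intervalIntegral hU hab hh hd hz fun t ht => ((hd t ht).differentiableAt
    (hU.mem_nhds hz)).hasDerivAt).differentiableAt.differentiableWithinAt

/-- The derivative under the integral sign is `∂ₜ (t g(c + t (z - c)))`. -/
theorem hasDerivAt_integral_ray {U : Set ℂ} (hU : IsOpen U) {c : ℂ} (hstar : StarConvex ℝ c U)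
    {g : ℂ → E} (hg : DifferentiableOn ℂ g U) {z : ℂ} (hz : z ∈ U) :
    HasDerivAt (fun w => (w - c) • ∫ t in (0 : ℝ)..1, g (c + t * (w - c))) (g z) z := by
  have hmem : ∀ w ∈ U, ∀ t ∈ Icc (0 : ℝ) 1, c + t * (w - c) ∈ U := fun w hw t ht => by
    simpa using hstar.add_smul_sub_mem hw ht.1 ht.2
  have hg' : ∀ w ∈ U, HasDerivAt g (deriv g w) w := fun w hw =>
    (hg.differentiableAt (hU.mem_nhds hw)).hasDerivAt
  have hcont : ContinuousOn (fun t : ℝ => deriv g (c + t * (z - c))) (Icc 0 1) :=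
    (hg.deriv hU).continuousOn.comp (by fun_prop) (hmem z hz)
  have hgcont : ContinuousOn (fun t : ℝ => g (c + t * (z - c))) (Icc 0 1) :=
    hg.continuousOn.comp (by fun_prop) (hmem z hz)
  have hparam := hasDerivAt_intervalIntegral hU zero_le_one
    (h := fun w t => (w - c) • g (c + t * (w - c)))
    (h' := fun t => (1 : ℂ) • g (c + t * (z - c)) +
      (z - c) • ((t : ℂ) • deriv g (c + t * (z - c))))
    (ContinuousOn.smul (by fun_prop) (hg.continuousOn.comp (by fun_prop)
      fun p hp => hmem p.1 hp.1 p.2 hp.2))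
    (fun t ht => DifferentiableOn.smul (by fun_prop) (hg.comp (by fun_prop)
      fun w hw => hmem w hw t ht)) hz fun t ht => by
    have haff : HasDerivAt (fun w : ℂ => c + t * (w - c)) t z := by
      simpa using (((hasDerivAt_id z).sub_const c).const_mul (t : ℂ)).const_add c
    simpa only [Function.comp_apply, id_eq, add_comm] using ((hasDerivAt_id z).sub_const c).fun_smul
      ((hg' _ (hmem z hz t ht)).scomp z haff)
  have hftc := intervalIntegral.integral_eq_sub_of_hasDerivAt (a := (0 : ℝ)) (b := 1)
    (f := fun t : ℝ => (t : ℂ) • g (c + t * (z - c)))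
    (f' := fun t => (1 : ℂ) • g (c + t * (z - c)) +
      (z - c) • ((t : ℂ) • deriv g (c + t * (z - c)))) (fun t ht => by
        rw [uIcc_of_le zero_le_one] at ht
        have hray : HasDerivAt (fun t : ℝ => c + t * (z - c)) (z - c) t := by
          simpa using ((hasDerivAt_id t).ofReal_comp.mul_const (z - c)).const_add c
        rw [smul_comm (z - c), add_comm]
        exact (hasDerivAt_id t).ofReal_comp.fun_smul ((hg' _ (hmem z hz t ht)).scomp t hray))
    (ContinuousOn.intervalIntegrable (by
      rw [uIcc_of_le zero_le_one]
      exact (hgcont.const_smul _).add ((ContinuousOn.smul (by fun_prop) hcont).const_smul _)))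
  rw [hftc] at hparam
  simpa [intervalIntegral.integral_smul] using hparam

end ParametricIntegral

/-- The kernel of Cauchy's integral formula for the circle `|ζ - c| = ρ`, up to `2πi`. -/
noncomputable def cauchyKernel (c : ℂ) (ρ : ℝ) (z : ℂ) (t : ℝ) : ℂ :=
  deriv (circleMap c ρ) t * (circleMap c ρ t - z)⁻¹

theorem continuousOn_cauchyKernel (c : ℂ) (ρ : ℝ) :
    ContinuousOn (Function.uncurry (cauchyKernel c ρ))
      (Metric.ball c ρ ×ˢ Icc 0 (2 * Real.pi)) := by
  have := continuous_circleMap c ρ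
  have := continuous_circleMap 0 ρ
  simp only [Function.uncurry_def, cauchyKernel, deriv_circleMap]
  exact ContinuousOn.mul (by fun_prop) (ContinuousOn.inv₀ (by fun_prop) fun p hp =>
    sub_ne_zero.2 (circleMap_ne_mem_ball hp.1 p.2))

theorem differentiableOn_cauchyKernel (c : ℂ) (ρ t : ℝ) :
    DifferentiableOn ℂ (fun z => cauchyKernel c ρ z t) (Metric.ball c ρ) :=
  (DifferentiableOn.inv (by fun_prop) fun _ hz =>
    sub_ne_zero.2 (circleMap_ne_mem_ball hz t)).const_mul _

/-- **Osgood's lemma** in two variables. -/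
theorem analyticOnNhd_of_separately {D : Set (ℂ × ℂ)} (hD : IsOpen D) {f : ℂ × ℂ → ℂ}
    (hf : ContinuousOn f D) (h1 : ∀ p ∈ D, DifferentiableAt ℂ (fun z => f (z, p.2)) p.1)
    (h2 : ∀ p ∈ D, DifferentiableAt ℂ (fun w => f (p.1, w)) p.2) : AnalyticOnNhd ℂ f D := by
  rintro ⟨z₀, w₀⟩ hp
  obtain ⟨ρ, hρ, hsub⟩ := Metric.nhds_basis_closedBall.mem_iff.1 (hD.mem_nhds hp)
  rw [← closedBall_prod_same] at hsub
  have hmem : ∀ t, ∀ w ∈ Metric.ball w₀ ρ, (circleMap z₀ ρ t, w) ∈ D := fun t w hw =>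
    hsub ⟨circleMap_mem_closedBall z₀ hρ.le t, Metric.ball_subset_closedBall hw⟩
  have hkernel := continuousOn_cauchyKernel z₀ ρ
  have hslice : ContinuousOn (Function.uncurry fun w t => f (circleMap z₀ ρ t, w))
      (Metric.ball w₀ ρ ×ˢ Icc 0 (2 * Real.pi)) :=
    hf.comp (f := fun p : ℂ × ℝ => (circleMap z₀ ρ p.2, p.1))
      (by have := continuous_circleMap z₀ ρ; fun_prop)
      fun p hp => hmem p.2 p.1 hp.1
  -- By Cauchy's formula in `z`, `f (z, w)` is the integral of `cauchyKernel z₀ ρ z * f (·, w)`.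
  have hprod : AnalyticAt ℂ (fun p : ℂ × ℂ => restrictIcc 0 (2 * Real.pi) (cauchyKernel z₀ ρ p.1) *
      restrictIcc 0 (2 * Real.pi) fun t => f (circleMap z₀ ρ t, p.2)) (z₀, w₀) :=
    ((analyticOnNhd_restrictIcc Metric.isOpen_ball hkernel fun t _ =>
      differentiableOn_cauchyKernel z₀ ρ t) z₀ (Metric.mem_ball_self hρ)).comp_of_eq
        analyticAt_fst rfl |>.mul <|
    ((analyticOnNhd_restrictIcc Metric.isOpen_ball hslice fun t _ w hw => (h2 (_, w)
      (hmem t w hw)).differentiableWithinAt) w₀ (Metric.mem_ball_self hρ)).comp_of_eq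
        analyticAt_snd rfl
  have h2π : (0 : ℝ) ≤ 2 * Real.pi := by positivity
  refine (((intervalIntegralCLM ℂ h2π).analyticAt _).comp hprod |>.const_smul
    (c := (2 * Real.pi * I : ℂ)⁻¹)).congr ?_
  filter_upwards [prod_mem_nhds (Metric.ball_mem_nhds z₀ hρ) (Metric.ball_mem_nhds w₀ hρ)]
  rintro ⟨z, w⟩ ⟨hz, hw⟩
  have hdiff : DifferentiableOn ℂ (fun z => f (z, w)) (Metric.closedBall z₀ ρ) := fun z hz =>
    (h1 (z, w) (hsub ⟨hz, Metric.ball_subset_closedBall hw⟩)).differentiableWithinAt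
  rw [← (hdiff.diffContOnCl_ball Subset.rfl).two_pi_i_inv_smul_circleIntegral_sub_inv_smul hz]
  refine congrArg (fun x : ℂ => (2 * Real.pi * I : ℂ)⁻¹ • x)
    (intervalIntegralCLM_eq h2π fun t => ?_)
  rw [ContinuousMap.mul_apply, restrictIcc_apply (continuousOn_slice hkernel hz),
    restrictIcc_apply (continuousOn_slice hslice hw)]
  exact mul_assoc _ _ _

theorem analyticOnNhd_of_differentiableOn_prod {D : Set (ℂ × ℂ)} (hD : IsOpen D)
    {f : ℂ × ℂ → ℂ} (hf : DifferentiableOn ℂ f D) : AnalyticOnNhd ℂ f D :=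
  analyticOnNhd_of_separately hD hf.continuousOn
    (fun p hp => (hf.differentiableAt (hD.mem_nhds hp)).comp (g := f) p.1 (by fun_prop))
    fun p hp => (hf.differentiableAt (hD.mem_nhds hp)).comp (g := f) p.2 (by fun_prop)

theorem analyticOnNhd_of_tendstoUniformlyOn {D : Set (ℂ × ℂ)} (hD : IsOpen D)
    {f : ℕ → ℂ × ℂ → ℂ} {g : ℂ × ℂ → ℂ} (hf : ∀ n, AnalyticOnNhd ℂ (f n) D)
    (hlim : TendstoUniformlyOn f g atTop D) : AnalyticOnNhd ℂ g D := by
  have hslice : ∀ {e : ℂ → ℂ × ℂ}, Differentiable ℂ e → ∀ z, e z ∈ D →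
      DifferentiableAt ℂ (fun z => g (e z)) z := fun {e} he z hz =>
    have hU : IsOpen (e ⁻¹' D) := hD.preimage he.continuous
    ((hlim.comp e).tendstoLocallyUniformlyOn.differentiableOn (.of_forall fun n =>
      (hf n).differentiableOn.comp he.differentiableOn fun _ hz => hz) hU).differentiableAt
        (hU.mem_nhds hz)
  exact analyticOnNhd_of_separately hD
    (hlim.continuousOn (.of_forall fun n => (hf n).continuousOn))
    (fun p hp => hslice (e := fun z => (z, p.2)) (by fun_prop) p.1 hp)
    fun p hp => hslice (e := fun w => (p.1, w)) (by fun_prop) p.2 hp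

theorem analyticOnNhd_intervalIntegral {D : Set (ℂ × ℂ)} (hD : IsOpen D)
    {h : ℂ × ℂ → ℝ → ℂ} {a b : ℝ} (hab : a ≤ b)
    (hc : ContinuousOn (Function.uncurry h) (D ×ˢ Icc a b))
    (hd : ∀ t ∈ Icc a b, DifferentiableOn ℂ (fun z => h z t) D) :
    AnalyticOnNhd ℂ (fun z => ∫ t in a..b, h z t) D := by
  have hslice : ∀ {e : ℂ → ℂ × ℂ}, Differentiable ℂ e → ∀ z, e z ∈ D →
      DifferentiableAt ℂ (fun z => ∫ t in a..b, h (e z) t) z := fun {e} he z hz =>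
    have hU : IsOpen (e ⁻¹' D) := hD.preimage he.continuous
    (differentiableOn_intervalIntegral hU hab
      (h := fun z => h (e z)) (hc.comp (s := (e ⁻¹' D) ×ˢ Icc a b)
        (f := fun p : ℂ × ℝ => (e p.1, p.2)) (by have := he.continuous; fun_prop)
        fun p hp => hp)
      fun t ht => (hd t ht).comp he.differentiableOn fun z hz => hz).differentiableAt
        (hU.mem_nhds hz)
  exact analyticOnNhd_of_separately hD (continuousOn_intervalIntegral hab hc)
    (fun p hp => hslice (e := fun z => (z, p.2)) (by fun_prop) p.1 hp)
    fun p hp => hslice (e := fun w => (p.1, w)) (by fun_prop) p.2 hp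

/-! ### Segment means near the diagonal of `ℂ × ℂ` -/

/-- The mean of `u`, with weight `t ^ n`, over the segment from `ℓ p` (at `t = 0`) to `p`. It is
used for the projections `ℓ` to the diagonal of `ℂ × ℂ`, where it inverts a partial derivative. -/
noncomputable def segmentMean (n : ℕ) (ℓ : ℂ × ℂ →L[ℂ] ℂ × ℂ) (u : ℂ × ℂ → ℂ) (p : ℂ × ℂ) : ℂ :=
  ∫ t in (0 : ℝ)..1, (t : ℂ) ^ n * u (ℓ p + t • (p - ℓ p))

section SegmentMean

variable {n : ℕ} {ℓ : ℂ × ℂ →L[ℂ] ℂ × ℂ} {D : Set (ℂ × ℂ)} {u v : ℂ × ℂ → ℂ} {p : ℂ × ℂ}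

theorem segmentMean_congr (hconv : Convex ℝ D) (hℓ : MapsTo ℓ D D) (h : EqOn u v D)
    (hp : p ∈ D) : segmentMean n ℓ u p = segmentMean n ℓ v p :=
  intervalIntegral.integral_congr fun t ht => by
    rw [uIcc_of_le zero_le_one] at ht
    simp only [h (hconv.add_smul_sub_mem (hℓ hp) hp ht)]

theorem segmentMean_add_of_periodic (hconv : Convex ℝ D) (hℓ : MapsTo ℓ D D) {e : ℂ × ℂ}
    (he : ℓ e = e) (hu : ∀ p ∈ D, u (p + e) = u p) (hp : p ∈ D) :
    segmentMean n ℓ u (p + e) = segmentMean n ℓ u p :=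
  intervalIntegral.integral_congr fun t ht => by
    rw [uIcc_of_le zero_le_one] at ht
    simp only [← hu _ (hconv.add_smul_sub_mem (hℓ hp) hp ht), map_add, he,
      add_sub_add_right_eq_sub, add_right_comm]

theorem continuousOn_segmentMean_integrand (hconv : Convex ℝ D) (hℓ : MapsTo ℓ D D)
    (hu : ContinuousOn u D) :
    ContinuousOn (Function.uncurry fun (p : ℂ × ℂ) (t : ℝ) =>
      (t : ℂ) ^ n * u (ℓ p + t • (p - ℓ p))) (D ×ˢ Icc 0 1) :=
  ContinuousOn.mul (by fun_prop)
    (hu.comp (f := fun q : (ℂ × ℂ) × ℝ => ℓ q.1 + q.2 • (q.1 - ℓ q.1)) (by fun_prop)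
      fun _ hq => hconv.add_smul_sub_mem (hℓ hq.1) hq.1 hq.2)

theorem analyticOnNhd_segmentMean (hD : IsOpen D) (hconv : Convex ℝ D) (hℓ : MapsTo ℓ D D)
    (hu : AnalyticOnNhd ℂ u D) : AnalyticOnNhd ℂ (segmentMean n ℓ u) D :=
  analyticOnNhd_intervalIntegral hD zero_le_one
    (continuousOn_segmentMean_integrand hconv hℓ hu.continuousOn) fun t ht =>
      (hu.differentiableOn.comp (f := fun p => ℓ p + t • (p - ℓ p)) (by fun_prop)
        fun _ hp => hconv.add_smul_sub_mem (hℓ hp) hp ht).const_mul _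

theorem intervalIntegrable_segmentMean (hconv : Convex ℝ D) (hℓ : MapsTo ℓ D D)
    (hu : ContinuousOn u D) (hp : p ∈ D) :
    IntervalIntegrable (fun t : ℝ => (t : ℂ) ^ n * u (ℓ p + t • (p - ℓ p))) volume 0 1 := by
  refine ContinuousOn.intervalIntegrable ?_
  rw [uIcc_of_le zero_le_one]
  exact continuousOn_slice (continuousOn_segmentMean_integrand hconv hℓ hu) hp

theorem segmentMean_sub (hconv : Convex ℝ D) (hℓ : MapsTo ℓ D D) (hu : ContinuousOn u D)
    (hv : ContinuousOn v D) (hp : p ∈ D) :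
    segmentMean n ℓ (u - v) p = segmentMean n ℓ u p - segmentMean n ℓ v p := by
  simp only [segmentMean, Pi.sub_apply, mul_sub]
  exact intervalIntegral.integral_sub (intervalIntegrable_segmentMean hconv hℓ hu hp)
    (intervalIntegrable_segmentMean hconv hℓ hv hp)

theorem integral_pow_mul_const (n : ℕ) (c : ℝ) :
    ∫ t in (0 : ℝ)..1, t ^ n * c = c / (n + 1) := by
  rw [intervalIntegral.integral_mul_const, integral_pow]
  simp [div_eq_inv_mul]

theorem norm_segmentMean_le (hconv : Convex ℝ D) (hℓ : MapsTo ℓ D D) {C : ℝ}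
    (hC : ∀ p ∈ D, ‖u p‖ ≤ C) (hp : p ∈ D) : ‖segmentMean n ℓ u p‖ ≤ C / (n + 1) := by
  rw [← integral_pow_mul_const]
  refine intervalIntegral.norm_integral_le_of_norm_le zero_le_one (.of_forall fun t ht => ?_)
    (Continuous.intervalIntegrable (by fun_prop) _ _)
  rw [norm_mul, norm_pow, norm_real, Real.norm_of_nonneg ht.1.le]
  have := hC _ (hconv.add_smul_sub_mem (hℓ hp) hp ⟨ht.1.le, ht.2⟩)
  have := ht.1.le
  gcongr

theorem le_re_segmentMean (hconv : Convex ℝ D) (hℓ : MapsTo ℓ D D) (hu : ContinuousOn u D) {c : ℝ}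
    (hc : ∀ p ∈ D, c ≤ (u p).re) (hp : p ∈ D) : c / (n + 1) ≤ (segmentMean n ℓ u p).re := by
  have hint := intervalIntegrable_segmentMean (n := n) hconv hℓ hu hp
  rw [← integral_pow_mul_const, segmentMean, ← reCLM_apply, ← reCLM.intervalIntegral_comp_comm hint]
  refine intervalIntegral.integral_mono_on zero_le_one
    (Continuous.intervalIntegrable (by fun_prop) _ _)
    ⟨reCLM.integrable_comp hint.1, reCLM.integrable_comp hint.2⟩ fun t ht => ?_
  rw [reCLM_apply, ← ofReal_pow, re_ofReal_mul]
  exact mul_le_mul_of_nonneg_left (hc _ (hconv.add_smul_sub_mem (hℓ hp) hp ht)) (pow_nonneg ht.1 n)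

end SegmentMean

/-- The projection `(z, w) ↦ (z, z)` to the diagonal. -/
noncomputable def diagFst : ℂ × ℂ →L[ℂ] ℂ × ℂ := (ContinuousLinearMap.fst ℂ ℂ ℂ).prod (.fst ℂ ℂ ℂ)

/-- The projection `(z, w) ↦ (w, w)` to the diagonal. -/
noncomputable def diagSnd : ℂ × ℂ →L[ℂ] ℂ × ℂ := (ContinuousLinearMap.snd ℂ ℂ ℂ).prod (.snd ℂ ℂ ℂ)

theorem hasDerivAt_segmentMean_diagFst {D : Set (ℂ × ℂ)} (hD : IsOpen D) (hconv : Convex ℝ D)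
    (hℓ : MapsTo diagFst D D) {u : ℂ × ℂ → ℂ} (hu : DifferentiableOn ℂ u D) {p : ℂ × ℂ}
    (hp : p ∈ D) :
    HasDerivAt (fun w => -(p.1 - w) * segmentMean 0 diagFst u (p.1, w)) (u p) p.2 := by
  have hU : IsOpen ((fun w : ℂ => (p.1, w)) ⁻¹' D) := hD.preimage (by fun_prop)
  have hstar : StarConvex ℝ p.1 ((fun w : ℂ => (p.1, w)) ⁻¹' D) := by
    intro w hw a b ha hb hab
    have heq : a • diagFst (p.1, w) + b • (p.1, w) = (p.1, a • p.1 + b • w) := by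
      ext1 <;> simp [diagFst, ← add_mul, ← ofReal_add, hab]
    have hmem := hconv (hℓ (show (p.1, w) ∈ D from hw)) hw ha hb hab
    rwa [heq] at hmem
  convert! hasDerivAt_integral_ray hU hstar (g := fun w => u (p.1, w))
    (hu.comp (by fun_prop) fun _ hw => hw) (z := p.2) hp using 1
  funext w
  simp [segmentMean, diagFst]

theorem hasDerivAt_segmentMean_diagSnd {D : Set (ℂ × ℂ)} (hD : IsOpen D) (hconv : Convex ℝ D)
    (hℓ : MapsTo diagSnd D D) {u : ℂ × ℂ → ℂ} (hu : DifferentiableOn ℂ u D) {p : ℂ × ℂ}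
    (hp : p ∈ D) :
    HasDerivAt (fun z => -(z - p.2) ^ 2 * segmentMean 1 diagSnd u (z, p.2))
      (-(p.1 - p.2) * u p) p.1 := by
  have hU : IsOpen ((fun z : ℂ => (z, p.2)) ⁻¹' D) := hD.preimage (by fun_prop)
  have hstar : StarConvex ℝ p.2 ((fun z : ℂ => (z, p.2)) ⁻¹' D) := by
    intro z hz a b ha hb hab
    have heq : a • diagSnd (z, p.2) + b • (z, p.2) = (a • p.2 + b • z, p.2) := by
      ext1 <;> simp [diagSnd, ← add_mul, ← ofReal_add, hab]
    have hmem := hconv (hℓ (show (z, p.2) ∈ D from hz)) hz ha hb hab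
    rwa [heq] at hmem
  convert! hasDerivAt_integral_ray hU hstar (g := fun z => -(z - p.2) * u (z, p.2))
    (DifferentiableOn.mul (by fun_prop) (hu.comp (by fun_prop) fun _ hw => hw)) (z := p.1) hp
    using 1
  funext z
  simp only [segmentMean, smul_eq_mul, ← intervalIntegral.integral_const_mul]
  refine intervalIntegral.integral_congr fun t _ => ?_
  simp [diagSnd]
  ring

/-- A neighborhood of the real diagonal in `ℂ × ℂ`, invariant under `(z, w) ↦ (z + 1, w + 1)`. -/
def diagStrip (r : ℝ) : Set (ℂ × ℂ) :=
  {p | |p.1.im| < r ∧ |p.2.im| < r ∧ |p.1.re - p.2.re| < r}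

theorem isOpen_diagStrip (r : ℝ) : IsOpen (diagStrip r) := by
  have h : ∀ {L : ℂ × ℂ → ℝ}, Continuous L → IsOpen {p | |L p| < r} := fun hL =>
    isOpen_lt hL.abs continuous_const
  exact (h (by fun_prop)).inter ((h (by fun_prop)).inter (h (by fun_prop)))

theorem convex_diagStrip (r : ℝ) : Convex ℝ (diagStrip r) := by
  have h : ∀ L : ℂ × ℂ →ₗ[ℝ] ℝ, Convex ℝ {p | |L p| < r} := fun L => by
    convert! (convex_ball 0 r).linear_preimage L using 1
    ext p
    simp
  exact (h (imLm ∘ₗ .fst ℝ ℂ ℂ)).inter ((h (imLm ∘ₗ .snd ℝ ℂ ℂ)).inter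
    (h (reLm ∘ₗ .fst ℝ ℂ ℂ - reLm ∘ₗ .snd ℝ ℂ ℂ)))

theorem diagStrip_mono {r r' : ℝ} (h : r ≤ r') : diagStrip r ⊆ diagStrip r' :=
  fun _ hp => ⟨hp.1.trans_le h, hp.2.1.trans_le h, hp.2.2.trans_le h⟩

theorem mapsTo_diagFst_diagStrip (r : ℝ) : MapsTo diagFst (diagStrip r) (diagStrip r) :=
  fun _ hp => ⟨hp.1, hp.1, by simpa [diagFst] using (abs_nonneg _).trans_lt hp.1⟩

theorem mapsTo_diagSnd_diagStrip (r : ℝ) : MapsTo diagSnd (diagStrip r) (diagStrip r) :=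
  fun _ hp => ⟨hp.2.1, hp.2.1, by simpa [diagSnd] using (abs_nonneg _).trans_lt hp.2.1⟩

theorem add_one_mem_diagStrip {r : ℝ} {p : ℂ × ℂ} (hp : p ∈ diagStrip r) :
    p + 1 ∈ diagStrip r := by
  simpa [diagStrip] using hp

/-- The antiholomorphic involution `(z, w) ↦ (w̄, z̄)`, whose fixed points are the `(z, z̄)`. -/
def conjSwap (p : ℂ × ℂ) : ℂ × ℂ := (conj p.2, conj p.1)

theorem conjSwap_mem_diagStrip {r : ℝ} {p : ℂ × ℂ} (hp : p ∈ diagStrip r) :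
    conjSwap p ∈ diagStrip r :=
  ⟨by simpa [conjSwap] using hp.2.1, by simpa [conjSwap] using hp.1,
    by simpa [conjSwap, abs_sub_comm] using hp.2.2⟩

theorem norm_sub_div_le_of_mem_diagStrip {r : ℝ} {p : ℂ × ℂ} (hp : p ∈ diagStrip r) :
    ‖(p.1 - p.2) / (2 * I)‖ ≤ 2 * r := by
  have hre : |(p.1 - p.2).re| < r := hp.2.2
  have him : |(p.1 - p.2).im| ≤ |p.1.im| + |p.2.im| := abs_sub _ _
  have hnorm := norm_le_abs_re_add_abs_im (p.1 - p.2)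
  have := hp.1
  have := hp.2.1
  rw [norm_div, norm_mul, norm_I, RCLike.norm_ofNat, mul_one]
  linarith [norm_nonneg (p.1 - p.2)]

/-! ### The Cauchy problem and Picard iteration -/

/-- The right half of a disc, on which the power `5 / 2` is Lipschitz. -/
def halfDisc (c M : ℝ) : Set ℂ := {z | ‖z‖ ≤ M ∧ c ≤ z.re}

theorem convex_halfDisc (c M : ℝ) : Convex ℝ (halfDisc c M) := by
  have hball : {z : ℂ | ‖z‖ ≤ M} = Metric.closedBall 0 M := by ext; simp
  exact (hball ▸ convex_closedBall 0 M).inter (convex_halfSpace_re_ge c)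

theorem isClosed_halfDisc (c M : ℝ) : IsClosed (halfDisc c M) :=
  (isClosed_le continuous_norm continuous_const).inter (isClosed_le continuous_const continuous_re)

theorem conj_mem_halfDisc {c M : ℝ} {z : ℂ} (hz : z ∈ halfDisc c M) :
    conj z ∈ halfDisc c M := by
  simpa [halfDisc] using hz

theorem mem_slitPlane_of_mem_halfDisc {c M : ℝ} (hc : 0 < c) {z : ℂ} (hz : z ∈ halfDisc c M) :
    z ∈ slitPlane := Or.inl (hc.trans_le hz.2)

theorem norm_cpow_le_of_mem_halfDisc {c M : ℝ} {x : ℝ} (hx : 0 ≤ x) {z : ℂ}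
    (hz : z ∈ halfDisc c M) : ‖z ^ (x : ℂ)‖ ≤ M ^ x := by
  rw [norm_cpow_real]
  exact Real.rpow_le_rpow (norm_nonneg _) hz.1 hx

theorem norm_cpow_sub_cpow_le_of_mem_halfDisc {c M x : ℝ} (hc : 0 < c) (hx : 1 ≤ x) {z w : ℂ}
    (hz : z ∈ halfDisc c M) (hw : w ∈ halfDisc c M) :
    ‖w ^ (x : ℂ) - z ^ (x : ℂ)‖ ≤ x * M ^ (x - 1) * ‖w - z‖ := by
  refine (convex_halfDisc c M).norm_image_sub_le_of_norm_hasDerivWithin_le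
    (fun ζ hζ => (hasStrictDerivAt_cpow_const
      (mem_slitPlane_of_mem_halfDisc hc hζ)).hasDerivAt.hasDerivWithinAt) (fun ζ hζ => ?_) hz hw
  rw [norm_mul, norm_real, Real.norm_of_nonneg (by linarith), ← ofReal_one, ← ofReal_sub]
  gcongr
  exact norm_cpow_le_of_mem_halfDisc (by linarith) hζ

/-- The mixed derivative `∂_w ∂_z K`; on the real plane `w = z̄` it is a quarter of the
Laplacian. -/
noncomputable def mixedDeriv (K : ℂ × ℂ → ℂ) (p : ℂ × ℂ) : ℂ :=
  deriv (fun w => deriv (fun z => K (z, w)) p.1) p.2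

/-- The complexification of `Δ ψ` for `ψ = y² v` with `Δ ψ = 2 + ε ψ ^ (5/2)` in the conformal
coordinate `s + i y` with conformal factor `m`; here `z = s + i y`, `w = s - i y`. -/
noncomputable def sourceTerm (m : ℂ × ℂ → ℂ) (ε : ℝ) (v : ℂ × ℂ → ℂ) (p : ℂ × ℂ) : ℂ :=
  m p * (2 + ε * ((p.1 - p.2) / (2 * I)) ^ 5 * v p ^ ((5 / 2 : ℝ) : ℂ))

/-- The quotient by `y² = -(z - w)² / 4` of the solution of `4 ∂_z ∂_w ψ = u` with zero Cauchy
data on the diagonal. -/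
noncomputable def cauchyQuotient (u : ℂ × ℂ → ℂ) : ℂ × ℂ → ℂ :=
  segmentMean 1 diagSnd (segmentMean 0 diagFst u)

/-- The function `p ↦ conj (V (conjSwap p))`, which agrees with `V` if `V` is real on `w = z̄`. -/
def conjReflect (V : ℂ × ℂ → ℂ) (p : ℂ × ℂ) : ℂ := conj (V (conjSwap p))

/-- One step of the Picard iteration, symmetrized so that functions that are real on `w = z̄` go
to such functions. -/
noncomputable def picardStep (m : ℂ × ℂ → ℂ) (ε : ℝ) (v : ℂ × ℂ → ℂ) (p : ℂ × ℂ) : ℂ :=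
  1 / 2 * (cauchyQuotient (sourceTerm m ε v) p + conjReflect (cauchyQuotient (sourceTerm m ε v)) p)

/-- The functions on `diagStrip r` among which the Picard iteration runs. -/
structure IsPicardAdmissible (r c M : ℝ) (v : ℂ × ℂ → ℂ) : Prop where
  analytic : AnalyticOnNhd ℂ v (diagStrip r)
  mem : ∀ p ∈ diagStrip r, v p ∈ halfDisc c M
  periodic : ∀ p ∈ diagStrip r, v (p + 1) = v p
  symm : ∀ p ∈ diagStrip r, conjReflect v p = v p

section Picard

variable {r c M ε : ℝ} {m u u' v v' : ℂ × ℂ → ℂ} {p : ℂ × ℂ}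

theorem IsPicardAdmissible.mono {r' c' M' : ℝ} (hv : IsPicardAdmissible r c M v) (hr : r' ≤ r)
    (hc : c' ≤ c) (hM : M ≤ M') : IsPicardAdmissible r' c' M' v where
  analytic := hv.analytic.mono (diagStrip_mono hr)
  mem p hp := ⟨(hv.mem p (diagStrip_mono hr hp)).1.trans hM,
    hc.trans (hv.mem p (diagStrip_mono hr hp)).2⟩
  periodic p hp := hv.periodic p (diagStrip_mono hr hp)
  symm p hp := hv.symm p (diagStrip_mono hr hp)

theorem IsPicardAdmissible.of_tendstoUniformlyOn {v : ℕ → ℂ × ℂ → ℂ} {w : ℂ × ℂ → ℂ}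
    (hv : ∀ n, IsPicardAdmissible r c M (v n))
    (hlim : TendstoUniformlyOn v w atTop (diagStrip r)) : IsPicardAdmissible r c M w where
  analytic := analyticOnNhd_of_tendstoUniformlyOn (isOpen_diagStrip r) (fun n => (hv n).analytic)
    hlim
  mem p hp := (isClosed_halfDisc c M).mem_of_tendsto (hlim.tendsto_at hp)
    (.of_forall fun n => (hv n).mem p hp)
  periodic p hp := tendsto_nhds_unique (hlim.tendsto_at (add_one_mem_diagStrip hp)) <| by
    simpa only [(hv _).periodic p hp] using hlim.tendsto_at hp
  symm p hp := tendsto_nhds_unique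
    ((continuous_conj.tendsto _).comp (hlim.tendsto_at (conjSwap_mem_diagStrip hp))) <|
      (hlim.tendsto_at hp).congr fun n => ((hv n).symm p hp).symm

theorem analyticOnNhd_conjReflect (hu : AnalyticOnNhd ℂ u (diagStrip r)) :
    AnalyticOnNhd ℂ (conjReflect u) (diagStrip r) := by
  refine analyticOnNhd_of_differentiableOn_prod (isOpen_diagStrip r) fun p hp =>
    DifferentiableAt.differentiableWithinAt ?_
  exact DifferentiableAt.comp_semilinear₂ (starL ℂ).toContinuousLinearMap
    (((ContinuousLinearMap.snd ℂ ℂ ℂ).prod (.fst ℂ ℂ ℂ)).comp (starL ℂ).toContinuousLinearMap)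
    (hu _ (conjSwap_mem_diagStrip hp)).differentiableAt

theorem analyticOnNhd_sourceTerm (hm : AnalyticOnNhd ℂ m (diagStrip r)) (hc : 0 < c)
    (hv : IsPicardAdmissible r c M v) : AnalyticOnNhd ℂ (sourceTerm m ε v) (diagStrip r) := by
  intro p hp
  have hy : AnalyticAt ℂ (fun p : ℂ × ℂ => (p.1 - p.2) / (2 * I)) p :=
    (analyticAt_fst.sub analyticAt_snd).div_const
  have hpow : AnalyticAt ℂ (fun p => v p ^ ((5 / 2 : ℝ) : ℂ)) p :=
    (hv.analytic p hp).cpow analyticAt_const (mem_slitPlane_of_mem_halfDisc hc (hv.mem p hp))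
  exact (hm p hp).mul (analyticAt_const.add ((analyticAt_const.mul (hy.pow 5)).mul hpow))

theorem sourceTerm_add_one (hm : ∀ p ∈ diagStrip r, m (p + 1) = m p)
    (hv : ∀ p ∈ diagStrip r, v (p + 1) = v p) (hp : p ∈ diagStrip r) :
    sourceTerm m ε v (p + 1) = sourceTerm m ε v p := by
  simp [sourceTerm, hm p hp, hv p hp]

theorem norm_sourceTerm_sub_le (hmM : ∀ p ∈ diagStrip r, ‖m p‖ ≤ M) (hε : |ε| ≤ 1)
    (hr : 2 * r ≤ 1) (hp : p ∈ diagStrip r) {a b : ℂ} {δ : ℝ} (hab : ‖a - b‖ ≤ δ) :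
    ‖m p * (2 + ε * ((p.1 - p.2) / (2 * I)) ^ 5 * a) -
      m p * (2 + ε * ((p.1 - p.2) / (2 * I)) ^ 5 * b)‖ ≤ 2 * (M * r * δ) := by
  have hy := norm_sub_div_le_of_mem_diagStrip hp
  have hM : 0 ≤ M := (norm_nonneg _).trans (hmM p hp)
  calc ‖m p * (2 + ε * ((p.1 - p.2) / (2 * I)) ^ 5 * a) -
        m p * (2 + ε * ((p.1 - p.2) / (2 * I)) ^ 5 * b)‖
      = ‖m p‖ * (|ε| * ‖(p.1 - p.2) / (2 * I)‖ ^ 5) * ‖a - b‖ := by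
        rw [← mul_sub, add_sub_add_left_eq_sub, ← mul_sub, norm_mul, norm_mul, norm_mul, norm_pow,
          norm_real, Real.norm_eq_abs]
        ring
    _ ≤ M * (1 * (2 * r)) * δ := by
        have hpow : ‖(p.1 - p.2) / (2 * I)‖ ^ 5 ≤ 2 * r :=
          (pow_le_of_le_one (norm_nonneg _) (hy.trans hr) (by norm_num)).trans hy
        have hr0 : 0 ≤ 2 * r := (norm_nonneg _).trans hy
        gcongr
        exact hmM p hp
    _ = 2 * (M * r * δ) := by ring

theorem analyticOnNhd_cauchyQuotient (hu : AnalyticOnNhd ℂ u (diagStrip r)) :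
    AnalyticOnNhd ℂ (cauchyQuotient u) (diagStrip r) :=
  analyticOnNhd_segmentMean (isOpen_diagStrip r) (convex_diagStrip r) (mapsTo_diagSnd_diagStrip r)
    (analyticOnNhd_segmentMean (isOpen_diagStrip r) (convex_diagStrip r)
      (mapsTo_diagFst_diagStrip r) hu)

theorem cauchyQuotient_add_one (hu : ∀ p ∈ diagStrip r, u (p + 1) = u p)
    (hp : p ∈ diagStrip r) : cauchyQuotient u (p + 1) = cauchyQuotient u p :=
  segmentMean_add_of_periodic (convex_diagStrip r) (mapsTo_diagSnd_diagStrip r) rfl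
    (fun _ hq => segmentMean_add_of_periodic (convex_diagStrip r) (mapsTo_diagFst_diagStrip r) rfl
      hu hq) hp

theorem cauchyQuotient_sub (hu : AnalyticOnNhd ℂ u (diagStrip r))
    (hu' : AnalyticOnNhd ℂ u' (diagStrip r)) (hp : p ∈ diagStrip r) :
    cauchyQuotient (u - u') p = cauchyQuotient u p - cauchyQuotient u' p := by
  have hmean : ∀ {u}, AnalyticOnNhd ℂ u (diagStrip r) →
      ContinuousOn (segmentMean 0 diagFst u) (diagStrip r) := fun hu =>
    (analyticOnNhd_segmentMean (isOpen_diagStrip r) (convex_diagStrip r)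
      (mapsTo_diagFst_diagStrip r) hu).continuousOn
  rw [cauchyQuotient, cauchyQuotient, cauchyQuotient, ← segmentMean_sub (convex_diagStrip r)
    (mapsTo_diagSnd_diagStrip r) (hmean hu) (hmean hu') hp]
  exact segmentMean_congr (convex_diagStrip r) (mapsTo_diagSnd_diagStrip r) (fun _ hq =>
    segmentMean_sub (convex_diagStrip r) (mapsTo_diagFst_diagStrip r) hu.continuousOn
      hu'.continuousOn hq) hp

theorem norm_cauchyQuotient_le {C : ℝ} (hC : ∀ p ∈ diagStrip r, ‖u p‖ ≤ C)
    (hp : p ∈ diagStrip r) : ‖cauchyQuotient u p‖ ≤ C / 2 := by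
  refine (norm_segmentMean_le (convex_diagStrip r) (mapsTo_diagSnd_diagStrip r) (fun q hq =>
    norm_segmentMean_le (convex_diagStrip r) (mapsTo_diagFst_diagStrip r) hC hq) hp).trans_eq ?_
  norm_num

theorem le_re_cauchyQuotient (hu : AnalyticOnNhd ℂ u (diagStrip r))
    (hc : ∀ p ∈ diagStrip r, c ≤ (u p).re) (hp : p ∈ diagStrip r) :
    c / 2 ≤ (cauchyQuotient u p).re := by
  refine (le_re_segmentMean (convex_diagStrip r) (mapsTo_diagSnd_diagStrip r)
    (analyticOnNhd_segmentMean (isOpen_diagStrip r) (convex_diagStrip r)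
      (mapsTo_diagFst_diagStrip r) hu).continuousOn (fun q hq =>
    le_re_segmentMean (convex_diagStrip r) (mapsTo_diagFst_diagStrip r) hu.continuousOn hc hq)
    hp).trans_eq' ?_
  norm_num

theorem cauchyQuotient_sourceTerm_mem_halfDisc (hc : 0 < c) (hcM : c ≤ M)
    (hm : IsPicardAdmissible r (2 * c) M m) (hε : |ε| ≤ 1) (hr : 2 * r ≤ 1)
    (hsmall : M * r * (2 * M) ^ (5 / 2 : ℝ) ≤ c) (hv : IsPicardAdmissible r c (2 * M) v)
    (hp : p ∈ diagStrip r) : cauchyQuotient (sourceTerm m ε v) p ∈ halfDisc c (2 * M) := by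
  have hu := analyticOnNhd_sourceTerm (ε := ε) hm.analytic hc hv
  have hu₀ : AnalyticOnNhd ℂ (fun p => m p * 2) (diagStrip r) :=
    hm.analytic.mul analyticOnNhd_const
  have hdiff : ‖cauchyQuotient (sourceTerm m ε v) p - cauchyQuotient (fun p => m p * 2) p‖ ≤ c := by
    rw [← cauchyQuotient_sub hu hu₀ hp]
    refine (norm_cauchyQuotient_le (C := 2 * (M * r * (2 * M) ^ (5 / 2 : ℝ))) (fun q hq => ?_)
      hp).trans (by linarith)
    have hpow := norm_cpow_le_of_mem_halfDisc (x := 5 / 2) (by norm_num) (hv.mem q hq)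
    have hsub := norm_sourceTerm_sub_le (ε := ε) (b := 0) (fun p hp => (hm.mem p hp).1) hε hr hq
      ((sub_zero (v q ^ ((5 / 2 : ℝ) : ℂ))).symm ▸ hpow)
    rwa [mul_zero, add_zero] at hsub
  have hnorm : ‖cauchyQuotient (fun p => m p * 2) p‖ ≤ M * 2 / 2 := by
    refine norm_cauchyQuotient_le (fun q hq => ?_) hp
    rw [norm_mul, RCLike.norm_ofNat]
    linarith [(hm.mem q hq).1]
  have hre : 2 * c * 2 / 2 ≤ (cauchyQuotient (fun p => m p * 2) p).re := by
    refine le_re_cauchyQuotient hu₀ (fun q hq => ?_) hp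
    rw [← ofReal_ofNat, re_mul_ofReal]
    linarith [(hm.mem q hq).2]
  refine ⟨?_, ?_⟩
  · linarith [norm_le_norm_add_norm_sub' (cauchyQuotient (sourceTerm m ε v) p)
      (cauchyQuotient (fun p => m p * 2) p)]
  · have := (abs_le.1 ((abs_re_le_norm _).trans hdiff)).1
    rw [sub_re] at this
    linarith

theorem isPicardAdmissible_picardStep (hc : 0 < c) (hcM : c ≤ M)
    (hm : IsPicardAdmissible r (2 * c) M m) (hε : |ε| ≤ 1) (hr : 2 * r ≤ 1)
    (hsmall : M * r * (2 * M) ^ (5 / 2 : ℝ) ≤ c) (hv : IsPicardAdmissible r c (2 * M) v) :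
    IsPicardAdmissible r c (2 * M) (picardStep m ε v) := by
  have hmem : ∀ {p}, p ∈ diagStrip r → cauchyQuotient (sourceTerm m ε v) p ∈ halfDisc c (2 * M) :=
    fun hp => cauchyQuotient_sourceTerm_mem_halfDisc hc hcM hm hε hr hsmall hv hp
  have hperiodic : ∀ {p}, p ∈ diagStrip r → cauchyQuotient (sourceTerm m ε v) (p + 1) =
      cauchyQuotient (sourceTerm m ε v) p := fun hp =>
    cauchyQuotient_add_one (fun p hp => sourceTerm_add_one hm.periodic hv.periodic hp) hp
  have hQ := analyticOnNhd_cauchyQuotient (analyticOnNhd_sourceTerm (ε := ε) hm.analytic hc hv)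
  refine ⟨analyticOnNhd_const.mul (hQ.add (analyticOnNhd_conjReflect hQ)), fun p hp => ?_,
    fun p hp => ?_, fun p _ => ?_⟩
  · convert! convex_halfDisc c (2 * M) (hmem hp)
      (conj_mem_halfDisc (hmem (conjSwap_mem_diagStrip hp))) (a := 1 / 2) (b := 1 / 2)
      (by norm_num) (by norm_num) (by norm_num) using 1
    simp [picardStep, conjReflect, mul_add]
  · have hswap : conjSwap (p + 1) = conjSwap p + 1 := by simp [conjSwap, Prod.ext_iff]
    simp only [picardStep, conjReflect, hswap, hperiodic hp, hperiodic (conjSwap_mem_diagStrip hp)]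
  · simp only [picardStep, conjReflect, conjSwap, map_mul, map_add, conj_conj, map_div₀, map_one,
      map_ofNat]
    ring

theorem norm_picardStep_sub_le (hc : 0 < c) (hm : IsPicardAdmissible r (2 * c) M m)
    (hε : |ε| ≤ 1) (hr : 2 * r ≤ 1)
    (hsmall : M * r * (5 / 2 * (2 * M) ^ (3 / 2 : ℝ)) ≤ 1 / 2)
    (hv : IsPicardAdmissible r c (2 * M) v) (hv' : IsPicardAdmissible r c (2 * M) v') {δ : ℝ}
    (hδ : ∀ p ∈ diagStrip r, ‖v p - v' p‖ ≤ δ) (hp : p ∈ diagStrip r) :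
    ‖picardStep m ε v p - picardStep m ε v' p‖ ≤ δ / 2 := by
  have hu := analyticOnNhd_sourceTerm (ε := ε) hm.analytic hc hv
  have hu' := analyticOnNhd_sourceTerm (ε := ε) hm.analytic hc hv'
  have hquot : ∀ q ∈ diagStrip r, ‖cauchyQuotient (sourceTerm m ε v) q -
      cauchyQuotient (sourceTerm m ε v') q‖ ≤ δ / 2 := by
    intro q hq
    rw [← cauchyQuotient_sub hu hu' hq]
    refine (norm_cauchyQuotient_le (C := 2 * (M * r * (5 / 2 * (2 * M) ^ (3 / 2 : ℝ) * δ)))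
      (fun x hx => norm_sourceTerm_sub_le (fun p hp => (hm.mem p hp).1) hε hr hx ?_) hq).trans ?_
    · have hlip := norm_cpow_sub_cpow_le_of_mem_halfDisc (x := 5 / 2) hc (by norm_num)
        (hv'.mem x hx) (hv.mem x hx)
      have h0 : 0 ≤ 2 * M := (norm_nonneg _).trans (hv.mem x hx).1
      norm_num at hlip
      have := hδ x hx
      push_cast
      exact hlip.trans (by gcongr)
    · linarith [mul_le_mul_of_nonneg_right hsmall ((norm_nonneg _).trans (hδ p hp))]
  have hsum := norm_add_le (cauchyQuotient (sourceTerm m ε v) p -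
    cauchyQuotient (sourceTerm m ε v') p) (conj (cauchyQuotient (sourceTerm m ε v)
      (conjSwap p) - cauchyQuotient (sourceTerm m ε v') (conjSwap p)))
  rw [RCLike.norm_conj] at hsum
  rw [picardStep, picardStep, conjReflect, conjReflect, ← mul_sub, add_sub_add_comm, ← map_sub,
    norm_mul, norm_div, norm_one, RCLike.norm_ofNat]
  linarith [hquot p hp, hquot _ (conjSwap_mem_diagStrip hp)]

theorem exists_eqOn_fixedPoint {X E : Type*} [MetricSpace E] [CompleteSpace E] {S : Set X}
    {P : (X → E) → Prop} {T : (X → E) → X → E}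
    (hlim : ∀ (v : ℕ → X → E) w, (∀ n, P (v n)) → TendstoUniformlyOn v w atTop S → P w)
    (hT : ∀ v, P v → P (T v))
    (hdist : ∀ v v', P v → P v' → ∀ δ, (∀ x ∈ S, dist (v x) (v' x) ≤ δ) →
      ∀ x ∈ S, dist (T v x) (T v' x) ≤ δ / 2)
    {v₀ : X → E} {C : ℝ} (h₀ : P v₀) (hC : ∀ x ∈ S, dist (v₀ x) (T v₀ x) ≤ C) :
    ∃ w, P w ∧ EqOn (T w) w S := by
  have hP : ∀ n, P (T^[n] v₀) := fun n => by
    induction n with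
    | zero => exact h₀
    | succ n ih => exact Function.iterate_succ_apply' T n v₀ ▸ hT _ ih
  have hstep : ∀ n, ∀ x ∈ S, dist (T^[n] v₀ x) (T^[n + 1] v₀ x) ≤ 2 * C / 2 / 2 ^ n := by
    intro n
    induction n with
    | zero => simpa using hC
    | succ n ih =>
      intro x hx
      rw [Function.iterate_succ_apply' T (n + 1), Function.iterate_succ_apply' T n, pow_succ,
        ← div_div]
      exact hdist _ _ (hP n) (Function.iterate_succ_apply' T n v₀ ▸ hP (n + 1)) _
        (Function.iterate_succ_apply' T n v₀ ▸ ih) x hx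
  have hex : ∀ x, ∃ a, x ∈ S → Tendsto (fun n => T^[n] v₀ x) atTop (𝓝 a) := fun x => by
    by_cases hx : x ∈ S
    · exact (cauchySeq_tendsto_of_complete
        (cauchySeq_of_le_geometric_two fun n => hstep n x hx)).imp fun _ h _ => h
    · exact ⟨v₀ x, fun h => absurd h hx⟩
  choose w hw using hex
  have hrate : ∀ n, ∀ x ∈ S, dist (T^[n] v₀ x) (w x) ≤ 2 * C / 2 ^ n := fun n x hx =>
    dist_le_of_le_geometric_two_of_tendsto (fun n => hstep n x hx) (hw x hx) n
  have hgeo : Tendsto (fun n : ℕ => 2 * C / 2 ^ n) atTop (𝓝 0) :=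
    tendsto_const_nhds.div_atTop (tendsto_pow_atTop_atTop_of_one_lt one_lt_two)
  have hPw : P w := hlim _ w hP <| Metric.tendstoUniformlyOn_iff.2 fun e he => by
    filter_upwards [hgeo.eventually (gt_mem_nhds he)] with n hn x hx
    exact (dist_comm _ _).trans_le (hrate n x hx) |>.trans_lt hn
  refine ⟨w, hPw, fun x hx => tendsto_nhds_unique (f := fun n => T^[n + 1] v₀ x) ?_
    ((hw x hx).comp (tendsto_add_atTop_nat 1))⟩
  refine tendsto_iff_dist_tendsto_zero.2 (squeeze_zero (fun _ => dist_nonneg) (fun n => ?_)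
    (by simpa using hgeo.div_const 2))
  simp only [Function.iterate_succ_apply']
  exact hdist _ _ (hP n) hPw _ (hrate n) x hx

theorem exists_fixedPoint_picardStep (hc : 0 < c) (hcM : c ≤ M)
    (hm : IsPicardAdmissible r (2 * c) M m) (hε : |ε| ≤ 1) (hr : 2 * r ≤ 1)
    (hsmall : M * r * (2 * M) ^ (5 / 2 : ℝ) ≤ c)
    (hsmall' : M * r * (5 / 2 * (2 * M) ^ (3 / 2 : ℝ)) ≤ 1 / 2) :
    ∃ v, IsPicardAdmissible r c (2 * M) v ∧ EqOn (picardStep m ε v) v (diagStrip r) := by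
  have h₀ : IsPicardAdmissible r c (2 * M) fun _ => c :=
    ⟨analyticOnNhd_const, fun _ _ => ⟨by simpa [abs_of_pos hc] using by linarith, by simp⟩,
      fun _ _ => rfl, fun _ _ => conj_ofReal c⟩
  have hstep := fun v => isPicardAdmissible_picardStep (v := v) hc hcM hm hε hr hsmall
  refine exists_eqOn_fixedPoint (fun _ _ => .of_tendstoUniformlyOn) hstep
    (fun v v' hv hv' δ hδ p hp => ?_) h₀ (C := 2 * M + 2 * M) fun p hp => ?_
  · simp only [dist_eq_norm] at hδ ⊢
    exact norm_picardStep_sub_le hc hm hε hr hsmall' hv hv' hδ hp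
  · exact (dist_le_norm_add_norm _ _).trans
      (add_le_add (h₀.mem p hp).1 ((hstep _ h₀).mem p hp).1)

theorem eventually_mul_mul_le (a b : ℝ) {c : ℝ} (hc : 0 < c) :
    ∀ᶠ r in 𝓝[>] (0 : ℝ), a * r * b ≤ c := by
  have h : Tendsto (fun r : ℝ => a * r * b) (𝓝[>] 0) (𝓝 0) :=
    (Continuous.tendsto' (by fun_prop) 0 0 (by simp)).mono_left nhdsWithin_le_nhds
  exact h.eventually_le_const hc

/-- The solution `y² · cauchyQuotient u` of `4 ∂_z ∂_w ψ = u` with zero Cauchy data on the diagonal,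
where `y = (z - w) / 2i`. -/
noncomputable def cauchySolution (u : ℂ × ℂ → ℂ) (p : ℂ × ℂ) : ℂ :=
  -(p.1 - p.2) ^ 2 / 4 * cauchyQuotient u p

theorem analyticOnNhd_cauchySolution (hu : AnalyticOnNhd ℂ u (diagStrip r)) :
    AnalyticOnNhd ℂ (cauchySolution u) (diagStrip r) :=
  ((analyticOnNhd_fst.sub analyticOnNhd_snd).pow 2).neg.div_const.mul
    (analyticOnNhd_cauchyQuotient hu)

theorem hasDerivAt_cauchySolution (hu : AnalyticOnNhd ℂ u (diagStrip r))
    (hp : p ∈ diagStrip r) :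
    HasDerivAt (fun z => cauchySolution u (z, p.2))
      (-(p.1 - p.2) / 4 * segmentMean 0 diagFst u p) p.1 := by
  have h := (hasDerivAt_segmentMean_diagSnd (isOpen_diagStrip r) (convex_diagStrip r)
    (mapsTo_diagSnd_diagStrip r) (analyticOnNhd_segmentMean (n := 0) (isOpen_diagStrip r)
      (convex_diagStrip r) (mapsTo_diagFst_diagStrip r) hu).differentiableOn hp).div_const 4
  convert! h using 1
  · funext z
    simp only [cauchySolution, cauchyQuotient]
    ring
  · ring

theorem mixedDeriv_cauchySolution (hu : AnalyticOnNhd ℂ u (diagStrip r))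
    (hp : p ∈ diagStrip r) : mixedDeriv (cauchySolution u) p = u p / 4 := by
  have h := (hasDerivAt_segmentMean_diagFst (isOpen_diagStrip r) (convex_diagStrip r)
    (mapsTo_diagFst_diagStrip r) hu.differentiableOn hp).div_const 4
  have hnear : ∀ᶠ w in 𝓝 p.2, (p.1, w) ∈ diagStrip r :=
    (Continuous.continuousAt (by fun_prop)).preimage_mem_nhds ((isOpen_diagStrip r).mem_nhds hp)
  refine (h.congr_of_eventuallyEq (hnear.mono fun w hw => ?_)).deriv
  simp only [(hasDerivAt_cauchySolution hu hw).deriv]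
  ring

theorem re_cauchySolution_conj (hfix : EqOn (picardStep m ε v) v (diagStrip r)) {z : ℂ}
    (hz : |z.im| < r) :
    (cauchySolution (sourceTerm m ε v) (z, conj z)).re =
      z.im ^ 2 * (v (z, conj z)).re := by
  have hp : (z, conj z) ∈ diagStrip r :=
    ⟨hz, by simpa, by simpa using (abs_nonneg _).trans_lt hz⟩
  have hre : (picardStep m ε v (z, conj z)).re =
      (cauchyQuotient (sourceTerm m ε v) (z, conj z)).re := by
    rw [picardStep, conjReflect, conjSwap, conj_conj, add_conj, ← ofReal_one, ← ofReal_ofNat,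
      ← ofReal_div, ← ofReal_mul, ofReal_re]
    ring
  have hy : -(z - conj z) ^ 2 / 4 = ((z.im ^ 2 : ℝ) : ℂ) := by
    rw [sub_conj, mul_pow, I_sq]
    push_cast
    ring
  rw [cauchySolution, hy, re_ofReal_mul, ← hre, hfix hp]

theorem exists_strip_fixedPoint_picardStep (hr : 0 < r) (hc : 0 < c)
    (hm : IsPicardAdmissible r (2 * c) M m) (hε : |ε| ≤ 1) :
    ∃ r', 0 < r' ∧ r' ≤ r ∧ ∃ v, IsPicardAdmissible r' c (2 * M) v ∧
      EqOn (picardStep m ε v) v (diagStrip r') := by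
  have h0 := hm.mem 0 ⟨by simpa, by simpa, by simpa⟩
  have hcM : c ≤ M := by linarith [h0.1, h0.2, re_le_norm (m 0)]
  obtain ⟨r', hsmall, hsmall', hhalf, hr'⟩ := ((eventually_mul_mul_le M _ hc).and <|
    (eventually_mul_mul_le M _ one_half_pos).and <| (eventually_mul_mul_le 2 1 one_pos).and <|
      Ioo_mem_nhdsGT hr).exists
  exact ⟨r', hr'.1, hr'.2.le, exists_fixedPoint_picardStep hc hcM
    (hm.mono hr'.2.le le_rfl le_rfl) hε (by simpa using hhalf) hsmall hsmall'⟩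

end Picard

/-! ### The conformal strip of an analytic Jordan curve -/

theorem exists_analyticAt_complexification {γ : ℝ → ℂ} {s₀ : ℝ} (hγ : AnalyticAt ℝ γ s₀) :
    ∃ f : ℂ → ℂ, AnalyticAt ℂ f s₀ ∧ ∀ᶠ s : ℝ in 𝓝 s₀, f s = γ s := by
  obtain ⟨p, hp⟩ := hγ
  set q : FormalMultilinearSeries ℂ ℂ ℂ := FormalMultilinearSeries.ofScalars ℂ p.coeff with hq
  have hnorm : ∀ n, ‖q n‖ = ‖p n‖ := fun n => by
    rw [hq, FormalMultilinearSeries.ofScalars_norm, p.norm_apply_eq_norm_coef]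
  have hrad : 0 < q.radius := by
    have : q.radius = p.radius := by simp only [FormalMultilinearSeries.radius, hnorm]
    exact this ▸ hp.radius_pos
  have hsum := (q.hasFPowerSeriesOnBall hrad).comp_sub (s₀ : ℂ)
  rw [zero_add] at hsum
  refine ⟨_, hsum.analyticAt, ?_⟩
  filter_upwards [hasFPowerSeriesAt_iff'.1 hp,
    (continuous_ofReal.tendsto s₀).eventually (Metric.eball_mem_nhds _ hrad)] with s hs hmem
  refine (hsum.hasSum_sub hmem).unique ?_
  convert! hs using 2 with n
  rw [hq, FormalMultilinearSeries.ofScalars_apply_eq, smul_eq_mul, mul_comm, real_smul]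
  push_cast
  rfl

theorem eventually_iteratedDeriv_ofReal {γ : ℝ → ℂ} {f : ℂ → ℂ} {s₀ : ℝ}
    (hf : AnalyticAt ℂ f s₀) (hfγ : ∀ᶠ s : ℝ in 𝓝 s₀, f s = γ s) (n : ℕ) :
    ∀ᶠ s : ℝ in 𝓝 s₀, iteratedDeriv n f s = iteratedDeriv n γ s := by
  induction n with
  | zero => simpa using hfγ
  | succ n ih =>
    filter_upwards [ih.eventually_nhds,
      (continuous_ofReal.tendsto s₀).eventually hf.eventually_analyticAt] with s hs hfs
    have hderiv : HasDerivAt (iteratedDeriv n f) (iteratedDeriv (n + 1) f s) s := by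
      rw [iteratedDeriv_succ, iteratedDeriv_eq_iterate]
      exact (hfs.iterated_deriv n).differentiableAt.hasDerivAt
    rw [iteratedDeriv_succ (f := γ)]
    exact (hderiv.comp_ofReal.congr_of_eventuallyEq (hs.mono fun t ht => ht.symm)).deriv.symm

/-- The holomorphic extension of a real-analytic function of a real variable to a neighborhood
of the real line, by the Taylor series at the nearest real point. -/
noncomputable def holomorphicExtension (γ : ℝ → ℂ) (z : ℂ) : ℂ :=
  ∑' n : ℕ, (n.factorial : ℂ)⁻¹ • (z - z.re) ^ n • iteratedDeriv n γ z.re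

theorem holomorphicExtension_eq {γ : ℝ → ℂ} {f : ℂ → ℂ} {z : ℂ} {r : ℝ}
    (hf : AnalyticOnNhd ℂ f (Metric.ball z.re r)) (hfγ : ∀ᶠ s : ℝ in 𝓝 z.re, f s = γ s)
    (hz : |z.im| < r) : holomorphicExtension γ z = f z := by
  have hfz := hf _ (Metric.mem_ball_self ((abs_nonneg _).trans_lt hz))
  have hmem : z ∈ Metric.ball (z.re : ℂ) r := by
    rwa [Metric.mem_ball, dist_of_re_eq (ofReal_re _).symm, ofReal_im, Real.dist_0_eq_abs]
  rw [← taylorSeries_eq_on_ball hf.differentiableOn hmem, holomorphicExtension]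
  simp only [(eventually_iteratedDeriv_ofReal hfz hfγ _).self_of_nhds]

theorem analyticAt_holomorphicExtension {γ : ℝ → ℂ} {s₀ : ℝ} (hγ : AnalyticAt ℝ γ s₀) :
    AnalyticAt ℂ (holomorphicExtension γ) s₀ := by
  obtain ⟨f, hf, hfγ⟩ := exists_analyticAt_complexification hγ
  obtain ⟨R, hR, hball⟩ := Metric.eventually_nhds_iff_ball.1 hf.eventually_analyticAt
  have hre : Tendsto re (𝓝 (s₀ : ℂ)) (𝓝 s₀) := continuous_re.tendsto' _ _ (ofReal_re s₀)
  refine hf.congr ?_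
  filter_upwards [hre.eventually hfγ.eventually_nhds,
    hre.eventually (Metric.ball_mem_nhds s₀ (half_pos hR)),
    (continuous_im.abs.tendsto' (s₀ : ℂ) 0 (by simp)).eventually_lt_const (half_pos hR)]
    with z hfz hz hz'
  refine (holomorphicExtension_eq (r := R / 2) (fun w hw => hball w ?_) hfz hz').symm
  refine Metric.ball_subset_ball' ?_ hw
  rw [dist_of_im_eq (by simp), ofReal_re, ofReal_re]
  linarith [Metric.mem_ball.1 hz]

theorem holomorphicExtension_ofReal (γ : ℝ → ℂ) (s : ℝ) : holomorphicExtension γ s = γ s := by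
  rw [holomorphicExtension, tsum_eq_single 0 fun n hn => by simp [hn]]
  simp

theorem periodic_holomorphicExtension {γ : ℝ → ℂ} (hγ : Function.Periodic γ 1) :
    Function.Periodic (holomorphicExtension γ) 1 := fun z => by
  have h : ∀ n, iteratedDeriv n γ (z.re + 1) = iteratedDeriv n γ z.re := fun n => by
    have hshift := congrFun (iteratedDeriv_comp_add_const n γ 1) z.re
    rw [funext hγ] at hshift
    exact hshift.symm
  simp [holomorphicExtension, h]

theorem deriv_holomorphicExtension_ofReal {γ : ℝ → ℂ} {s : ℝ} (hγ : AnalyticAt ℝ γ s) :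
    deriv (holomorphicExtension γ) s = deriv γ s := by
  simpa using (eventually_iteratedDeriv_ofReal (analyticAt_holomorphicExtension hγ)
    (.of_forall fun s => holomorphicExtension_ofReal γ s) 1).self_of_nhds

/-- By `hcover`, up to a symmetry of `P` every point of the range of `L` lies in `L '' K`. -/
theorem exists_forall_dist_lt_of_eventually {A E : Type*} [TopologicalSpace A]
    [SeminormedAddCommGroup E] {K : Set A} (hK : IsCompact K) {L : A → E} (hL : Continuous L)
    {P : E → Prop} (hcover : ∀ a, ∃ k ∈ K, ∀ x, P (x + (L k - L a)) → P x)
    (h : ∀ k ∈ K, ∀ᶠ x in 𝓝 (L k), P x) : ∃ r > 0, ∀ a x, dist x (L a) < r → P x := by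
  have hP : {x | P x} ∈ 𝓝ˢ (L '' K) := mem_nhdsSet_iff_forall.2 (forall_mem_image.2 h)
  obtain ⟨r, hr, hsub⟩ := (Metric.hasBasis_nhdsSet_thickening (hK.image hL)).mem_iff.1 hP
  refine ⟨r, hr, fun a x hx => ?_⟩
  obtain ⟨k, hk, hPk⟩ := hcover a
  refine hPk x (hsub (Metric.mem_thickening_iff.2 ⟨L k, mem_image_of_mem L hk, ?_⟩))
  rwa [dist_eq_norm, show x + (L k - L a) - L k = x - L a by abel, ← dist_eq_norm]

/-- A holomorphic function on the strip `|Im z| < r` which is the universal cover of a conformal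
parametrization of a neighborhood of a closed curve. -/
structure IsConformalStrip (G : ℂ → ℂ) (r : ℝ) : Prop where
  pos : 0 < r
  analytic : ∀ z : ℂ, |z.im| < r → AnalyticAt ℂ G z
  periodic : Function.Periodic G 1
  deriv_ne : ∀ z : ℂ, |z.im| < r → deriv G z ≠ 0
  inj : ∀ z w : ℂ, |z.im| < r → |w.im| < r → G z = G w → ∃ n : ℤ, z = w + n

/-- The polarization of the conformal factor `|G'|²`. -/
noncomputable def conformalFactor (G : ℂ → ℂ) (p : ℂ × ℂ) : ℂ :=
  deriv G p.1 * conjReflect (fun q => deriv G q.1) p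

theorem IsConformalStrip.mono {G : ℂ → ℂ} {r r' : ℝ} (h : IsConformalStrip G r) (hr' : 0 < r')
    (hle : r' ≤ r) : IsConformalStrip G r' :=
  ⟨hr', fun z hz => h.analytic z (hz.trans_le hle), h.periodic,
    fun z hz => h.deriv_ne z (hz.trans_le hle),
    fun z w hz hw => h.inj z w (hz.trans_le hle) (hw.trans_le hle)⟩

theorem periodic_deriv {G : ℂ → ℂ} {c : ℂ} (h : Function.Periodic G c) :
    Function.Periodic (deriv G) c := fun z => by
  rw [← deriv_comp_add_const, funext h]

theorem periodic_add_int {E : Type*} {G : ℂ → E} (h : Function.Periodic G 1) (z : ℂ) (n : ℤ) :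
    G (z + n) = G z := by
  simpa using h.int_mul n z

theorem exists_strip_analyticAt_deriv_ne_zero {G : ℂ → ℂ} (hper : Function.Periodic G 1)
    (hG : ∀ a : ℝ, AnalyticAt ℂ G a) (hG' : ∀ a : ℝ, deriv G a ≠ 0) :
    ∃ r > 0, ∀ z : ℂ, |z.im| < r → AnalyticAt ℂ G z ∧ deriv G z ≠ 0 := by
  obtain ⟨r, hr, h⟩ := exists_forall_dist_lt_of_eventually (isCompact_Icc (a := (0 : ℝ)) (b := 1))
    continuous_ofReal (P := fun z => AnalyticAt ℂ G z ∧ deriv G z ≠ 0) (fun a => by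
      refine ⟨Int.fract a, ⟨Int.fract_nonneg a, (Int.fract_lt_one a).le⟩, fun z ⟨h, h'⟩ => ?_⟩
      have hshift : (Int.fract a - a : ℂ) = (-⌊a⌋ : ℤ) := by
        rw [← Int.self_sub_floor]; push_cast; ring
      rw [hshift] at h h'
      rw [periodic_add_int (periodic_deriv hper)] at h'
      refine ⟨?_, h'⟩
      have := AnalyticAt.fun_comp (f := fun w : ℂ => w + (-⌊a⌋ : ℤ)) (x := z) h (by fun_prop)
      simpa only [Function.comp_def, periodic_add_int hper] using this)
    fun a _ => (hG a).eventually_analyticAt.and ((hG a).deriv.continuousAt.eventually_ne (hG' a))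
  refine ⟨r, hr, fun z hz => h z.re z ?_⟩
  rwa [dist_of_re_eq (ofReal_re _).symm, ofReal_im, Real.dist_0_eq_abs]

theorem eventually_injective_of_deriv_ne_zero {G : ℂ → ℂ} {a : ℂ} (hG : AnalyticAt ℂ G a)
    (hG' : deriv G a ≠ 0) : ∀ᶠ p in 𝓝 (a, a), G p.1 = G p.2 → p.1 = p.2 := by
  have hs := hG.hasStrictDerivAt.hasStrictFDerivAt_equiv hG'
  have hsource := (hs.toOpenPartialHomeomorph G).open_source.mem_nhds
    hs.mem_toOpenPartialHomeomorph_source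
  filter_upwards [prod_mem_nhds hsource hsource] with p hp heq
  exact (hs.toOpenPartialHomeomorph G).injOn hp.1 hp.2 heq

theorem exists_strip_injective_mod_int {G : ℂ → ℂ} (hper : Function.Periodic G 1)
    (hG : ∀ a : ℝ, AnalyticAt ℂ G a) (hG' : ∀ a : ℝ, deriv G a ≠ 0)
    (hinj : ∀ a b : ℝ, G a = G b → ∃ n : ℤ, a = b + n) :
    ∃ r > 0, ∀ z w : ℂ, |z.im| < r → |w.im| < r → G z = G w → ∃ n : ℤ, z = w + n := by
  obtain ⟨r, hr, h⟩ := exists_forall_dist_lt_of_eventually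
    (isCompact_Icc.prod isCompact_Icc) (K := Icc (0 : ℝ) 1 ×ˢ Icc (0 : ℝ) 1)
    (L := fun q => ((q.1 : ℂ), (q.2 : ℂ))) (by fun_prop)
    (P := fun p => G p.1 = G p.2 → ∃ n : ℤ, p.1 = p.2 + n) (fun a => by
      refine ⟨(Int.fract a.1, Int.fract a.2), ⟨⟨Int.fract_nonneg _, (Int.fract_lt_one _).le⟩,
        Int.fract_nonneg _, (Int.fract_lt_one _).le⟩, fun p h heq => ?_⟩
      have hshift : ∀ x : ℝ, (Int.fract x - x : ℂ) = (-⌊x⌋ : ℤ) := fun x => by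
        rw [← Int.self_sub_floor]; push_cast; ring
      simp only [Prod.fst_add, Prod.snd_add, Prod.fst_sub, Prod.snd_sub, hshift,
        periodic_add_int hper] at h
      obtain ⟨n, hn⟩ := h heq
      refine ⟨-⌊a.2⌋ + n + ⌊a.1⌋, ?_⟩
      push_cast at hn ⊢
      linear_combination hn)
    fun ⟨a, b⟩ _ => by
      by_cases hab : G a = G b
      · obtain ⟨n, rfl⟩ := hinj a b hab
        have hb : Tendsto (fun p : ℂ × ℂ => (p.1, p.2 + n)) (𝓝 (((b + n : ℝ) : ℂ), (b : ℂ)))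
            (𝓝 (((b + n : ℝ) : ℂ), ((b + n : ℝ) : ℂ))) :=
          Continuous.tendsto' (by fun_prop) _ _ (by push_cast; rfl)
        filter_upwards [hb.eventually (eventually_injective_of_deriv_ne_zero (hG _) (hG' _))]
          with p hp heq
        exact ⟨n, hp (by rw [heq, periodic_add_int hper])⟩
      · have hcont : ContinuousAt (fun p : ℂ × ℂ => G p.1 - G p.2) (a, b) :=
          ((hG a).continuousAt.comp_of_eq continuousAt_fst rfl).sub
            ((hG b).continuousAt.comp_of_eq continuousAt_snd rfl)
        filter_upwards [hcont.eventually_ne (sub_ne_zero.2 hab)] with p hp heq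
        exact absurd heq (sub_ne_zero.1 hp)
  refine ⟨r, hr, fun z w hz hw => h (z.re, w.re) (z, w) ?_⟩
  rw [Prod.dist_eq, dist_of_re_eq (ofReal_re _).symm, dist_of_re_eq (ofReal_re _).symm, ofReal_im,
    ofReal_im, Real.dist_0_eq_abs, Real.dist_0_eq_abs]
  exact max_lt hz hw

theorem exists_int_eq_add_of_injOn_Ico {E : Type*} {γ : ℝ → E} (hper : Function.Periodic γ 1)
    (hinj : InjOn γ (Ico 0 1)) {a b : ℝ} (hab : γ a = γ b) : ∃ n : ℤ, a = b + n := by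
  have hfract : ∀ x, γ (Int.fract x) = γ x := fun x => by
    simpa [← Int.self_sub_floor] using hper.sub_int_mul_eq ⌊x⌋ (x := x)
  obtain ⟨n, hn⟩ := Int.fract_eq_fract.1 (hinj ⟨Int.fract_nonneg a, Int.fract_lt_one a⟩
    ⟨Int.fract_nonneg b, Int.fract_lt_one b⟩ (by rw [hfract, hfract, hab]))
  exact ⟨n, by linarith⟩

theorem exists_isConformalStrip {γ : ℝ → ℂ} (hγ : AnalyticOnNhd ℝ γ univ)
    (hper : Function.Periodic γ 1) (hinj : InjOn γ (Ico 0 1)) (hreg : ∀ s, deriv γ s ≠ 0) :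
    ∃ r, IsConformalStrip (holomorphicExtension γ) r := by
  have hG := fun a : ℝ => analyticAt_holomorphicExtension (hγ a (mem_univ a))
  have hG' : ∀ a : ℝ, deriv (holomorphicExtension γ) a ≠ 0 := fun a =>
    deriv_holomorphicExtension_ofReal (hγ a (mem_univ a)) ▸ hreg a
  have hGper := periodic_holomorphicExtension hper
  obtain ⟨r₁, hr₁, h₁⟩ := exists_strip_analyticAt_deriv_ne_zero hGper hG hG'
  obtain ⟨r₂, hr₂, h₂⟩ := exists_strip_injective_mod_int hGper hG hG' fun a b hab =>
    exists_int_eq_add_of_injOn_Ico hper hinj (by simpa only [holomorphicExtension_ofReal] using hab)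
  have h₁' := fun z (hz : |z.im| < min r₁ r₂) => h₁ z (hz.trans_le (min_le_left _ _))
  exact ⟨min r₁ r₂, lt_min hr₁ hr₂, fun z hz => (h₁' z hz).1, hGper, fun z hz => (h₁' z hz).2,
    fun z w hz hw => h₂ z w (hz.trans_le (min_le_right _ _)) (hw.trans_le (min_le_right _ _))⟩

theorem exists_diagStrip_of_eventually {P : ℂ × ℂ → Prop} (hper : Function.Periodic P 1)
    (h : ∀ a : ℝ, ∀ᶠ p in 𝓝 ((a : ℂ), (a : ℂ)), P p) : ∃ r > 0, ∀ p ∈ diagStrip r, P p := by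
  obtain ⟨r, hr, hP⟩ := exists_forall_dist_lt_of_eventually (isCompact_Icc (a := (0 : ℝ)) (b := 1))
    (L := fun a => ((a : ℂ), (a : ℂ))) (by fun_prop) (fun a => by
      refine ⟨Int.fract a, ⟨Int.fract_nonneg a, (Int.fract_lt_one a).le⟩, fun p hp => ?_⟩
      rw [← hper.sub_int_mul_eq ⌊a⌋]
      convert! hp using 1
      simp [← Int.self_sub_floor, Prod.ext_iff, sub_eq_add_neg]) fun a _ => h a
  refine ⟨r / 2, half_pos hr, fun p hp => hP p.1.re p ?_⟩
  obtain ⟨h1, h2, h3⟩ := hp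
  have hp1 := norm_le_abs_re_add_abs_im (p.1 - p.1.re)
  have hp2 := norm_le_abs_re_add_abs_im (p.2 - p.1.re)
  simp only [sub_re, ofReal_re, sub_self, abs_zero, sub_im, ofReal_im, sub_zero] at hp1 hp2
  rw [abs_sub_comm] at h3
  rw [Prod.dist_eq, dist_eq_norm, dist_eq_norm]
  exact max_lt (by linarith) (by linarith)

namespace IsConformalStrip

variable {G : ℂ → ℂ} {r : ℝ}

theorem abs_im_ofReal_lt (hG : IsConformalStrip G r) (t : ℝ) : |(t : ℂ).im| < r := by
  simpa using hG.pos

theorem conj_mem_diagStrip (hG : IsConformalStrip G r) {z : ℂ} (hz : |z.im| < r) :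
    (z, conj z) ∈ diagStrip r := ⟨hz, by simpa, by simpa using hG.pos⟩

theorem analyticOnNhd_conformalFactor (hG : IsConformalStrip G r) :
    AnalyticOnNhd ℂ (conformalFactor G) (diagStrip r) := by
  have h : AnalyticOnNhd ℂ (fun p : ℂ × ℂ => deriv G p.1) (diagStrip r) := fun p hp =>
    (hG.analytic _ hp.1).deriv.comp (f := fun p : ℂ × ℂ => p.1) analyticAt_fst
  exact h.mul (analyticOnNhd_conjReflect h)

theorem conformalFactor_ofReal (a : ℝ) :
    conformalFactor G (a, a) = ((‖deriv G a‖ ^ 2 : ℝ) : ℂ) := by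
  simp only [conformalFactor, conjReflect, conjSwap]
  rw [conj_ofReal, mul_conj, normSq_eq_norm_sq]

theorem periodic_conformalFactor (hG : IsConformalStrip G r) :
    Function.Periodic (conformalFactor G) 1 := fun p => by
  simp [conformalFactor, conjReflect, conjSwap, periodic_deriv hG.periodic _]

theorem exists_bounds_conformalFactor_ofReal (hG : IsConformalStrip G r) :
    ∃ c M : ℝ, 0 < c ∧ ∀ a : ℝ, conformalFactor G (a, a) ∈ halfDisc c M := by
  have hcont : Continuous fun a : ℝ => ‖deriv G a‖ ^ 2 :=
    (continuous_iff_continuousAt.2 fun a => (hG.analytic _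
      (hG.abs_im_ofReal_lt a)).deriv.continuousAt.comp' continuous_ofReal.continuousAt).norm.pow 2
  have hcompact := Function.Periodic.compact_of_continuous (c := 1)
    (fun a => by simp [periodic_deriv hG.periodic (a : ℂ)]) one_ne_zero hcont
  obtain ⟨_, ⟨b, rfl⟩, hmin⟩ := hcompact.exists_isLeast (range_nonempty _)
  obtain ⟨M, -, hmax⟩ := hcompact.exists_isGreatest (range_nonempty _)
  have hb : 0 < ‖deriv G b‖ := norm_pos_iff.2 (hG.deriv_ne _ (hG.abs_im_ofReal_lt b))
  refine ⟨‖deriv G b‖ ^ 2, M, by positivity, fun a => ?_⟩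
  rw [conformalFactor_ofReal]
  refine ⟨?_, hmin (mem_range_self a)⟩
  rw [norm_real, Real.norm_of_nonneg (by positivity)]
  exact hmax (mem_range_self a)

theorem exists_isPicardAdmissible (hG : IsConformalStrip G r) :
    ∃ r', 0 < r' ∧ r' ≤ r ∧ ∃ c M : ℝ, 0 < c ∧
      IsPicardAdmissible r' (2 * c) M (conformalFactor G) := by
  obtain ⟨c, M, hc, hcM⟩ := hG.exists_bounds_conformalFactor_ofReal
  obtain ⟨r', hr', hP⟩ := exists_diagStrip_of_eventually
    (P := fun p => ‖conformalFactor G p‖ < M + 1 ∧ c / 2 < (conformalFactor G p).re)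
    (fun p => by simp only [hG.periodic_conformalFactor p]) fun a => by
      have hcont := (hG.analyticOnNhd_conformalFactor (a, a) ⟨hG.abs_im_ofReal_lt a,
        hG.abs_im_ofReal_lt a, by simpa using hG.pos⟩).continuousAt
      exact (hcont.norm.eventually_lt_const (by linarith [(hcM a).1])).and
        ((continuous_re.continuousAt.comp' hcont).eventually_const_lt (by linarith [(hcM a).2]))
  refine ⟨min r r', lt_min hG.pos hr', min_le_left _ _, c / 4, M + 1, by positivity,
    hG.analyticOnNhd_conformalFactor.mono (diagStrip_mono (min_le_left _ _)), fun p hp => ?_,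
    fun p _ => hG.periodic_conformalFactor p, fun p _ => ?_⟩
  · obtain ⟨hnorm, hre⟩ := hP p (diagStrip_mono (min_le_right _ _) hp)
    exact ⟨hnorm.le, by linarith⟩
  · simp only [conformalFactor, conjReflect, conjSwap, map_mul, conj_conj]
    ring

end IsConformalStrip

/-! ### The Laplacian in a conformal coordinate -/

/-- The isometry `(s, t) ↦ s + i t`. -/
noncomputable def planeToComplex : Plane ≃ₗᵢ[ℝ] ℂ := Complex.orthonormalBasisOneI.repr.symm

theorem planeToComplex_single_zero : planeToComplex (EuclideanSpace.single 0 1) = 1 := by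
  simp [planeToComplex]

theorem planeToComplex_single_one : planeToComplex (EuclideanSpace.single 1 1) = I := by
  simp [planeToComplex]

/-- The embedding `x ↦ (z, z̄)`, `z = planeToComplex x`, of the plane in its complexification. -/
noncomputable def conjGraph : Plane →L[ℝ] ℂ × ℂ :=
  (planeToComplex.toContinuousLinearEquiv : Plane →L[ℝ] ℂ).prod
    ((conjCLE : ℂ →L[ℝ] ℂ).comp (planeToComplex.toContinuousLinearEquiv : Plane →L[ℝ] ℂ))

theorem conjGraph_apply (x : Plane) :
    conjGraph x = (planeToComplex x, conj (planeToComplex x)) := rfl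

theorem analyticAt_re_comp_conjGraph {K : ℂ × ℂ → ℂ} {x : Plane}
    (hK : AnalyticAt ℂ K (conjGraph x)) : AnalyticAt ℝ (fun y => (K (conjGraph y)).re) x :=
  (reCLM.analyticAt _).comp ((hK.restrictScalars (𝕜 := ℝ)).comp (conjGraph.analyticAt x))

theorem fderiv_fderiv_comp_continuousLinearMap {𝕜 E F H : Type*} [NontriviallyNormedField 𝕜]
    [NormedAddCommGroup E] [NormedSpace 𝕜 E] [NormedAddCommGroup F] [NormedSpace 𝕜 F]
    [NormedAddCommGroup H] [NormedSpace 𝕜 H] {K : F → H} {L : E →L[𝕜] F} {x : E}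
    (hK : ContDiffAt 𝕜 2 K (L x)) (v w : E) :
    fderiv 𝕜 (fderiv 𝕜 fun y => K (L y)) x v w = fderiv 𝕜 (fderiv 𝕜 K) (L x) (L v) (L w) := by
  have hfst : fderiv 𝕜 (fun y => K (L y)) =ᶠ[𝓝 x] fun y => (fderiv 𝕜 K (L y)).comp L := by
    filter_upwards [L.continuous.continuousAt.eventually (hK.eventually (by simp))] with y hy
    exact ((hy.differentiableAt two_ne_zero).hasFDerivAt.comp y L.hasFDerivAt).fderiv
  have hsnd : HasFDerivAt (fderiv 𝕜 K) (fderiv 𝕜 (fderiv 𝕜 K) (L x)) (L x) :=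
    ((hK.fderiv_right (m := 1) le_rfl).differentiableAt one_ne_zero).hasFDerivAt
  have hcomp := ((ContinuousLinearMap.compL 𝕜 E F H).flip L).hasFDerivAt.comp x
    (hsnd.comp x L.hasFDerivAt)
  rw [hfst.fderiv_eq]
  exact congrArg (fun A => A v w) hcomp.fderiv

section MixedDeriv

variable {K : ℂ × ℂ → ℂ} {p : ℂ × ℂ}

theorem eventually_deriv_fst_eq_fderiv (hK : AnalyticAt ℂ K p) :
    ∀ᶠ w in 𝓝 p.2, deriv (fun z => K (z, w)) p.1 = fderiv ℂ K (p.1, w) (1, 0) := by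
  have hcont : ContinuousAt (fun w : ℂ => (p.1, w)) p.2 := by fun_prop
  filter_upwards [hcont.eventually hK.eventually_analyticAt] with w hw
  have hslice : HasDerivAt (fun z : ℂ => (z, w)) ((1 : ℂ), (0 : ℂ)) p.1 :=
    (hasDerivAt_id p.1).prodMk (hasDerivAt_const p.1 w)
  exact (hw.differentiableAt.hasFDerivAt.comp_hasDerivAt p.1 hslice).deriv

theorem hasDerivAt_deriv_fst (hK : AnalyticAt ℂ K p) :
    HasDerivAt (fun w => deriv (fun z => K (z, w)) p.1) (fderiv ℂ (fderiv ℂ K) p (0, 1) (1, 0))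
      p.2 := by
  have hslice : HasDerivAt (fun w : ℂ => (p.1, w)) ((0 : ℂ), (1 : ℂ)) p.2 :=
    (hasDerivAt_const p.2 p.1).prodMk (hasDerivAt_id p.2)
  have hfderiv : HasDerivAt (fun w => fderiv ℂ K (p.1, w)) (fderiv ℂ (fderiv ℂ K) p (0, 1)) p.2 :=
    HasFDerivAt.comp_hasDerivAt (f := fun w : ℂ => (p.1, w)) p.2
      hK.fderiv.differentiableAt.hasFDerivAt hslice
  have happly := hfderiv.clm_apply (hasDerivAt_const p.2 ((1 : ℂ), (0 : ℂ)))
  simp only [map_zero, add_zero] at happly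
  exact happly.congr_of_eventuallyEq (eventually_deriv_fst_eq_fderiv hK)

theorem mixedDeriv_eq_fderiv_fderiv (hK : AnalyticAt ℂ K p) :
    mixedDeriv K p = fderiv ℂ (fderiv ℂ K) p (0, 1) (1, 0) :=
  (hasDerivAt_deriv_fst hK).deriv

theorem mixedDeriv_comp_prodMap {g h : ℂ → ℂ} (hK : AnalyticAt ℂ K (g p.1, h p.2))
    (hg : DifferentiableAt ℂ g p.1) (hh : DifferentiableAt ℂ h p.2) :
    mixedDeriv (fun q => K (g q.1, h q.2)) p =
      mixedDeriv K (g p.1, h p.2) * deriv h p.2 * deriv g p.1 := by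
  have hcont : ContinuousAt (fun w => (g p.1, h w)) p.2 :=
    continuousAt_const.prodMk hh.continuousAt
  have hfst : (fun w => deriv (fun z => K (g z, h w)) p.1) =ᶠ[𝓝 p.2]
      fun w => deriv (fun z => K (z, h w)) (g p.1) * deriv g p.1 := by
    filter_upwards [hcont.eventually hK.eventually_analyticAt] with w hw
    exact deriv_comp (h₂ := fun z => K (z, h w)) p.1
      (hw.differentiableAt.comp (g p.1) (by fun_prop)) hg
  rw [mixedDeriv_eq_fderiv_fderiv hK, mixedDeriv, hfst.deriv_eq]
  exact (((hasDerivAt_deriv_fst hK).comp p.2 hh.hasDerivAt).mul_const _).deriv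

end MixedDeriv

theorem laplacian_re_comp_conjGraph {K : ℂ × ℂ → ℂ} {x : Plane}
    (hK : AnalyticAt ℂ K (conjGraph x)) :
    Laplacian.laplacian (fun y => (K (conjGraph y)).re) x =
      4 * (mixedDeriv K (conjGraph x)).re := by
  have hKℝ : ContDiffAt ℝ 2 K (conjGraph x) := (hK.restrictScalars (𝕜 := ℝ)).contDiffAt
  have hre : Laplacian.laplacian (fun y => (K (conjGraph y)).re) x =
      (Laplacian.laplacian (fun y => K (conjGraph y)) x).re :=
    (hKℝ.comp x conjGraph.contDiff.contDiffAt).laplacian_CLM_comp_left (l := reCLM)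
  have hscalars (v w : ℂ × ℂ) : fderiv ℝ (fderiv ℝ K) (conjGraph x) v w =
      fderiv ℂ (fderiv ℂ K) (conjGraph x) v w := by
    have h := (hK.contDiffAt (n := 2)).restrictScalars_iteratedFDeriv (𝕜 := ℝ)
    simpa [iteratedFDeriv_two_apply] using congrArg (fun A => A ![v, w]) h.symm
  have hsymm : fderiv ℂ (fderiv ℂ K) (conjGraph x) (1, 0) (0, 1) = mixedDeriv K (conjGraph x) :=
    ((hK.contDiffAt (n := ⊤)).isSymmSndFDerivAt_of_omega _ _).trans
      (mixedDeriv_eq_fderiv_fderiv hK).symm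
  have h1 : ((1 : ℂ), conj (1 : ℂ)) = ((1 : ℂ), (0 : ℂ)) + ((0 : ℂ), (1 : ℂ)) := by simp
  have hI : (I, conj I) = I • ((1 : ℂ), (0 : ℂ)) - I • ((0 : ℂ), (1 : ℂ)) := by simp
  rw [hre, InnerProductSpace.laplacian_eq_iteratedFDeriv_orthonormalBasis _
    (EuclideanSpace.basisFun (Fin 2) ℝ), ← re_ofReal_mul]
  simp only [Fin.sum_univ_two, iteratedFDeriv_two_apply, Matrix.cons_val_zero, Matrix.cons_val_one,
    EuclideanSpace.basisFun_apply, fderiv_fderiv_comp_continuousLinearMap hKℝ, hscalars]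
  rw [conjGraph_apply (EuclideanSpace.single 0 1), conjGraph_apply (EuclideanSpace.single 1 1),
    planeToComplex_single_zero, planeToComplex_single_one, h1, hI]
  simp only [map_add, map_sub, map_smul, add_apply, sub_apply, smul_apply, hsymm, smul_eq_mul,
    ← mixedDeriv_eq_fderiv_fderiv hK]
  congr 1
  push_cast
  linear_combination (fderiv ℂ (fderiv ℂ K) (conjGraph x) (1, 0) (1, 0) +
    fderiv ℂ (fderiv ℂ K) (conjGraph x) (0, 1) (0, 1) - 2 * mixedDeriv K (conjGraph x)) * I_mul_I

theorem analyticAt_conj_comp_conj {g : ℂ → ℂ} {z : ℂ} (hg : AnalyticAt ℂ g z) :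
    AnalyticAt ℂ (fun w => conj (g (conj w))) (conj z) := by
  rw [analyticAt_iff_eventually_differentiableAt] at hg ⊢
  have hconj : Tendsto (conj) (𝓝 (conj z)) (𝓝 z) :=
    continuous_conj.tendsto' _ _ (conj_conj z)
  filter_upwards [hconj.eventually hg] with w hw
  simpa [Function.comp_def] using hw.conj_conj

theorem exists_local_right_inverse_of_deriv_ne_zero {G : ℂ → ℂ} {z : ℂ} (hG : AnalyticAt ℂ G z)
    (hG' : deriv G z ≠ 0) : ∃ g : ℂ → ℂ, AnalyticAt ℂ g (G z) ∧ g (G z) = z ∧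
      (∀ᶠ y in 𝓝 (G z), G (g y) = y) ∧ deriv g (G z) = (deriv G z)⁻¹ :=
  ⟨_, hG.analyticAt_localInverse hG',
    (hG.hasStrictDerivAt.hasStrictFDerivAt_equiv hG').localInverse_apply_image,
    (hG.hasStrictDerivAt.hasStrictFDerivAt_equiv hG').eventually_right_inverse,
    (hG.hasStrictDerivAt.to_localInverse hG').hasDerivAt.deriv⟩

namespace IsConformalStrip

variable {G : ℂ → ℂ} {r : ℝ} {ψ : ℂ × ℂ → ℂ} {f : Plane → ℝ} {z : ℂ}

/-- As `K` is the complexification of `f`, this is the conformal change `Δ = |G'|⁻² Δ_z` of the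
Laplacian. -/
theorem exists_eventuallyEq_re_comp_conjGraph (hG : IsConformalStrip G r)
    (hψ : AnalyticOnNhd ℂ ψ (diagStrip r))
    (hf : ∀ z : ℂ, |z.im| < r → f (planeToComplex.symm (G z)) = (ψ (z, conj z)).re)
    (hz : |z.im| < r) :
    ∃ K : ℂ × ℂ → ℂ, AnalyticAt ℂ K (conjGraph (planeToComplex.symm (G z))) ∧
      (f =ᶠ[𝓝 (planeToComplex.symm (G z))] fun y => (K (conjGraph y)).re) ∧
      mixedDeriv K (conjGraph (planeToComplex.symm (G z))) =
        mixedDeriv ψ (z, conj z) / conformalFactor G (z, conj z) := by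
  obtain ⟨g, hg, hgz, hGg, hg'⟩ :=
    exists_local_right_inverse_of_deriv_ne_zero (hG.analytic z hz) (hG.deriv_ne z hz)
  set h : ℂ → ℂ := fun w => conj (g (conj w)) with hh_def
  have hh : AnalyticAt ℂ h (conj (G z)) := analyticAt_conj_comp_conj hg
  have hhz : h (conj (G z)) = conj z := by simp [hh_def, hgz]
  have hh' : deriv h (conj (G z)) = conj (deriv G z)⁻¹ :=
    hg' ▸ hg.differentiableAt.hasDerivAt.conj_conj.deriv
  have hψz : AnalyticAt ℂ ψ (g (G z), h (conj (G z))) := by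
    rw [hgz, hhz]
    exact hψ _ (hG.conj_mem_diagStrip hz)
  have himg : ∀ᶠ y in 𝓝 (G z), |(g y).im| < r :=
    (continuous_im.continuousAt.comp' hg.continuousAt).abs.eventually_lt_const (by simpa only [hgz])
  have hplane : Tendsto planeToComplex (𝓝 (planeToComplex.symm (G z))) (𝓝 (G z)) :=
    planeToComplex.continuous.tendsto' _ _ (by simp)
  rw [conjGraph_apply, LinearIsometryEquiv.apply_symm_apply]
  refine ⟨fun p => ψ (g p.1, h p.2), ?_, ?_, ?_⟩
  · exact hψz.comp₂ (hg.comp (f := fun p : ℂ × ℂ => p.1)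
      (x := (G z, conj (G z))) analyticAt_fst) (hh.comp (f := fun p : ℂ × ℂ => p.2)
      (x := (G z, conj (G z))) analyticAt_snd)
  · filter_upwards [hplane.eventually hGg, hplane.eventually himg] with y hy hy'
    have hfy := hf _ hy'
    rw [hy, LinearIsometryEquiv.symm_apply_apply] at hfy
    simp [hfy, conjGraph_apply, hh_def]
  · rw [mixedDeriv_comp_prodMap hψz hg.differentiableAt hh.differentiableAt, hgz, hhz, hg', hh']
    simp only [conformalFactor, conjReflect, conjSwap, conj_conj, map_inv₀, div_eq_mul_inv,
      mul_inv]
    ring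

theorem analyticAt_of_eq_re (hG : IsConformalStrip G r) (hψ : AnalyticOnNhd ℂ ψ (diagStrip r))
    (hf : ∀ z : ℂ, |z.im| < r → f (planeToComplex.symm (G z)) = (ψ (z, conj z)).re)
    (hz : |z.im| < r) : AnalyticAt ℝ f (planeToComplex.symm (G z)) := by
  obtain ⟨K, hK, hfK, -⟩ := hG.exists_eventuallyEq_re_comp_conjGraph hψ hf hz
  exact (analyticAt_re_comp_conjGraph hK).congr hfK.symm

theorem laplacian_of_eq_re (hG : IsConformalStrip G r) (hψ : AnalyticOnNhd ℂ ψ (diagStrip r))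
    (hf : ∀ z : ℂ, |z.im| < r → f (planeToComplex.symm (G z)) = (ψ (z, conj z)).re)
    (hz : |z.im| < r) :
    Laplacian.laplacian f (planeToComplex.symm (G z)) =
      4 * (mixedDeriv ψ (z, conj z) / conformalFactor G (z, conj z)).re := by
  obtain ⟨K, hK, hfK, hmixed⟩ := hG.exists_eventuallyEq_re_comp_conjGraph hψ hf hz
  rw [(InnerProductSpace.laplacian_congr_nhds hfK).eq_of_nhds, laplacian_re_comp_conjGraph hK,
    hmixed]

end IsConformalStrip

/-! ### Winding number and the two sides of the curve -/

section DividedDifference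

/-- The divided difference `(F w - F z) / (w - z)` at `p = (z, w)`, written as an integral so that
it is meaningful, and holomorphic, also on the diagonal `z = w`. -/
noncomputable def dividedDifference (F : ℂ → ℂ) (p : ℂ × ℂ) : ℂ :=
  ∫ τ in (0 : ℝ)..1, deriv F (p.1 + τ • (p.2 - p.1))

theorem dividedDifference_self (F : ℂ → ℂ) (z : ℂ) : dividedDifference F (z, z) = deriv F z := by
  simp [dividedDifference]

variable {F : ℂ → ℂ} {U : Set ℂ} {z w : ℂ}

theorem analyticOnNhd_dividedDifference (hU : IsOpen U) (hconv : Convex ℝ U)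
    (hF : DifferentiableOn ℂ F U) : AnalyticOnNhd ℂ (dividedDifference F) (U ×ˢ U) := by
  have hF' : DifferentiableOn ℂ (deriv F) U := hF.deriv hU
  have hmem : ∀ p ∈ U ×ˢ U, ∀ τ ∈ Icc (0 : ℝ) 1, p.1 + τ • (p.2 - p.1) ∈ U := fun p hp τ hτ =>
    hconv.add_smul_sub_mem hp.1 hp.2 hτ
  refine analyticOnNhd_intervalIntegral (hU.prod hU) zero_le_one ?_ fun τ hτ => ?_
  · exact hF'.continuousOn.comp (f := fun q : (ℂ × ℂ) × ℝ => q.1.1 + q.2 • (q.1.2 - q.1.1))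
      (by fun_prop) fun q hq => hmem q.1 hq.1 q.2 hq.2
  · exact hF'.comp (f := fun p : ℂ × ℂ => p.1 + τ • (p.2 - p.1)) (by fun_prop)
      fun p hp => hmem p hp τ hτ

theorem dividedDifference_mul_sub (hU : IsOpen U) (hconv : Convex ℝ U)
    (hF : DifferentiableOn ℂ F U) (hz : z ∈ U) (hw : w ∈ U) :
    dividedDifference F (z, w) * (w - z) = F w - F z := by
  have hmem : MapsTo (fun τ : ℝ => z + τ • (w - z)) (Icc 0 1) U := fun τ hτ =>
    hconv.add_smul_sub_mem hz hw hτ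
  have hderiv : ∀ τ ∈ uIcc (0 : ℝ) 1,
      HasDerivAt (fun τ : ℝ => F (z + τ • (w - z))) (deriv F (z + τ • (w - z)) * (w - z)) τ :=
    fun τ hτ => by
      have hseg : HasDerivAt (fun τ : ℝ => z + τ • (w - z)) (w - z) τ := by
        simpa using ((hasDerivAt_id τ).smul_const (w - z)).const_add z
      exact (hF.differentiableAt (hU.mem_nhds (hmem (by rwa [uIcc_of_le zero_le_one] at hτ)
        ))).hasDerivAt.comp τ hseg
  rw [dividedDifference, ← intervalIntegral.integral_mul_const,
    intervalIntegral.integral_eq_sub_of_hasDerivAt hderiv]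
  · simp
  · refine ContinuousOn.intervalIntegrable ?_
    rw [uIcc_of_le zero_le_one]
    exact ((hF.deriv hU).continuousOn.comp (by fun_prop) hmem).mul continuousOn_const

theorem fderiv_dividedDifference_mul_sub (hU : IsOpen U) (hconv : Convex ℝ U)
    (hF : DifferentiableOn ℂ F U) (hz : z ∈ U) (hw : w ∈ U) :
    fderiv ℂ (dividedDifference F) (z, w) (0, 1) * (w - z) + dividedDifference F (z, w) =
      deriv F w := by
  have hdiff := (analyticOnNhd_dividedDifference hU hconv hF (z, w) ⟨hz, hw⟩).differentiableAt
  have hslice : HasDerivAt (fun w : ℂ => (z, w)) ((0 : ℂ), (1 : ℂ)) w :=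
    (hasDerivAt_const w z).prodMk (hasDerivAt_id w)
  have hprod := (hdiff.hasFDerivAt.comp_hasDerivAt w hslice).mul ((hasDerivAt_id w).sub_const z)
  have hF' := (hF.differentiableAt (hU.mem_nhds hw)).hasDerivAt.sub_const (F z)
  have heq : (fun w => F w - F z) =ᶠ[𝓝 w] fun w => dividedDifference F (z, w) * (w - z) := by
    filter_upwards [hU.mem_nhds hw] with w' hw'
    exact (dividedDifference_mul_sub hU hconv hF hz hw').symm
  simpa using hprod.unique (hF'.congr_of_eventuallyEq heq.symm)

end DividedDifference

theorem isOpen_strip (r : ℝ) : IsOpen {z : ℂ | |z.im| < r} :=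
  isOpen_lt continuous_im.abs continuous_const

theorem convex_strip (r : ℝ) : Convex ℝ {z : ℂ | |z.im| < r} := by
  simp only [abs_lt]
  exact (convex_halfSpace_im_gt (-r)).inter (convex_halfSpace_im_lt r)

/-- `2 π i` times the winding number about `w` of the curve `G (t)`, `t ∈ ℝ`, of period `1`. -/
noncomputable def windingIntegral (G : ℂ → ℂ) (w : ℂ) : ℂ :=
  ∫ t in (-(1 / 2) : ℝ)..1 / 2, deriv G t * (G t - w)⁻¹

theorem integral_inv_sub_mul_I_sub_inv_add_mul_I {y : ℝ} (hy : 0 < y) :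
    (∫ t in (-(1 / 2) : ℝ)..1 / 2, (((t : ℂ) - y * I)⁻¹ - ((t : ℂ) + y * I)⁻¹)) =
      4 * Real.arctan (1 / 2 / y) * I := by
  have hsub : ∀ t : ℝ, (t : ℂ) - y * I ≠ 0 := fun t h => hy.ne' <| by
    simpa using congrArg Complex.im h
  have hadd : ∀ t : ℝ, (t : ℂ) + y * I ≠ 0 := fun t h => hy.ne' <| by
    simpa using congrArg Complex.im h
  have hderiv : ∀ t : ℝ, HasDerivAt (fun t : ℝ => 2 * I * (Real.arctan (t / y) : ℂ))
      (((t : ℂ) - y * I)⁻¹ - ((t : ℂ) + y * I)⁻¹) t := fun t => by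
    refine ((((hasDerivAt_id t).div_const y).arctan).ofReal_comp.const_mul (2 * I)).congr_deriv ?_
    have hsum : (y : ℂ) ^ 2 + t ^ 2 = (t - y * I) * (t + y * I) := by
      linear_combination (y : ℂ) ^ 2 * I_sq
    have hy0 : (y : ℂ) ≠ 0 := ofReal_ne_zero.2 hy.ne'
    rw [inv_sub_inv (hsub t) (hadd t), ← hsum]
    have hne : (y : ℂ) ^ 2 + t ^ 2 ≠ 0 := hsum ▸ mul_ne_zero (hsub t) (hadd t)
    push_cast [id]
    field_simp
    ring
  rw [intervalIntegral.integral_eq_sub_of_hasDerivAt fun t _ => hderiv t]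
  · rw [neg_div, Real.arctan_neg]
    push_cast
    ring
  · exact Continuous.intervalIntegrable
      (.sub (.inv₀ (by fun_prop) hsub) (.inv₀ (by fun_prop) hadd)) _ _

namespace IsConformalStrip

variable {G : ℂ → ℂ} {r : ℝ}

theorem differentiableOn (hG : IsConformalStrip G r) :
    DifferentiableOn ℂ G {z : ℂ | |z.im| < r} := fun z hz =>
  (hG.analytic z hz).differentiableAt.differentiableWithinAt

theorem hasDerivAt_ofReal (hG : IsConformalStrip G r) (t : ℝ) :
    HasDerivAt (fun s : ℝ => G s) (deriv G t) t :=
  (hG.analytic _ (hG.abs_im_ofReal_lt t)).differentiableAt.hasDerivAt.comp_ofReal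

theorem continuous_curve (hG : IsConformalStrip G r) : Continuous fun s : ℝ => G s :=
  continuous_iff_continuousAt.2 fun t => (hG.hasDerivAt_ofReal t).continuousAt

theorem continuous_deriv_curve (hG : IsConformalStrip G r) :
    Continuous fun s : ℝ => deriv G s :=
  continuous_iff_continuousAt.2 fun t =>
    (hG.analytic _ (hG.abs_im_ofReal_lt t)).deriv.continuousAt.comp
      (f := fun s : ℝ => (s : ℂ)) (by fun_prop)

theorem periodic_curve (hG : IsConformalStrip G r) : Function.Periodic (fun s : ℝ => G s) 1 :=
  fun s => by simpa using hG.periodic s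

theorem isCompact_range (hG : IsConformalStrip G r) : IsCompact (range fun s : ℝ => G s) :=
  hG.periodic_curve.compact_of_continuous one_ne_zero hG.continuous_curve

theorem isOpen_compl_range (hG : IsConformalStrip G r) : IsOpen (range fun s : ℝ => G s)ᶜ :=
  hG.isCompact_range.isClosed.isOpen_compl

theorem notMem_range_iff (hG : IsConformalStrip G r) {z : ℂ} (hz : |z.im| < r) :
    G z ∉ range (fun s : ℝ => G s) ↔ z.im ≠ 0 := by
  rw [not_iff_not]
  constructor
  · rintro ⟨s, hs⟩
    obtain ⟨n, rfl⟩ := hG.inj _ _ hz (hG.abs_im_ofReal_lt s) hs.symm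
    simp
  · intro h
    exact ⟨z.re, congrArg G (Complex.ext (by simp) (by simp [h]))⟩

theorem hasDerivAt_windingIntegral (hG : IsConformalStrip G r) {w : ℂ}
    (hw : w ∈ (range fun s : ℝ => G s)ᶜ) : HasDerivAt (windingIntegral G) 0 w := by
  have hne : ∀ z ∈ (range fun s : ℝ => G s)ᶜ, ∀ t : ℝ, G t - z ≠ 0 := fun z hz t h =>
    hz ⟨t, sub_eq_zero.1 h⟩
  have hc := hG.continuous_curve
  have hc' := hG.continuous_deriv_curve
  have hd : ∀ t : ℝ, ∀ z ∈ (range fun s : ℝ => G s)ᶜ,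
      HasDerivAt (fun z => deriv G t * (G t - z)⁻¹) (deriv G t / (G t - z) ^ 2) z :=
    fun t z hz => ((((hasDerivAt_id z).const_sub (G t)).fun_inv (hne z hz t)).const_mul
      (deriv G t)).congr_deriv (by simp [div_eq_mul_inv])
  have hcont : ContinuousOn (Function.uncurry fun (z : ℂ) (t : ℝ) => deriv G t * (G t - z)⁻¹)
      ((range fun s : ℝ => G s)ᶜ ×ˢ Icc (-(1 / 2)) (1 / 2)) :=
    (hc'.comp continuous_snd).continuousOn.mul
      (((hc.comp continuous_snd).sub continuous_fst).continuousOn.inv₀ fun p hp => hne _ hp.1 _)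
  have hint : ∫ t in (-(1 / 2) : ℝ)..1 / 2, deriv G t / (G t - w) ^ 2 = 0 := by
    have hends : G (1 / 2 : ℝ) = G (-(1 / 2) : ℝ) :=
      (congrArg (fun s : ℝ => G s) (by norm_num)).trans (hG.periodic_curve (-(1 / 2)))
    have hprim : ∀ t : ℝ, HasDerivAt (fun t : ℝ => -(G t - w)⁻¹) (deriv G t / (G t - w) ^ 2) t :=
      fun t => (((hG.hasDerivAt_ofReal t).sub_const w).fun_inv (hne w hw t)).fun_neg.congr_deriv
        (by ring)
    rw [intervalIntegral.integral_eq_sub_of_hasDerivAt fun t _ => hprim t, hends, sub_self]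
    exact Continuous.intervalIntegrable
      (hc'.div₀ ((hc.sub continuous_const).pow 2) fun t => pow_ne_zero 2 (hne w hw t)) _ _
  rw [← hint]
  exact hasDerivAt_intervalIntegral hG.isOpen_compl_range (by norm_num) hcont
    (fun t _ z hz => (hd t z hz).differentiableAt.differentiableWithinAt) hw
    fun t _ => hd t w hw

theorem windingIntegral_eq_of_mem (hG : IsConformalStrip G r) {w w' : ℂ}
    (hw : w ∈ (range fun s : ℝ => G s)ᶜ)
    (hw' : w' ∈ connectedComponentIn (range fun s : ℝ => G s)ᶜ w) :
    windingIntegral G w' = windingIntegral G w := by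
  have hd : ∀ z ∈ connectedComponentIn (range fun s : ℝ => G s)ᶜ w,
      HasDerivAt (windingIntegral G) 0 z := fun z hz =>
    hG.hasDerivAt_windingIntegral (connectedComponentIn_subset _ _ hz)
  exact hG.isOpen_compl_range.connectedComponentIn.is_const_of_deriv_eq_zero
    isPreconnected_connectedComponentIn
    (fun z hz => (hd z hz).differentiableAt.differentiableWithinAt) (fun z hz => (hd z hz).deriv)
    hw' (mem_connectedComponentIn hw)

theorem tendsto_windingIntegral_cobounded (hG : IsConformalStrip G r) :
    Tendsto (windingIntegral G) (Bornology.cobounded ℂ) (𝓝 0) := by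
  obtain ⟨R, hR⟩ := hG.isCompact_range.isBounded.exists_norm_le
  obtain ⟨L, hL⟩ := (isCompact_Icc (a := (-(1 / 2) : ℝ)) (b := 1 / 2)).exists_bound_of_continuousOn
    hG.continuous_deriv_curve.continuousOn
  have hL0 : 0 ≤ L := (norm_nonneg _).trans (hL 0 (by norm_num))
  have hsub : Tendsto (fun w : ℂ => ‖w‖ - R) (Bornology.cobounded ℂ) atTop :=
    tendsto_atTop_add_const_right _ (-R) tendsto_norm_cobounded_atTop
  refine squeeze_zero_norm' ?_ (by simpa using hsub.inv_tendsto_atTop.const_mul L)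
  filter_upwards [hsub.eventually_gt_atTop 0] with w hw
  refine (intervalIntegral.norm_integral_le_of_norm_le_const (C := L * (‖w‖ - R)⁻¹)
    fun t ht => ?_).trans (by norm_num)
  rw [uIoc_of_le (by norm_num)] at ht
  have hdist : ‖w‖ - R ≤ ‖G t - w‖ := by
    rw [norm_sub_rev]
    exact (sub_le_sub_left (hR _ (mem_range_self t)) _).trans (norm_sub_norm_le w (G t))
  rw [norm_mul, norm_inv]
  have := hL t (Ioc_subset_Icc_self ht)
  gcongr

theorem windingIntegral_eq_zero (hG : IsConformalStrip G r) {w : ℂ}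
    (hw : w ∈ (range fun s : ℝ => G s)ᶜ)
    (hunb : ¬ Bornology.IsBounded (connectedComponentIn (range fun s : ℝ => G s)ᶜ w)) :
    windingIntegral G w = 0 := by
  have hfreq : ∃ᶠ w' in Bornology.cobounded ℂ,
      w' ∈ connectedComponentIn (range fun s : ℝ => G s)ᶜ w := fun hev =>
    hunb (Bornology.isBounded_def.2 hev)
  exact (isClosed_singleton.mem_of_frequently_of_tendsto
    (hfreq.mono fun w' hw' => hG.windingIntegral_eq_of_mem hw hw')
    hG.tendsto_windingIntegral_cobounded).symm

theorem dividedDifference_ne_zero (hG : IsConformalStrip G r) {y t : ℝ} (hy : |y| < r)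
    (ht : t ∈ Icc (-(1 / 2) : ℝ) (1 / 2)) : dividedDifference G (y * I, t) ≠ 0 := by
  have hz : |((y : ℂ) * I).im| < r := by simpa using hy
  intro h0
  have hGt := dividedDifference_mul_sub (isOpen_strip r) (convex_strip r) hG.differentiableOn hz
    (hG.abs_im_ofReal_lt t)
  rw [h0, zero_mul, eq_comm, sub_eq_zero] at hGt
  obtain ⟨n, hn⟩ := hG.inj _ _ (hG.abs_im_ofReal_lt t) hz hGt
  have hre : t = n := by simpa using congrArg Complex.re hn
  have him : y = 0 := by simpa using (congrArg Complex.im hn).symm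
  have hn0 : n = 0 := by
    have hlt : (n : ℝ) < 1 := by linarith [ht.2]
    have hgt : (-1 : ℝ) < n := by linarith [ht.1]
    norm_cast at hlt hgt
    omega
  simp only [hre, him, hn0, Int.cast_zero, ofReal_zero, zero_mul, dividedDifference_self] at h0
  exact hG.deriv_ne 0 (by simpa using hG.pos) h0

theorem continuousOn_logDeriv_dividedDifference (hG : IsConformalStrip G r) :
    ContinuousOn (Function.uncurry fun y t : ℝ =>
      fderiv ℂ (dividedDifference G) (y * I, t) (0, 1) / dividedDifference G (y * I, t))
      ({y : ℝ | |y| < r} ×ˢ Icc (-(1 / 2)) (1 / 2)) := by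
  have hD := analyticOnNhd_dividedDifference (isOpen_strip r) (convex_strip r) hG.differentiableOn
  have hmaps : MapsTo (fun q : ℝ × ℝ => ((q.1 : ℂ) * I, (q.2 : ℂ)))
      ({y : ℝ | |y| < r} ×ˢ Icc (-(1 / 2)) (1 / 2))
      ({z : ℂ | |z.im| < r} ×ˢ {z : ℂ | |z.im| < r}) := fun q hq =>
    ⟨by simpa using hq.1, hG.abs_im_ofReal_lt _⟩
  exact ((hD.fderiv.continuousOn.comp (by fun_prop) hmaps).clm_apply continuousOn_const).div
    (hD.continuousOn.comp (by fun_prop) hmaps) fun q hq => hG.dividedDifference_ne_zero hq.1 hq.2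

theorem windingIntegral_eq_integral_logDeriv_add (hG : IsConformalStrip G r) {y : ℝ} (hy : |y| < r)
    (hy0 : y ≠ 0) :
    windingIntegral G (G (y * I)) =
      (∫ t in (-(1 / 2) : ℝ)..1 / 2,
        fderiv ℂ (dividedDifference G) (y * I, t) (0, 1) / dividedDifference G (y * I, t)) +
      ∫ t in (-(1 / 2) : ℝ)..1 / 2, ((t : ℂ) - y * I)⁻¹ := by
  have hz : (y : ℂ) * I ∈ {z : ℂ | |z.im| < r} := by simpa using hy
  have hne : ∀ t : ℝ, (t : ℂ) - y * I ≠ 0 := fun t h => hy0 <| by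
    simpa using congrArg Complex.im h
  rw [← intervalIntegral.integral_add]
  · refine intervalIntegral.integral_congr fun t ht => ?_
    rw [uIcc_of_le (by norm_num)] at ht
    have hD := hG.dividedDifference_ne_zero hy ht
    have hn := hne t
    rw [← dividedDifference_mul_sub (isOpen_strip r) (convex_strip r) hG.differentiableOn hz
      (hG.abs_im_ofReal_lt t), ← fderiv_dividedDifference_mul_sub (isOpen_strip r) (convex_strip r)
      hG.differentiableOn hz (hG.abs_im_ofReal_lt t)]
    field_simp
  · refine ContinuousOn.intervalIntegrable ?_
    rw [uIcc_of_le (by norm_num)]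
    exact hG.continuousOn_logDeriv_dividedDifference.comp (f := fun t : ℝ => (y, t)) (by fun_prop)
      fun t ht => ⟨hy, ht⟩
  · exact (Continuous.inv₀ (by fun_prop) hne).intervalIntegrable _ _

theorem tendsto_windingIntegral_sub (hG : IsConformalStrip G r) :
    Tendsto (fun y : ℝ => windingIntegral G (G (y * I)) - windingIntegral G (G ((-y : ℝ) * I)))
      (𝓝[>] 0) (𝓝 (2 * Real.pi * I)) := by
  set κ : ℝ → ℂ := fun y => ∫ t in (-(1 / 2) : ℝ)..1 / 2,
    fderiv ℂ (dividedDifference G) (y * I, t) (0, 1) / dividedDifference G (y * I, t)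
  have hopen : {y : ℝ | |y| < r} ∈ 𝓝 0 :=
    (isOpen_lt continuous_abs continuous_const).mem_nhds (by simpa using hG.pos)
  have hκ : ContinuousAt κ 0 :=
    (continuousOn_intervalIntegral (by norm_num)
      hG.continuousOn_logDeriv_dividedDifference).continuousAt hopen
  have hκneg : ContinuousAt (fun y : ℝ => κ (-y)) 0 :=
    ContinuousAt.comp (g := κ) (f := fun y : ℝ => -y) (by rwa [neg_zero])
      continuous_neg.continuousAt
  have harctan : Tendsto (fun y : ℝ => (4 * Real.arctan (1 / 2 / y) * I : ℂ)) (𝓝[>] 0)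
      (𝓝 (2 * Real.pi * I)) := by
    have hinv : Tendsto (fun y : ℝ => 1 / 2 / y) (𝓝[>] 0) atTop :=
      tendsto_inv_nhdsGT_zero.const_mul_atTop one_half_pos
    have hlim := (Real.tendsto_arctan_atTop.mono_right nhdsWithin_le_nhds).comp hinv
    convert! (((continuous_ofReal.tendsto _).comp hlim).const_mul 4).mul_const I using 2
    push_cast
    ring
  have hsum := (((hκ.fun_sub hκneg).tendsto).mono_left
    (nhdsWithin_le_nhds (s := Ioi 0))).add harctan
  simp only [neg_zero, sub_self, zero_add] at hsum
  refine hsum.congr' ?_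
  filter_upwards [self_mem_nhdsWithin, mem_nhdsWithin_of_mem_nhds hopen] with y hy hyr
  rw [hG.windingIntegral_eq_integral_logDeriv_add hyr (ne_of_gt hy),
    hG.windingIntegral_eq_integral_logDeriv_add (by rwa [abs_neg]) (neg_ne_zero.2 (ne_of_gt hy)),
    ← integral_inv_sub_mul_I_sub_inv_add_mul_I hy, intervalIntegral.integral_sub]
  · simp only [ofReal_neg, neg_mul, sub_neg_eq_add, κ]
    ring
  · exact (Continuous.inv₀ (by fun_prop) fun t h => (ne_of_gt hy) (by
      simpa using congrArg Complex.im h)).intervalIntegrable _ _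
  · exact (Continuous.inv₀ (by fun_prop) fun t h => (ne_of_gt hy) (by
      simpa using congrArg Complex.im h)).intervalIntegrable _ _

end IsConformalStrip

theorem frontier_connectedComponentIn_subset_compl {X : Type*} [TopologicalSpace X]
    [LocallyConnectedSpace X] {U : Set X} (hU : IsOpen U) (x : X) :
    frontier (connectedComponentIn U x) ⊆ Uᶜ := by
  intro y hy hyU
  have hopen := hU.connectedComponentIn (x := y)
  obtain ⟨z, hzy, hzx⟩ := mem_closure_iff_nhds.1 hy.1 _
    (hopen.mem_nhds (mem_connectedComponentIn hyU))
  rw [hU.connectedComponentIn.frontier_eq] at hy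
  apply hy.2
  rw [connectedComponentIn_eq hzx, ← connectedComponentIn_eq hzy]
  exact mem_connectedComponentIn hyU

namespace IsConformalStrip

variable {G : ℂ → ℂ} {r : ℝ}

theorem map_nhds_eq (hG : IsConformalStrip G r) {z : ℂ} (hz : |z.im| < r) :
    map G (𝓝 z) = 𝓝 (G z) :=
  (hG.analytic z hz).hasStrictDerivAt.map_nhds_eq (hG.deriv_ne z hz)

theorem connectedComponentIn_eq_of_convex (hG : IsConformalStrip G r) {S : Set ℂ}
    (hS : Convex ℝ S) (hSr : ∀ z ∈ S, |z.im| < r ∧ z.im ≠ 0) {z w : ℂ} (hz : z ∈ S) (hw : w ∈ S) :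
    connectedComponentIn (range fun s : ℝ => G s)ᶜ (G z) =
      connectedComponentIn (range fun s : ℝ => G s)ᶜ (G w) := by
  have himage : IsPreconnected (G '' S) := hS.isPreconnected.image G fun x hx =>
    (hG.analytic x (hSr x hx).1).continuousAt.continuousWithinAt
  have hsub : G '' S ⊆ (range fun s : ℝ => G s)ᶜ :=
    image_subset_iff.2 fun x hx => (hG.notMem_range_iff (hSr x hx).1).2 (hSr x hx).2
  exact connectedComponentIn_eq
    (himage.subset_connectedComponentIn (mem_image_of_mem G hz) hsub (mem_image_of_mem G hw))

theorem connectedComponentIn_eq_of_im_pos (hG : IsConformalStrip G r) {z w : ℂ}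
    (hz : 0 < z.im) (hzr : z.im < r) (hw : 0 < w.im) (hwr : w.im < r) :
    connectedComponentIn (range fun s : ℝ => G s)ᶜ (G z) =
      connectedComponentIn (range fun s : ℝ => G s)ᶜ (G w) :=
  hG.connectedComponentIn_eq_of_convex
    ((convex_halfSpace_im_gt 0).inter (convex_halfSpace_im_lt r))
    (fun _ hx => ⟨by rw [abs_of_pos hx.1]; exact hx.2, ne_of_gt hx.1⟩) ⟨hz, hzr⟩ ⟨hw, hwr⟩

theorem connectedComponentIn_eq_of_im_neg (hG : IsConformalStrip G r) {z w : ℂ}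
    (hz : z.im < 0) (hzr : -r < z.im) (hw : w.im < 0) (hwr : -r < w.im) :
    connectedComponentIn (range fun s : ℝ => G s)ᶜ (G z) =
      connectedComponentIn (range fun s : ℝ => G s)ᶜ (G w) :=
  hG.connectedComponentIn_eq_of_convex
    ((convex_halfSpace_im_gt (-r)).inter (convex_halfSpace_im_lt 0))
    (fun _ hx => ⟨by rw [abs_of_neg hx.2]; exact neg_lt.1 hx.1, ne_of_lt hx.2⟩) ⟨hzr, hz⟩ ⟨hwr, hw⟩

theorem exists_mem_connectedComponentIn (hG : IsConformalStrip G r) {w : ℂ}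
    (hw : w ∈ (range fun s : ℝ => G s)ᶜ) : ∃ z : ℂ, |z.im| < r ∧ z.im ≠ 0 ∧
      G z ∈ connectedComponentIn (range fun s : ℝ => G s)ᶜ w := by
  set C := connectedComponentIn (range fun s : ℝ => G s)ᶜ w
  have hCuniv : C ≠ univ := fun h =>
    (connectedComponentIn_subset _ _ (h ▸ mem_univ (G (0 : ℝ))) :
      G (0 : ℝ) ∉ range fun s : ℝ => G s) ⟨0, rfl⟩
  obtain ⟨x, hx⟩ := nonempty_frontier_iff.2 ⟨⟨w, mem_connectedComponentIn hw⟩, hCuniv⟩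
  obtain ⟨s, rfl⟩ :=
    not_not.1 (frontier_connectedComponentIn_subset_compl hG.isOpen_compl_range w hx)
  have hs := hG.abs_im_ofReal_lt s
  have hnear : G '' {z | |z.im| < r} ∈ 𝓝 (G s) := by
    rw [← hG.map_nhds_eq hs]
    exact image_mem_map ((isOpen_strip r).mem_nhds hs)
  obtain ⟨_, ⟨z, hz, rfl⟩, hzC⟩ := mem_closure_iff_nhds.1 hx.1 _ hnear
  exact ⟨z, hz, (hG.notMem_range_iff hz).1 (connectedComponentIn_subset _ _ hzC), hzC⟩

theorem not_isBounded_connectedComponentIn_both (hG : IsConformalStrip G r) {a b : ℂ}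
    (ha : 0 < a.im) (har : a.im < r) (hb : b.im < 0) (hbr : -r < b.im) :
    ¬ (Bornology.IsBounded (connectedComponentIn (range fun s : ℝ => G s)ᶜ (G a)) ∧
      Bornology.IsBounded (connectedComponentIn (range fun s : ℝ => G s)ᶜ (G b))) := by
  rintro ⟨hA, hB⟩
  refine NormedSpace.unbounded_univ ℂ ℂ
    ((hG.isCompact_range.isBounded.union (hA.union hB)).subset fun w _ => ?_)
  rw [mem_union, or_iff_not_imp_left]
  intro hw
  obtain ⟨z, hz, hz0, hzw⟩ := hG.exists_mem_connectedComponentIn hw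
  have hwz : w ∈ connectedComponentIn (range fun s : ℝ => G s)ᶜ (G z) := by
    rw [← connectedComponentIn_eq hzw]
    exact mem_connectedComponentIn hw
  rw [abs_lt] at hz
  rcases hz0.lt_or_gt with hneg | hpos
  · exact Or.inr (hG.connectedComponentIn_eq_of_im_neg hneg hz.1 hb hbr ▸ hwz)
  · exact Or.inl (hG.connectedComponentIn_eq_of_im_pos hpos hz.2 ha har ▸ hwz)

theorem isBounded_connectedComponentIn_or (hG : IsConformalStrip G r) {a b : ℂ}
    (ha : 0 < a.im) (har : a.im < r) (hb : b.im < 0) (hbr : -r < b.im) :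
    Bornology.IsBounded (connectedComponentIn (range fun s : ℝ => G s)ᶜ (G a)) ∨
      Bornology.IsBounded (connectedComponentIn (range fun s : ℝ => G s)ᶜ (G b)) := by
  by_contra! ⟨hA, hB⟩
  have hzero : ∀ z : ℂ, |z.im| < r → z.im ≠ 0 → windingIntegral G (G z) = 0 := fun z hz hz0 => by
    refine hG.windingIntegral_eq_zero ((hG.notMem_range_iff hz).2 hz0) ?_
    rw [abs_lt] at hz
    rcases hz0.lt_or_gt with hneg | hpos
    · rwa [hG.connectedComponentIn_eq_of_im_neg hneg hz.1 hb hbr]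
    · rwa [hG.connectedComponentIn_eq_of_im_pos hpos hz.2 ha har]
  have hlim : Tendsto (fun _ : ℝ => (0 : ℂ)) (𝓝[>] 0) (𝓝 (2 * Real.pi * I)) := by
    refine hG.tendsto_windingIntegral_sub.congr' ?_
    filter_upwards [Ioo_mem_nhdsGT hG.pos] with y hy
    rw [hzero, hzero, sub_zero] <;> simp [hy.1.ne', abs_of_pos hy.1, hy.2]
  exact two_pi_I_ne_zero (tendsto_nhds_unique hlim tendsto_const_nhds)

theorem exists_sign_isBounded_connectedComponentIn_iff (hG : IsConformalStrip G r) :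
    ∃ ε : ℝ, (ε = 1 ∨ ε = -1) ∧ ∀ z : ℂ, |z.im| < r → z.im ≠ 0 →
      (Bornology.IsBounded (connectedComponentIn (range fun s : ℝ => G s)ᶜ (G z)) ↔
        0 < ε * z.im) := by
  obtain ⟨h, hh, hhr⟩ := exists_between hG.pos
  set a : ℂ := h * I
  have ha : 0 < a.im ∧ a.im < r := by simp [a, hh, hhr]
  have hb : (-a).im < 0 ∧ -r < (-a).im := by simp [a, hh, hhr]
  have hnot := hG.not_isBounded_connectedComponentIn_both ha.1 ha.2 hb.1 hb.2
  have hor := hG.isBounded_connectedComponentIn_or ha.1 ha.2 hb.1 hb.2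
  have hside : ∀ z : ℂ, |z.im| < r → z.im ≠ 0 →
      (Bornology.IsBounded (connectedComponentIn (range fun s : ℝ => G s)ᶜ (G z)) ↔
        (0 < z.im ↔
          Bornology.IsBounded (connectedComponentIn (range fun s : ℝ => G s)ᶜ (G a)))) :=
    fun z hz hz0 => by
      rw [abs_lt] at hz
      rcases hz0.lt_or_gt with hneg | hpos
      · rw [hG.connectedComponentIn_eq_of_im_neg hneg hz.1 hb.1 hb.2, iff_false_left hneg.not_gt]
        tauto
      · rw [hG.connectedComponentIn_eq_of_im_pos hpos hz.2 ha.1 ha.2, iff_true_left hpos]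
  by_cases hA : Bornology.IsBounded (connectedComponentIn (range fun s : ℝ => G s)ᶜ (G a))
  · exact ⟨1, Or.inl rfl, fun z hz hz0 => by rw [hside z hz hz0, iff_true_right hA, one_mul]⟩
  · refine ⟨-1, Or.inr rfl, fun z hz hz0 => ?_⟩
    rw [hside z hz hz0, iff_false_right hA, neg_one_mul, neg_pos, not_lt]
    exact ⟨fun hle => hle.lt_of_ne hz0, le_of_lt⟩

variable {γ : ℝ → Plane}

theorem isBounded_connectedComponentIn_symm_iff (hγ : ∀ s : ℝ, planeToComplex (γ s) = G s)
    {w : ℂ} (hw : w ∈ (range fun s : ℝ => G s)ᶜ) :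
    Bornology.IsBounded (connectedComponentIn (range γ)ᶜ (planeToComplex.symm w)) ↔
      Bornology.IsBounded (connectedComponentIn (range fun s : ℝ => G s)ᶜ w) := by
  have hrange : planeToComplex.symm '' (range fun s : ℝ => G s) = range γ := by
    rw [← range_comp]
    congr 1 with s
    simp [← hγ]
  have himage : planeToComplex.symm '' connectedComponentIn (range fun s : ℝ => G s)ᶜ w =
      connectedComponentIn (range γ)ᶜ (planeToComplex.symm w) := by
    rw [← hrange, ← image_compl_eq planeToComplex.symm.bijective]
    exact planeToComplex.symm.toHomeomorph.image_connectedComponentIn hw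
  rw [← himage]
  exact ⟨fun hbd => by
    simpa [← image_comp] using planeToComplex.lipschitz.isBounded_image hbd,
    fun hbd => planeToComplex.symm.lipschitz.isBounded_image hbd⟩

theorem exists_sign_jordan_side (hG : IsConformalStrip G r)
    (hγ : ∀ s : ℝ, planeToComplex (γ s) = G s) : ∃ ε : ℝ, (ε = 1 ∨ ε = -1) ∧
    ∀ z : ℂ, |z.im| < r →
      (planeToComplex.symm (G z) ∈ jordanInterior (range γ) → 0 < ε * z.im) ∧
      (planeToComplex.symm (G z) ∈ jordanExterior (range γ) → ε * z.im < 0) := by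
  obtain ⟨ε, hε, hside⟩ := hG.exists_sign_isBounded_connectedComponentIn_iff
  have hmem : ∀ z : ℂ, planeToComplex.symm (G z) ∈ (range γ)ᶜ →
      G z ∈ (range fun s : ℝ => G s)ᶜ := by
    rintro z hz ⟨s, hs⟩
    exact hz ⟨s, by rw [LinearIsometryEquiv.eq_symm_apply, hγ]; exact hs⟩
  refine ⟨ε, hε, fun z hz => ⟨fun ⟨hoff, hbd⟩ => ?_, fun ⟨hoff, hunb⟩ => ?_⟩⟩
  · have hz0 := (hG.notMem_range_iff hz).1 (hmem z hoff)
    rwa [isBounded_connectedComponentIn_symm_iff hγ (hmem z hoff), hside z hz hz0] at hbd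
  · have hz0 := (hG.notMem_range_iff hz).1 (hmem z hoff)
    rw [isBounded_connectedComponentIn_symm_iff hγ (hmem z hoff), hside z hz hz0, not_lt] at hunb
    exact hunb.lt_of_ne (mul_ne_zero (by rcases hε with rfl | rfl <;> norm_num) hz0)

end IsConformalStrip

/-! ### Local solutions -/

theorem IsAnalyticJordanCurve.exists_isConformalStrip {γ : ℝ → Plane}
    (hγ : IsAnalyticJordanCurve γ) :
    ∃ G r, IsConformalStrip G r ∧ ∀ s : ℝ, planeToComplex (γ s) = G s := by
  have hderiv : ∀ s, deriv (fun s => planeToComplex (γ s)) s = planeToComplex (deriv γ s) :=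
    fun s => ((planeToComplex.toContinuousLinearEquiv : Plane →L[ℝ] ℂ).hasFDerivAt.comp_hasDerivAt
      s (hγ.analytic s (mem_univ s)).differentiableAt.hasDerivAt).deriv
  obtain ⟨r, hG⟩ := _root_.exists_isConformalStrip (γ := fun s => planeToComplex (γ s))
    (fun s hs => ((planeToComplex.toContinuousLinearEquiv : Plane →L[ℝ] ℂ).analyticAt _).comp
      (hγ.analytic s hs))
    (fun s => congrArg planeToComplex (hγ.periodic s))
    (planeToComplex.injective.comp_injOn hγ.injOn)
    (fun s => by rw [hderiv, map_ne_zero_iff _ planeToComplex.injective]; exact hγ.regular s)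
  exact ⟨_, r, hG, fun s =>
    (holomorphicExtension_ofReal (fun s => planeToComplex (γ s)) s).symm⟩

theorem apply_add_int_of_strip {E : Type*} {h : ℂ → E} {r : ℝ}
    (hh : ∀ z : ℂ, |z.im| < r → h (z + 1) = h z) {z : ℂ} (hz : |z.im| < r) (n : ℤ) :
    h (z + n) = h z := by
  have hper : Function.Periodic (fun n : ℤ => h (z + n)) 1 := fun n => by
    have := hh (z + n) (by simpa using hz)
    rwa [add_assoc, ← Int.cast_one, ← Int.cast_add] at this
  simpa using hper.int_mul_eq n

theorem IsConformalStrip.exists_descent {G : ℂ → ℂ} {r : ℝ} (hG : IsConformalStrip G r)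
    {E : Type*} {h : ℂ → E} (hh : ∀ z : ℂ, |z.im| < r → h (z + 1) = h z) :
    ∃ f : Plane → E, ∀ z : ℂ, |z.im| < r → f (planeToComplex.symm (G z)) = h z := by
  let S := {z : ℂ // |z.im| < r}
  have hfactors : (fun z : S => h z).FactorsThrough
      fun z : S => planeToComplex.symm (G z) := by
    rintro ⟨z, hz⟩ ⟨w, hw⟩ heq
    obtain ⟨n, rfl⟩ := hG.inj z w hz hw (planeToComplex.symm.injective heq)
    exact apply_add_int_of_strip hh hw n
  exact ⟨Function.extend _ (fun z : S => h z) fun _ => h 0,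
    fun z hz => hfactors.extend_apply _ ⟨z, hz⟩⟩

/-- A solution near the curve `γ` of the free boundary problem, in the conformal coordinate `z` in
which `γ` is the real axis: `f = W²` and `Δ f = 2 + ε W⁵`, where `W` has the sign of `Im z` and
the sign `ε` is such that `ε W` is positive inside `γ` and negative outside. -/
structure IsLocalSolution (γ : ℝ → Plane) (G : ℂ → ℂ) (r c ε : ℝ) (W : ℂ → ℝ) (f : Plane → ℝ) :
    Prop where
  strip : IsConformalStrip G r
  curve : ∀ s : ℝ, planeToComplex (γ s) = G s
  sign : ε = 1 ∨ ε = -1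
  side : ∀ z : ℂ, |z.im| < r →
    (planeToComplex.symm (G z) ∈ jordanInterior (range γ) → 0 < ε * W z) ∧
    (planeToComplex.symm (G z) ∈ jordanExterior (range γ) → ε * W z < 0)
  periodic : ∀ z : ℂ, |z.im| < r → W (z + 1) = W z
  analytic : ∀ z : ℂ, |z.im| < r → AnalyticAt ℝ W z
  ofReal : ∀ s : ℝ, W s = 0
  pos : 0 < c
  lt_fderiv : ∀ s : ℝ, c < fderiv ℝ W s I
  eq : ∀ z : ℂ, |z.im| < r → f (planeToComplex.symm (G z)) = W z ^ 2
  analyticAt : ∀ z : ℂ, |z.im| < r → AnalyticAt ℝ f (planeToComplex.symm (G z))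
  laplacian : ∀ z : ℂ, |z.im| < r →
    Laplacian.laplacian f (planeToComplex.symm (G z)) = 2 + ε * W z ^ 5

theorem IsLocalSolution.mono {γ : ℝ → Plane} {G : ℂ → ℂ} {r r' c ε : ℝ} {W : ℂ → ℝ}
    {f : Plane → ℝ} (h : IsLocalSolution γ G r c ε W f) (hr' : 0 < r') (hle : r' ≤ r) :
    IsLocalSolution γ G r' c ε W f where
  strip := h.strip.mono hr' hle
  curve := h.curve
  sign := h.sign
  side z hz := h.side z (hz.trans_le hle)
  periodic z hz := h.periodic z (hz.trans_le hle)
  analytic z hz := h.analytic z (hz.trans_le hle)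
  ofReal := h.ofReal
  pos := h.pos
  lt_fderiv := h.lt_fderiv
  eq z hz := h.eq z (hz.trans_le hle)
  analyticAt z hz := h.analyticAt z (hz.trans_le hle)
  laplacian z hz := h.laplacian z (hz.trans_le hle)

theorem analyticAt_sqrt {a : ℝ} (ha : 0 < a) : AnalyticAt ℝ (√·) a := by
  refine (((analyticAt_id.log ha).div_const (c := 2)).rexp).congr ?_
  filter_upwards [lt_mem_nhds ha] with y hy
  rw [← Real.exp_log (Real.sqrt_pos.2 hy), Real.log_sqrt hy.le]
  rfl

/-- The signed square root `Im z √V` of the solution `(Im z)² V`, with `V = v(z, z̄)`. -/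
noncomputable def signedRoot (v : ℂ × ℂ → ℂ) (z : ℂ) : ℝ :=
  z.im * √(v (z, conj z)).re

namespace IsPicardAdmissible

variable {r c M : ℝ} {v : ℂ × ℂ → ℂ}

theorem analyticAt_sqrt_re (hv : IsPicardAdmissible r c M v) (hc : 0 < c) {z : ℂ}
    (hz : (z, conj z) ∈ diagStrip r) : AnalyticAt ℝ (fun z => √(v (z, conj z)).re) z := by
  have hconj : AnalyticAt ℝ (fun z : ℂ => (z, conj z)) z :=
    analyticAt_id.prod (conjCLE.toContinuousLinearMap.analyticAt z)
  have hre : AnalyticAt ℝ (fun z => (v (z, conj z)).re) z := (reCLM.analyticAt _).comp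
    (((hv.analytic _ hz).restrictScalars (𝕜 := ℝ)).comp (f := fun z => (z, conj z)) hconj)
  exact (analyticAt_sqrt (hc.trans_le (hv.mem _ hz).2)).fun_comp
    (f := fun z => (v (z, conj z)).re) hre

theorem analyticAt_signedRoot (hv : IsPicardAdmissible r c M v) (hc : 0 < c) {z : ℂ}
    (hz : (z, conj z) ∈ diagStrip r) : AnalyticAt ℝ (signedRoot v) z :=
  (imCLM.analyticAt z).mul (hv.analyticAt_sqrt_re hc hz)

theorem fderiv_signedRoot_I (hv : IsPicardAdmissible r c M v) (hc : 0 < c) {s : ℝ}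
    (hs : ((s : ℂ), conj (s : ℂ)) ∈ diagStrip r) :
    fderiv ℝ (signedRoot v) s I = √(v (s, conj s)).re := by
  have h : HasFDerivAt (signedRoot v) _ (s : ℂ) :=
    imCLM.hasFDerivAt.mul (hv.analyticAt_sqrt_re hc hs).differentiableAt.hasFDerivAt
  rw [h.fderiv]
  simp

theorem re_sourceTerm_div_conj (hv : IsPicardAdmissible r c M v) (hc : 0 < c) {m : ℂ × ℂ → ℂ}
    {ε : ℝ} {z : ℂ} (hz : (z, conj z) ∈ diagStrip r) (hm : m (z, conj z) ≠ 0) :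
    (sourceTerm m ε v (z, conj z) / m (z, conj z)).re = 2 + ε * signedRoot v z ^ 5 := by
  have hpos : 0 ≤ (v (z, conj z)).re := hc.le.trans (hv.mem _ hz).2
  have hreal : v (z, conj z) = ((v (z, conj z)).re : ℂ) := by
    have h := hv.symm _ hz
    rw [conjReflect, conjSwap, conj_conj] at h
    exact (conj_eq_iff_re.1 h).symm
  have hroot : √(v (z, conj z)).re ^ 5 = (v (z, conj z)).re ^ (5 / 2 : ℝ) := by
    rw [Real.sqrt_eq_rpow, ← Real.rpow_natCast, ← Real.rpow_mul hpos]
    norm_num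
  have him : (z - conj z) / (2 * I) = (z.im : ℂ) := by
    rw [sub_conj]
    field_simp
    push_cast
    ring
  rw [sourceTerm, mul_div_cancel_left₀ _ hm, him, hreal, ← ofReal_cpow hpos, ← hroot]
  norm_cast
  rw [signedRoot, mul_pow, mul_assoc]

end IsPicardAdmissible

theorem IsAnalyticJordanCurve.exists_isLocalSolution {γ : ℝ → Plane}
    (hγ : IsAnalyticJordanCurve γ) : ∃ G r c ε W f, IsLocalSolution γ G r c ε W f := by
  obtain ⟨G, r₀, hG₀, hcurve⟩ := hγ.exists_isConformalStrip
  obtain ⟨ε, hε, hside⟩ := hG₀.exists_sign_jordan_side hcurve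
  obtain ⟨r₁, hr₁, hr₁₀, c, M, hc, hm⟩ := hG₀.exists_isPicardAdmissible
  obtain ⟨r, hr, hrr₁, v, hv, hfix⟩ := exists_strip_fixedPoint_picardStep (ε := ε) hr₁ hc hm
    (by rcases hε with rfl | rfl <;> norm_num)
  have hG := hG₀.mono hr (hrr₁.trans hr₁₀)
  have hmem {z : ℂ} (hz : |z.im| < r) : (z, conj z) ∈ diagStrip r := hG.conj_mem_diagStrip hz
  have hreal (s : ℝ) := hmem (hG.abs_im_ofReal_lt s)
  have hvpos {z : ℂ} (hz : |z.im| < r) : 0 < (v (z, conj z)).re :=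
    hc.trans_le (hv.mem _ (hmem hz)).2
  have hper (z : ℂ) (hz : |z.im| < r) : signedRoot v (z + 1) = signedRoot v z := by
    have h : v (z + 1, conj (z + 1)) = v (z, conj z) := by
      simpa [Prod.one_eq_mk] using hv.periodic _ (hmem hz)
    rw [signedRoot, signedRoot, h, add_im, one_im, add_zero]
  obtain ⟨f, hf⟩ := hG.exists_descent (h := fun z => signedRoot v z ^ 2)
    fun z hz => by rw [hper z hz]
  have hu := analyticOnNhd_sourceTerm (ε := ε) (hm.mono hrr₁ le_rfl le_rfl).analytic hc hv
  have hψ := analyticOnNhd_cauchySolution hu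
  have hfψ (z : ℂ) (hz : |z.im| < r) : f (planeToComplex.symm (G z)) =
      (cauchySolution (sourceTerm (conformalFactor G) ε v) (z, conj z)).re := by
    rw [hf z hz, re_cauchySolution_conj hfix hz, signedRoot, mul_pow,
      Real.sq_sqrt (hvpos hz).le]
  refine ⟨G, r, √c / 2, ε, signedRoot v, f, hG, hcurve, hε, fun z hz => ?_, hper,
    fun z hz => hv.analyticAt_signedRoot hc (hmem hz), fun s => by simp [signedRoot],
    half_pos (Real.sqrt_pos.2 hc), fun s => ?_, hf, fun z hz => hG.analyticAt_of_eq_re hψ hfψ hz,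
    fun z hz => ?_⟩
  · have hroot := Real.sqrt_pos.2 (hvpos hz)
    obtain ⟨hint, hext⟩ := hside z (hz.trans_le (hrr₁.trans hr₁₀))
    rw [signedRoot, ← mul_assoc]
    exact ⟨fun h => mul_pos (hint h) hroot, fun h => mul_neg_of_neg_of_pos (hext h) hroot⟩
  · rw [hv.fderiv_signedRoot_I hc (hreal s)]
    exact (half_lt_self (Real.sqrt_pos.2 hc)).trans_le
      (Real.sqrt_le_sqrt (hv.mem _ (hreal s)).2)
  · have hm0 : conformalFactor G (z, conj z) ≠ 0 := by
      simpa [conformalFactor, conjReflect, conjSwap] using hG.deriv_ne z hz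
    rw [hG.laplacian_of_eq_re hψ hfψ hz, mixedDeriv_cauchySolution hu (hmem hz),
      ← hv.re_sourceTerm_div_conj hc (hmem hz) hm0, div_right_comm, div_ofNat_re]
    ring

/-! ### Tubular neighborhoods bounded by level sets -/

theorem analyticAt_invFunOn {E F : Type*} [NormedAddCommGroup E] [NormedSpace ℝ E]
    [CompleteSpace E] [NormedAddCommGroup F] [NormedSpace ℝ F] [Nonempty E] {H : E → F} {s : Set E}
    (hs : IsOpen s) (hinj : InjOn H s) {x : E} (hx : x ∈ s) (hH : AnalyticAt ℝ H x)
    {i : E ≃L[ℝ] F} (hi : fderiv ℝ H x = i) : AnalyticAt ℝ (Function.invFunOn H s) (H x) := by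
  have hstrict : HasStrictFDerivAt H (i : E →L[ℝ] F) x := hi ▸ hH.hasStrictFDerivAt
  let e := hstrict.toOpenPartialHomeomorph H
  have hx' : x ∈ e.source := hstrict.mem_toOpenPartialHomeomorph_source
  have hsymm : AnalyticAt ℝ e.symm (H x) := e.analyticAt_symm' hx' hH hi
  have hmem : ∀ᶠ y in 𝓝 (H x), e.symm y ∈ s :=
    hsymm.continuousAt.eventually_mem (hs.mem_nhds (by
      rwa [show e.symm (H x) = x from e.left_inv hx']))
  refine hsymm.congr ?_
  filter_upwards [hmem, e.eventually_right_inverse (e.map_source hx')] with y hy hright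
  have hy' : H (e.symm y) = y := hright
  rw [← hinj.leftInvOn_invFunOn hy, hy']

/-- A real-analytic chart `z ↦ (s, t)` of the strip `|Im z| < r` near its center line, commuting
with the deck translation, which is the identity on the center line and whose range contains the
closed strip `|t| ≤ 1`. -/
structure IsStripChart (H : ℂ → ℝ × ℝ) (r : ℝ) : Prop where
  analytic : ∀ z : ℂ, |z.im| < r → AnalyticAt ℝ H z
  injective_fderiv : ∀ z : ℂ, |z.im| < r → Function.Injective (fderiv ℝ H z)
  injOn : InjOn H {z : ℂ | |z.im| < r}
  add_one : ∀ z : ℂ, |z.im| < r → H (z + 1) = H z + (1, 0)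
  ofReal : ∀ s : ℝ, H s = (s, 0)
  subset_image : univ ×ˢ Icc (-1) 1 ⊆ H '' {z : ℂ | |z.im| < r}

section LevelChart

variable {W : ℂ → ℝ} {r c κ : ℝ}

theorem exists_strip_forall_lt_fderiv (hr : 0 < r)
    (hper : ∀ z : ℂ, |z.im| < r → W (z + 1) = W z)
    (hW : ∀ z : ℂ, |z.im| < r → AnalyticAt ℝ W z) (hc : ∀ s : ℝ, c < fderiv ℝ W s I) :
    ∃ r', 0 < r' ∧ r' ≤ r ∧ ∀ z : ℂ, |z.im| < r' → c < fderiv ℝ W z I := by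
  have hshift (z : ℂ) (hz : |z.im| < r) (n : ℤ) : fderiv ℝ W (z + n) = fderiv ℝ W z := by
    rw [← fderiv_comp_add_right]
    refine EventuallyEq.fderiv_eq ?_
    filter_upwards [(isOpen_strip r).mem_nhds hz] with w hw using apply_add_int_of_strip hper hw n
  obtain ⟨r', hr', h⟩ := exists_forall_dist_lt_of_eventually (isCompact_Icc (a := (0 : ℝ)) (b := 1))
    continuous_ofReal (P := fun z => |z.im| < r → c < fderiv ℝ W z I) (fun a => by
      refine ⟨Int.fract a, ⟨Int.fract_nonneg a, (Int.fract_lt_one a).le⟩, fun z h hz => ?_⟩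
      have hfloor : (Int.fract a - a : ℂ) = (-⌊a⌋ : ℤ) := by
        rw [← Int.self_sub_floor]; push_cast; ring
      rw [hfloor, hshift z hz] at h
      exact h (by simpa using hz))
    fun a _ => by
      have ha : |(a : ℂ).im| < r := by simpa using hr
      have hcont : ContinuousAt (fun z => fderiv ℝ W z I) (a : ℂ) :=
        (hW a ha).fderiv.continuousAt.clm_apply continuousAt_const
      filter_upwards [hcont.eventually_const_lt (hc a)] with z hz _ using hz
  refine ⟨min r r', lt_min hr hr', min_le_left _ _, fun z hz => ?_⟩
  refine h z.re z ?_ (hz.trans_le (min_le_left _ _))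
  rw [dist_of_re_eq (ofReal_re _).symm, ofReal_im, Real.dist_0_eq_abs]
  exact hz.trans_le (min_le_right _ _)

theorem hasDerivAt_vertical {s y : ℝ} (hW : DifferentiableAt ℝ W (s + y * I)) :
    HasDerivAt (fun y : ℝ => W (s + y * I)) (fderiv ℝ W (s + y * I) I) y := by
  have hline : HasDerivAt (fun y : ℝ => (s : ℂ) + y * I) I y := by
    simpa using ((ofRealCLM.hasDerivAt (x := y)).mul_const I).const_add (s : ℂ)
  exact hW.hasFDerivAt.comp_hasDerivAt y hline

theorem strictMonoOn_vertical_sub (hW : ∀ z : ℂ, |z.im| < r → DifferentiableAt ℝ W z)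
    (hc : ∀ z : ℂ, |z.im| < r → c < fderiv ℝ W z I) (s : ℝ) :
    StrictMonoOn (fun y : ℝ => W (s + y * I) - c * y) {y : ℝ | |y| < r} := by
  have hderiv (y : ℝ) (hy : |y| < r) : HasDerivAt (fun y : ℝ => W (s + y * I) - c * y)
      (fderiv ℝ W (s + y * I) I - c) y := by
    have hline := hasDerivAt_vertical (hW (s + y * I) (by simpa using hy))
    simpa using hline.fun_sub ((hasDerivAt_id' y).const_mul c)
  have hball : {y : ℝ | |y| < r} = Metric.ball 0 r := by ext; simp
  refine strictMonoOn_of_deriv_pos (by rw [hball]; exact convex_ball _ _)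
    (fun y hy => (hderiv y hy).continuousAt.continuousWithinAt) fun y hy => ?_
  have hy' : y ∈ {y : ℝ | |y| < r} := interior_subset hy
  rw [(hderiv y hy').deriv, sub_pos]
  exact hc _ (by simpa using hy')

/-- The chart `z ↦ (Re z, W z / κ)`, whose second coordinate is constant on the level sets
of `W`. -/
noncomputable def levelChart (κ : ℝ) (W : ℂ → ℝ) (z : ℂ) : ℝ × ℝ := (z.re, κ⁻¹ * W z)

theorem hasFDerivAt_levelChart {W' : ℂ →L[ℝ] ℝ} {z : ℂ} (hW : HasFDerivAt W W' z) :
    HasFDerivAt (levelChart κ W) (reCLM.prod (κ⁻¹ • W')) z :=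
  reCLM.hasFDerivAt.prodMk (hW.const_smul κ⁻¹)

theorem injective_fderiv_levelChart (hκ : κ ≠ 0) {z : ℂ} (hW : DifferentiableAt ℝ W z)
    (hz : fderiv ℝ W z I ≠ 0) : Function.Injective (fderiv ℝ (levelChart κ W) z) := by
  rw [injective_iff_map_eq_zero, (hasFDerivAt_levelChart hW.hasFDerivAt).fderiv]
  intro w hw
  have hre : w.re = 0 := congrArg Prod.fst hw
  have hW' : κ⁻¹ * fderiv ℝ W z w = 0 := congrArg Prod.snd hw
  have hw' : w = w.im • I := by apply Complex.ext <;> simp [hre]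
  rw [hw', map_smul, smul_eq_mul] at hW'
  have him : w.im = 0 := by simpa [hκ, hz] using hW'
  rw [hw', him, zero_smul]

theorem injOn_levelChart (hκ : κ ≠ 0) (hW : ∀ z : ℂ, |z.im| < r → DifferentiableAt ℝ W z)
    (hW' : ∀ z : ℂ, |z.im| < r → 0 < fderiv ℝ W z I) :
    InjOn (levelChart κ W) {z : ℂ | |z.im| < r} := by
  intro z hz w hw heq
  have hre : z.re = w.re := congrArg Prod.fst heq
  have hWzw : W z = W w := mul_left_cancel₀ (inv_ne_zero hκ) (congrArg Prod.snd heq)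
  refine Complex.ext hre ((strictMonoOn_vertical_sub hW hW' z.re).injOn hz hw ?_)
  simp only [zero_mul, sub_zero]
  rwa [re_add_im, hre, re_add_im]

theorem exists_apply_add_mul_I_eq (hr : 0 < r)
    (hW : ∀ z : ℂ, |z.im| < r → DifferentiableAt ℝ W z) (hzero : ∀ s : ℝ, W s = 0)
    (hW' : ∀ z : ℂ, |z.im| < r → c < fderiv ℝ W z I) (s : ℝ) {w : ℝ} (hw : |w| ≤ c * (r / 2)) :
    ∃ y : ℝ, |y| < r ∧ W (s + y * I) = w := by
  have hmono := strictMonoOn_vertical_sub hW hW' s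
  have hmem {y : ℝ} (hy : y ∈ Icc (-(r / 2)) (r / 2)) : |y| < r :=
    (abs_le.2 hy).trans_lt (half_lt_self hr)
  have hle : -(r / 2) ≤ r / 2 := by linarith
  have hzero' : W (s + (0 : ℝ) * I) = 0 := by simpa using hzero s
  have hlow := hmono (hmem (left_mem_Icc.2 hle)) (hmem ⟨by linarith, by linarith⟩)
    (show -(r / 2) < 0 by linarith)
  have hhigh := hmono (hmem ⟨by linarith, by linarith⟩) (hmem (right_mem_Icc.2 hle))
    (show 0 < r / 2 by linarith)
  simp only [hzero'] at hlow hhigh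
  have hcont : ContinuousOn (fun y : ℝ => W (s + y * I)) (Icc (-(r / 2)) (r / 2)) := fun y hy =>
    (hasDerivAt_vertical (hW _ (by simpa using hmem hy))).continuousAt.continuousWithinAt
  obtain ⟨y, hy, hyw⟩ := intermediate_value_Icc hle hcont (show w ∈ Icc _ _ from
    ⟨by linarith [(abs_le.1 hw).1], by linarith [(abs_le.1 hw).2]⟩)
  exact ⟨y, hmem hy, hyw⟩

theorem isStripChart_levelChart (hr : 0 < r) (hc : 0 < c)
    (hper : ∀ z : ℂ, |z.im| < r → W (z + 1) = W z)
    (hW : ∀ z : ℂ, |z.im| < r → AnalyticAt ℝ W z) (hzero : ∀ s : ℝ, W s = 0)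
    (hW' : ∀ z : ℂ, |z.im| < r → c < fderiv ℝ W z I) :
    IsStripChart (levelChart (c * (r / 2)) W) r := by
  have hκ : 0 < c * (r / 2) := by positivity
  have hpos (z : ℂ) (hz : |z.im| < r) := hc.trans (hW' z hz)
  have hdiff (z : ℂ) (hz : |z.im| < r) := (hW z hz).differentiableAt
  refine ⟨fun z hz => (reCLM.analyticAt z).prod (analyticAt_const.mul (hW z hz)),
    fun z hz => injective_fderiv_levelChart hκ.ne' (hdiff z hz) (hpos z hz).ne',
    injOn_levelChart hκ.ne' hdiff hpos, fun z hz => by simp [levelChart, hper z hz],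
    fun s => by simp [levelChart, hzero], ?_⟩
  rintro ⟨s, t⟩ ⟨-, ht⟩
  obtain ⟨y, hy, hyt⟩ := exists_apply_add_mul_I_eq hr hdiff hzero hW' s
    (w := c * (r / 2) * t) (by
      rw [abs_mul, abs_of_pos hκ]
      exact mul_le_of_le_one_right hκ.le (abs_le.2 ht))
  refine ⟨s + y * I, by simpa using hy, ?_⟩
  rw [levelChart, hyt, inv_mul_cancel_left₀ hκ.ne']
  simp

end LevelChart

/-- The inverse of a chart `H` of the strip `|Im z| < r`, with junk values outside the range. -/
noncomputable def stripInverse (H : ℂ → ℝ × ℝ) (r : ℝ) : ℝ × ℝ → ℂ :=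
  Function.invFunOn H {z : ℂ | |z.im| < r}

namespace IsStripChart

variable {H : ℂ → ℝ × ℝ} {r : ℝ} {q : ℝ × ℝ}

theorem abs_im_stripInverse_lt (hH : IsStripChart H r) (hq : q.2 ∈ Icc (-1) 1) :
    |(stripInverse H r q).im| < r :=
  Function.invFunOn_mem (hH.subset_image ⟨mem_univ _, hq⟩)

theorem apply_stripInverse (hH : IsStripChart H r) (hq : q.2 ∈ Icc (-1) 1) :
    H (stripInverse H r q) = q :=
  Function.invFunOn_eq (hH.subset_image ⟨mem_univ _, hq⟩)

theorem stripInverse_apply (hH : IsStripChart H r) {z : ℂ} (hz : |z.im| < r) :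
    stripInverse H r (H z) = z :=
  hH.injOn.leftInvOn_invFunOn hz

theorem stripInverse_add_one (hH : IsStripChart H r) (hq : q.2 ∈ Icc (-1) 1) :
    stripInverse H r (q + (1, 0)) = stripInverse H r q + 1 := by
  have hz := hH.abs_im_stripInverse_lt hq
  rw [← hH.stripInverse_apply (z := stripInverse H r q + 1) (by simpa using hz),
    hH.add_one _ hz, hH.apply_stripInverse hq]

theorem apply_add_int (hH : IsStripChart H r) {z : ℂ} (hz : |z.im| < r) (n : ℤ) :
    H (z + n) = H z + ((n : ℝ), 0) := by
  have hdisp (w : ℂ) (hw : |w.im| < r) :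
      H (w + 1) - ((w + 1).re, 0) = H w - (w.re, 0) := by
    simp [hH.add_one w hw, Prod.ext_iff]
  have h := apply_add_int_of_strip (h := fun w => H w - (w.re, 0)) hdisp hz n
  rw [sub_eq_sub_iff_add_eq_add] at h
  ext
  · have hfst := congrArg Prod.fst h
    simp only [Prod.fst_add, add_re, intCast_re] at hfst ⊢
    linarith
  · simpa using congrArg Prod.snd h

theorem stripInverse_ofReal (hH : IsStripChart H r) (hr : 0 < r) (s : ℝ) :
    stripInverse H r (s, 0) = s := by
  rw [← hH.ofReal, hH.stripInverse_apply (by simpa using hr)]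

theorem exists_fderiv_eq_equiv (hH : IsStripChart H r) {z : ℂ} (hz : |z.im| < r) :
    ∃ i : ℂ ≃L[ℝ] ℝ × ℝ, fderiv ℝ H z = i := by
  have hfin : Module.finrank ℝ ℂ = Module.finrank ℝ (ℝ × ℝ) := by simp
  let e := LinearEquiv.ofInjectiveOfFinrankEq (fderiv ℝ H z : ℂ →ₗ[ℝ] ℝ × ℝ)
    (hH.injective_fderiv z hz) hfin
  exact ⟨e.toContinuousLinearEquiv, rfl⟩

theorem analyticAt_stripInverse (hH : IsStripChart H r) (hq : q.2 ∈ Icc (-1) 1) :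
    AnalyticAt ℝ (stripInverse H r) q := by
  have hz := hH.abs_im_stripInverse_lt hq
  obtain ⟨i, hi⟩ := hH.exists_fderiv_eq_equiv hz
  have h := analyticAt_invFunOn (isOpen_strip r) hH.injOn hz (hH.analytic _ hz) hi
  rwa [hH.apply_stripInverse hq] at h

theorem bijective_fderiv_stripInverse (hH : IsStripChart H r) (hq : q.2 ∈ Icc (-1) 1) :
    Function.Bijective (fderiv ℝ (stripInverse H r) q) := by
  have hz := hH.abs_im_stripInverse_lt hq
  obtain ⟨i, hi⟩ := hH.exists_fderiv_eq_equiv hz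
  have hHd : HasFDerivAt H (i : ℂ →L[ℝ] ℝ × ℝ) (stripInverse H r q) :=
    hi ▸ (hH.analytic _ hz).differentiableAt.hasFDerivAt
  have hinv := (hH.analyticAt_stripInverse hq).differentiableAt.hasFDerivAt
  rw [← hH.apply_stripInverse hq] at hinv
  have hid : stripInverse H r ∘ H =ᶠ[𝓝 (stripInverse H r q)] id := by
    filter_upwards [(isOpen_strip r).mem_nhds hz] with w hw using hH.stripInverse_apply hw
  have hcomp := (hinv.comp _ hHd).unique ((hasFDerivAt_id _).congr_of_eventuallyEq hid)
  rw [hH.apply_stripInverse hq] at hcomp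
  have heq : ⇑(fderiv ℝ (stripInverse H r) q) = i.symm := by
    ext1 v
    simpa using congrArg (fun L => L (i.symm v)) hcomp
  rw [heq]
  exact i.symm.bijective

end IsStripChart

/-- The coordinates `(s, t)` around the curve `G (ℝ)` given by the conformal coordinate `G⁻¹`
followed by the chart `H` of the strip `|Im z| < r`. -/
noncomputable def tubeMap (G : ℂ → ℂ) (H : ℂ → ℝ × ℝ) (r : ℝ) (q : ℝ × ℝ) : Plane :=
  planeToComplex.symm (G (stripInverse H r q))

/-- The tube `|t| < 1` around the curve `G (ℝ)` in the coordinates `tubeMap`. -/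
def tube (G : ℂ → ℂ) (H : ℂ → ℝ × ℝ) (r : ℝ) : Set Plane :=
  tubeMap G H r '' (univ ×ˢ Ioo (-1) 1)

theorem IsStripChart.exists_eq_of_mem_tube {G : ℂ → ℂ} {H : ℂ → ℝ × ℝ} {r : ℝ}
    (hH : IsStripChart H r) {x : Plane} (hx : x ∈ tube G H r) :
    ∃ z : ℂ, |z.im| < r ∧ planeToComplex.symm (G z) = x := by
  obtain ⟨q, ⟨-, ht⟩, rfl⟩ := hx
  exact ⟨_, hH.abs_im_stripInverse_lt (Ioo_subset_Icc_self ht), rfl⟩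

namespace IsConformalStrip

variable {G : ℂ → ℂ} {H : ℂ → ℝ × ℝ} {r : ℝ}

theorem analyticOnNhd_tubeMap (hG : IsConformalStrip G r) (hH : IsStripChart H r) :
    AnalyticOnNhd ℝ (tubeMap G H r) (univ ×ˢ Icc (-1) 1) := fun _ hq =>
  ((planeToComplex.symm.toContinuousLinearEquiv : ℂ →L[ℝ] Plane).analyticAt _).comp
    (((hG.analytic _ (hH.abs_im_stripInverse_lt hq.2)).restrictScalars (𝕜 := ℝ)).comp
      (hH.analyticAt_stripInverse hq.2))

theorem tubeMap_add_one (hG : IsConformalStrip G r) (hH : IsStripChart H r) {s t : ℝ}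
    (ht : t ∈ Icc (-1) 1) : tubeMap G H r (s + 1, t) = tubeMap G H r (s, t) := by
  have hshift : ((s + 1, t) : ℝ × ℝ) = (s, t) + (1, 0) := by simp
  rw [tubeMap, hshift, hH.stripInverse_add_one ht, hG.periodic, tubeMap]

theorem injOn_tubeMap (hG : IsConformalStrip G r) (hH : IsStripChart H r) :
    InjOn (tubeMap G H r) (Ico 0 1 ×ˢ Icc (-1) 1) := by
  rintro ⟨s, t⟩ ⟨hs, ht⟩ ⟨s', t'⟩ ⟨hs', ht'⟩ heq
  have hz := hH.abs_im_stripInverse_lt (q := (s, t)) ht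
  have hz' := hH.abs_im_stripInverse_lt (q := (s', t')) ht'
  obtain ⟨n, hn⟩ := hG.inj _ _ hz hz' (planeToComplex.symm.injective heq)
  have hshift : (s, t) = (s', t') + ((n : ℝ), 0) := by
    rw [← hH.apply_stripInverse (q := (s, t)) ht, hn, hH.apply_add_int hz' n,
      hH.apply_stripInverse ht']
  obtain ⟨rfl, rfl⟩ : s = s' + n ∧ t = t' := by simpa using hshift
  have hn0 : n = 0 := by
    have hlower : (-1 : ℝ) < n := by linarith [hs.1, hs'.2]
    have hupper : (n : ℝ) < 1 := by linarith [hs.2, hs'.1]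
    norm_cast at hlower hupper
    lia
  simp [hn0]

theorem bijective_fderiv_tubeMap (hG : IsConformalStrip G r) (hH : IsStripChart H r)
    {q : ℝ × ℝ} (hq : q.2 ∈ Icc (-1) 1) : Function.Bijective (fderiv ℝ (tubeMap G H r) q) := by
  have hz := hH.abs_im_stripInverse_lt hq
  have hGd := (hG.analytic _ hz).differentiableAt.hasDerivAt.hasFDerivAt.restrictScalars ℝ
  have hd : HasFDerivAt (tubeMap G H r) _ q :=
    (planeToComplex.symm.toContinuousLinearEquiv : ℂ →L[ℝ] Plane).hasFDerivAt.comp q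
      (hGd.comp q (hH.analyticAt_stripInverse hq).differentiableAt.hasFDerivAt)
  have hmul : Function.Bijective fun z => z * deriv G (stripInverse H r q) :=
    (Equiv.mulRight₀ _ (hG.deriv_ne _ hz)).bijective
  have heq : ⇑(fderiv ℝ (tubeMap G H r) q) = planeToComplex.symm ∘
      (fun z => z * deriv G (stripInverse H r q)) ∘ fderiv ℝ (stripInverse H r) q := by
    ext1 v
    simp [hd.fderiv]
  rw [heq]
  exact planeToComplex.symm.bijective.comp (hmul.comp (hH.bijective_fderiv_stripInverse hq))

theorem tubeMap_zero (hG : IsConformalStrip G r) (hH : IsStripChart H r) (s : ℝ) :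
    tubeMap G H r (s, 0) = planeToComplex.symm (G s) := by
  rw [tubeMap, hH.stripInverse_ofReal hG.pos]

theorem isTubularNeighborhood_tube (hG : IsConformalStrip G r) (hH : IsStripChart H r)
    {γ : ℝ → Plane} (hγ : ∀ s : ℝ, planeToComplex (γ s) = G s) :
    IsTubularNeighborhood γ (tube G H r) :=
  ⟨tubeMap G H r, hG.analyticOnNhd_tubeMap hH, fun _ _ ht => hG.tubeMap_add_one hH ht,
    hG.injOn_tubeMap hH, fun _ hq => hG.bijective_fderiv_tubeMap hH hq.2,
    fun s => by simp [hG.tubeMap_zero hH, ← hγ], rfl⟩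

theorem symm_mem_tube (hG : IsConformalStrip G r) (hH : IsStripChart H r) (s : ℝ) :
    planeToComplex.symm (G s) ∈ tube G H r :=
  ⟨(s, 0), by simp, hG.tubeMap_zero hH s⟩

theorem isOpen_tube (hG : IsConformalStrip G r) (hH : IsStripChart H r) :
    IsOpen (tube G H r) := by
  rw [isOpen_iff_mem_nhds]
  rintro _ ⟨q, ⟨-, ht⟩, rfl⟩
  have hq := Ioo_subset_Icc_self ht
  rw [← (hG.analyticOnNhd_tubeMap hH q ⟨mem_univ _, hq⟩).hasStrictFDerivAt.map_nhds_eq_of_surj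
    (LinearMap.range_eq_top.2 (hG.bijective_fderiv_tubeMap hH hq).2)]
  exact image_mem_map ((isOpen_univ.prod isOpen_Ioo).mem_nhds ⟨mem_univ _, ht⟩)

theorem closure_tube_subset (hG : IsConformalStrip G r) (hH : IsStripChart H r) :
    closure (tube G H r) ⊆ tubeMap G H r '' (univ ×ˢ Icc (-1) 1) := by
  have hcompact : IsCompact (tubeMap G H r '' (Icc 0 1 ×ˢ Icc (-1) 1)) :=
    (isCompact_Icc.prod isCompact_Icc).image_of_continuousOn
      ((hG.analyticOnNhd_tubeMap hH).continuousOn.mono (prod_mono_left (subset_univ _)))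
  refine (closure_minimal ?_ hcompact.isClosed).trans
    (image_mono (prod_mono_left (subset_univ _)))
  rintro _ ⟨⟨s, t⟩, ⟨-, ht⟩, rfl⟩
  have ht' := Ioo_subset_Icc_self ht
  have hper : Function.Periodic (fun s => tubeMap G H r (s, t)) 1 :=
    fun s => hG.tubeMap_add_one hH ht'
  refine ⟨(Int.fract s, t), ⟨⟨Int.fract_nonneg s, (Int.fract_lt_one s).le⟩, ht'⟩, ?_⟩
  simpa using hper.sub_int_mul_eq (x := s) ⌊s⌋

theorem frontier_tube_subset (hG : IsConformalStrip G r) (hH : IsStripChart H r) :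
    frontier (tube G H r) ⊆ tubeMap G H r '' (univ ×ˢ {-1, 1}) := by
  rw [(hG.isOpen_tube hH).frontier_eq]
  rintro _ ⟨hx, hx'⟩
  obtain ⟨⟨s, t⟩, ⟨-, ht⟩, rfl⟩ := hG.closure_tube_subset hH hx
  have ht' : t ∈ Icc (-1 : ℝ) 1 \ Ioo (-1) 1 :=
    ⟨ht, fun ht' => hx' ⟨(s, t), ⟨mem_univ _, ht'⟩, rfl⟩⟩
  rw [Icc_sdiff_Ioo_same (by norm_num)] at ht'
  exact ⟨(s, t), ⟨mem_univ _, ht'⟩, rfl⟩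

end IsConformalStrip

/-! ### Topology and circular symmetry -/

namespace IsConformalStrip

variable {G : ℂ → ℂ} {r : ℝ}

theorem map_symm_nhds (hG : IsConformalStrip G r) {z : ℂ} (hz : |z.im| < r) :
    map (fun z => planeToComplex.symm (G z)) (𝓝 z) = 𝓝 (planeToComplex.symm (G z)) := by
  have hsymm : map planeToComplex.symm (𝓝 (G z)) = 𝓝 (planeToComplex.symm (G z)) :=
    planeToComplex.symm.toHomeomorph.map_nhds_eq (G z)
  rw [← hsymm, ← hG.map_nhds_eq hz, map_map]
  rfl

theorem eventually_nhds_symm (hG : IsConformalStrip G r) {z : ℂ} (hz : |z.im| < r)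
    {P : Plane → Prop} : (∀ᶠ x in 𝓝 (planeToComplex.symm (G z)), P x) ↔
      ∀ᶠ w in 𝓝 z, P (planeToComplex.symm (G w)) := by
  rw [← hG.map_symm_nhds hz, eventually_map]

theorem continuousAt_of_eq {E : Type*} [TopologicalSpace E] {f : Plane → E} {h : ℂ → E}
    (hG : IsConformalStrip G r)
    (hf : ∀ z : ℂ, |z.im| < r → f (planeToComplex.symm (G z)) = h z) {z : ℂ} (hz : |z.im| < r)
    (hh : ContinuousAt h z) : ContinuousAt f (planeToComplex.symm (G z)) := by
  rw [ContinuousAt, ← hG.map_symm_nhds hz, tendsto_map'_iff, hf z hz]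
  refine hh.congr' ?_
  filter_upwards [(isOpen_strip r).mem_nhds hz] with w hw using (hf w hw).symm

end IsConformalStrip

theorem not_forall_exists_sub_eq_int {L : ℝ → ℝ} (hL : Continuous L) (hper : L 1 = L 0) :
    ¬ ∀ s, ∃ n : ℤ, L s - s = n := by
  intro hint
  have hconst : L 1 - 1 = L 0 - 0 := isPreconnected_univ.constant_of_mapsTo
    Int.isClosedEmbedding_coe_real.isEmbedding.isDiscrete_range
    (f := fun s => L s - s) (hL.sub continuous_id).continuousOn
    (fun s _ => (hint s).imp fun _ => Eq.symm) (mem_univ 1) (mem_univ 0)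
  norm_num [hper] at hconst

/-- The function `G z ↦ exp (2 π i z)` has no continuous logarithm on `Ω`. -/
theorem IsConformalStrip.not_simplyConnectedSpace {G : ℂ → ℂ} {r : ℝ} (hG : IsConformalStrip G r)
    {Ω : Set Plane} (hΩ : IsOpen Ω) (hcurve : ∀ s : ℝ, planeToComplex.symm (G s) ∈ Ω)
    (hsub : ∀ x ∈ Ω, ∃ z : ℂ, |z.im| < r ∧ planeToComplex.symm (G z) = x) :
    ¬ SimplyConnectedSpace Ω := by
  intro hsc
  obtain ⟨g, hg⟩ := hG.exists_descent (h := fun z => exp (2 * Real.pi * I * z)) fun z _ => by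
    rw [mul_add, mul_one, exp_periodic]
  have hgcont : ContinuousOn g Ω := fun x hx => by
    obtain ⟨z, hz, rfl⟩ := hsub x hx
    exact (hG.continuousAt_of_eq hg hz (by fun_prop)).continuousWithinAt
  have hg0 : (0 : ℂ) ∉ g '' Ω := by
    rintro ⟨x, hx, hx0⟩
    obtain ⟨z, hz, rfl⟩ := hsub x hx
    exact exp_ne_zero _ ((hg z hz).symm.trans hx0)
  obtain ⟨L, hLcont, hL⟩ := Complex.exists_continuousOn_eqOn_exp_comp
    (show IsSimplyConnected Ω from hsc) hΩ hgcont hg0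
  have hlog (s : ℝ) : ∃ n : ℤ, L (planeToComplex.symm (G s)) =
      2 * Real.pi * I * s + n * (2 * Real.pi * I) := by
    rw [← Complex.exp_eq_exp_iff_exists_int, ← hg s (hG.abs_im_ofReal_lt s)]
    exact hL (hcurve s)
  refine not_forall_exists_sub_eq_int
    (L := fun s => (L (planeToComplex.symm (G s)) / (2 * Real.pi * I)).re) ?_ ?_ fun s => ?_
  · have hLG := hLcont.comp_continuous
      (planeToComplex.symm.continuous.comp hG.continuous_curve) hcurve
    exact continuous_re.comp (hLG.div_const _)
  · have hG1 : G ((1 : ℝ) : ℂ) = G ((0 : ℝ) : ℂ) := by simpa using hG.periodic 0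
    rw [hG1]
  · obtain ⟨n, hn⟩ := hlog s
    refine ⟨n, ?_⟩
    have hquot : L (planeToComplex.symm (G s)) / (2 * Real.pi * I) = ((s + n : ℝ) : ℂ) := by
      rw [hn, div_eq_iff two_pi_I_ne_zero]
      push_cast
      ring
    rw [hquot, ofReal_re, add_sub_cancel_left]

theorem IsRadialOn.exists_curve_subset_sphere {ψ : Plane → ℝ} {Ω : Set Plane}
    (h : IsRadialOn ψ Ω) (hΩ : IsOpen Ω) {γ : ℝ → Plane} (hcont : Continuous γ)
    (hmem : ∀ s, γ s ∈ Ω) (hzero : ∀ s, ψ (γ s) = 0) (hne : ∀ s, ∃ᶠ x in 𝓝 (γ s), ψ x ≠ 0) :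
    ∃ c ρ, ∀ s, γ s ∈ Metric.sphere c ρ := by
  obtain ⟨c, hc⟩ := h
  refine ⟨c, dist (γ 0) c, fun s => ?_⟩
  have hdist : Continuous fun s => dist (γ s) c := hcont.dist continuous_const
  suffices hle : ∀ s₁ s₂, dist (γ s₂) c ≤ dist (γ s₁) c from le_antisymm (hle 0 s) (hle s 0)
  intro s₁ s₂
  by_contra! hlt
  obtain ⟨d, hd₁, hd₂⟩ := exists_between hlt
  obtain ⟨s₀, rfl⟩ := mem_range_of_exists_le_of_exists_ge hdist ⟨s₁, hd₁.le⟩ ⟨s₂, hd₂.le⟩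
  have hdist' : ContinuousAt (fun x => dist x c) (γ s₀) := by fun_prop
  obtain ⟨x, hx0, hx₁, hx₂, hxΩ⟩ := ((hne s₀).and_eventually
    ((hdist'.eventually_const_lt hd₁).and
      ((hdist'.eventually_lt_const hd₂).and (hΩ.mem_nhds (hmem s₀))))).exists
  obtain ⟨t, ht⟩ := mem_range_of_exists_le_of_exists_ge hdist ⟨s₁, hx₁.le⟩ ⟨s₂, hx₂.le⟩
  exact hx0 ((hc x hxΩ (γ t) (hmem t) ht.symm).trans (hzero t))

theorem exists_apply_add_half_eq {a : ℝ → ℝ} (ha : Continuous a) (hper : Function.Periodic a 1) :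
    ∃ s, a (s + 1 / 2) = a s := by
  have hcont : Continuous fun s => a (s + 1 / 2) - a s := by fun_prop
  have hneg : a (1 / 2 + 1 / 2) - a (1 / 2) = -(a (0 + 1 / 2) - a 0) := by
    rw [add_halves, ← hper 0, zero_add, zero_add]
    ring
  obtain ⟨s, hs⟩ : (0 : ℝ) ∈ range fun s => a (s + 1 / 2) - a s := by
    rcases le_total (a (0 + 1 / 2) - a 0) 0 with h0 | h0
    · exact mem_range_of_exists_le_of_exists_ge hcont ⟨0, h0⟩ ⟨1 / 2, by linarith⟩
    · exact mem_range_of_exists_le_of_exists_ge hcont ⟨1 / 2, by linarith⟩ ⟨0, h0⟩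
  exact ⟨s, sub_eq_zero.1 hs⟩

theorem neg_mem_slitPlane_of_norm_eq_one {w : ℂ} (hw : ‖w‖ = 1) (hw1 : w ≠ 1) :
    -w ∈ slitPlane := by
  rw [mem_slitPlane_iff_arg]
  refine ⟨fun harg => hw1 ?_, neg_ne_zero.2 fun h0 => by simp [h0] at hw⟩
  have hpolar := norm_mul_exp_arg_mul_I (-w)
  rw [harg, norm_neg, hw, exp_pi_mul_I, ofReal_one, one_mul] at hpolar
  exact (neg_injective hpolar).symm

theorem exists_apply_add_half_eq_of_norm_eq_one {w : ℝ → ℂ} (hcont : Continuous w)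
    (hper : Function.Periodic w 1) (hnorm : ∀ s, ‖w s‖ = 1) (hne : ∀ s, w s ≠ 1) :
    ∃ s, w (s + 1 / 2) = w s := by
  have harg : Continuous fun s => arg (-w s) := continuous_iff_continuousAt.2 fun s =>
    ContinuousAt.comp (f := fun s => -w s)
      (continuousAt_arg (neg_mem_slitPlane_of_norm_eq_one (hnorm s) (hne s)))
      hcont.neg.continuousAt
  obtain ⟨s, hs⟩ := exists_apply_add_half_eq harg fun s => by rw [hper s]
  exact ⟨s, neg_injective (Complex.ext_norm_arg (by simp [hnorm]) hs)⟩

theorem IsAnalyticJordanCurve.continuous {γ : ℝ → Plane} (hγ : IsAnalyticJordanCurve γ) :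
    Continuous γ :=
  continuousOn_univ.1 hγ.analytic.continuousOn

theorem IsAnalyticJordanCurve.range_eq_sphere {γ : ℝ → Plane} (hγ : IsAnalyticJordanCurve γ)
    {c : Plane} {ρ : ℝ} (h : ∀ s, γ s ∈ Metric.sphere c ρ) : range γ = Metric.sphere c ρ := by
  have hinj {s : ℝ} : γ (s + 1 / 2) ≠ γ s := fun heq => by
    obtain ⟨n, hn⟩ := exists_int_eq_add_of_injOn_Ico hγ.periodic hγ.injOn heq
    have hn2 : (1 : ℝ) = 2 * n := by linarith
    norm_cast at hn2
    lia
  refine Subset.antisymm (range_subset_iff.2 h) fun p hp => ?_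
  by_contra! hpγ
  have hnorm {x : Plane} (hx : x ∈ Metric.sphere c ρ) : ‖planeToComplex (x - c)‖ = ρ := by
    rwa [LinearIsometryEquiv.norm_map, ← mem_sphere_iff_norm]
  have hρ : ρ ≠ 0 := by
    rintro rfl
    simp only [Metric.sphere_zero, mem_singleton_iff] at h
    exact hinj ((h _).trans (h 0).symm)
  have hpc : planeToComplex (p - c) ≠ 0 := by rwa [← norm_ne_zero_iff, hnorm hp]
  obtain ⟨s, hs⟩ := exists_apply_add_half_eq_of_norm_eq_one
    (w := fun s => planeToComplex (γ s - c) / planeToComplex (p - c))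
    ((planeToComplex.continuous.comp (hγ.continuous.sub continuous_const)).div_const _)
    (fun s => by simp only [hγ.periodic s])
    (fun s => by rw [norm_div, hnorm (h s), hnorm hp, div_self hρ])
    (fun s hs => hpγ ⟨s, by simpa using (div_eq_one_iff_eq hpc).1 hs⟩)
  exact hinj (by simpa using (div_left_inj' hpc).1 hs)

/-! ### The stream function in the tube -/

theorem poissonBracket_eq_zero_of_fderiv_eq_smul {f g : Plane → ℝ} {x : Plane} {k : ℝ}
    (h : fderiv ℝ g x = k • fderiv ℝ f x) : poissonBracket f g x = 0 := by
  simp only [poissonBracket, partialDeriv, h, smul_apply, smul_eq_mul]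
  ring

theorem poissonBracket_eq_zero_of_fderiv_eq_zero {f g : Plane → ℝ} {x : Plane}
    (h : fderiv ℝ f x = 0) : poissonBracket f g x = 0 := by
  simp [poissonBracket, partialDeriv, h]

theorem sq_rpow_five_halves (y : ℝ) : (y ^ 2) ^ (5 / 2 : ℝ) = |y| ^ 5 := by
  rw [← sq_abs, ← Real.rpow_natCast_mul (abs_nonneg y), ← Real.rpow_natCast |y| 5]
  norm_num

theorem IsStripChart.apply_stripInverse_levelChart {W : ℂ → ℝ} {κ r : ℝ} {q : ℝ × ℝ}
    (hH : IsStripChart (levelChart κ W) r) (hκ : κ ≠ 0) (hq : q.2 ∈ Icc (-1) 1) :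
    W (stripInverse (levelChart κ W) r q) = κ * q.2 := by
  have hsnd := congrArg Prod.snd (hH.apply_stripInverse hq)
  rwa [levelChart, inv_mul_eq_iff_eq_mul₀ hκ] at hsnd

namespace IsLocalSolution

variable {γ : ℝ → Plane} {G : ℂ → ℂ} {r c ε κ : ℝ} {W : ℂ → ℝ} {f : Plane → ℝ} {z : ℂ} {x : Plane}

theorem sign_ne_zero (h : IsLocalSolution γ G r c ε W f) : ε ≠ 0 := by
  rcases h.sign with rfl | rfl <;> norm_num

theorem nonneg (h : IsLocalSolution γ G r c ε W f) (hz : |z.im| < r) :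
    0 ≤ f (planeToComplex.symm (G z)) := by
  rw [h.eq z hz]
  positivity

theorem laplacian_of_nonneg (h : IsLocalSolution γ G r c ε W f) (hz : |z.im| < r)
    (hside : 0 ≤ ε * W z) : Laplacian.laplacian f (planeToComplex.symm (G z)) =
      2 + f (planeToComplex.symm (G z)) ^ (5 / 2 : ℝ) := by
  rw [h.laplacian z hz, h.eq z hz, sq_rpow_five_halves]
  rcases h.sign with rfl | rfl
  · rw [abs_of_nonneg (by linarith)]
    ring
  · rw [abs_of_nonpos (by linarith)]
    ring

theorem laplacian_of_nonpos (h : IsLocalSolution γ G r c ε W f) (hz : |z.im| < r)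
    (hside : ε * W z ≤ 0) : Laplacian.laplacian f (planeToComplex.symm (G z)) =
      2 - f (planeToComplex.symm (G z)) ^ (5 / 2 : ℝ) := by
  rw [h.laplacian z hz, h.eq z hz, sq_rpow_five_halves]
  rcases h.sign with rfl | rfl
  · rw [abs_of_nonpos (by linarith)]
    ring
  · rw [abs_of_nonneg (by linarith)]
    ring

theorem fderiv_eq_zero (h : IsLocalSolution γ G r c ε W f) (hz : |z.im| < r) (hW : W z = 0) :
    fderiv ℝ f (planeToComplex.symm (G z)) = 0 := by
  refine IsLocalMin.fderiv_eq_zero ?_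
  have hzero : f (planeToComplex.symm (G z)) = 0 := by rw [h.eq z hz, hW, zero_pow two_ne_zero]
  rw [IsLocalMin, IsMinFilter, hzero, h.strip.eventually_nhds_symm hz]
  exact ((isOpen_strip r).eventually_mem hz).mono fun w hw => h.nonneg hw

theorem eventually_laplacian (h : IsLocalSolution γ G r c ε W f) (hz : |z.im| < r)
    (hW : W z ≠ 0) : ∃ σ : ℝ, ∀ᶠ x in 𝓝 (planeToComplex.symm (G z)),
      Laplacian.laplacian f x = 2 + σ * f x ^ (5 / 2 : ℝ) := by
  have hε : ε * W z ≠ 0 := mul_ne_zero h.sign_ne_zero hW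
  have hcont : ContinuousAt (fun w => ε * W w) z :=
    continuousAt_const.mul (h.analytic z hz).continuousAt
  have hstrip := (isOpen_strip r).eventually_mem hz
  rcases hε.lt_or_gt with hneg | hpos
  · refine ⟨-1, (h.strip.eventually_nhds_symm hz).2 ?_⟩
    filter_upwards [hstrip, hcont.eventually_lt_const hneg] with w hw hw'
    rw [h.laplacian_of_nonpos hw hw'.le]
    ring
  · refine ⟨1, (h.strip.eventually_nhds_symm hz).2 ?_⟩
    filter_upwards [hstrip, hcont.eventually_const_lt hpos] with w hw hw'
    rw [h.laplacian_of_nonneg hw hw'.le]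
    ring

theorem poissonBracket_laplacian (h : IsLocalSolution γ G r c ε W f) (hz : |z.im| < r) :
    poissonBracket f (Laplacian.laplacian f) (planeToComplex.symm (G z)) = 0 := by
  by_cases hW : W z = 0
  · exact poissonBracket_eq_zero_of_fderiv_eq_zero (h.fderiv_eq_zero hz hW)
  obtain ⟨σ, hσ⟩ := h.eventually_laplacian hz hW
  have hf : f (planeToComplex.symm (G z)) ≠ 0 := by
    rw [h.eq z hz]
    exact pow_ne_zero 2 hW
  have hderiv := (((h.analyticAt z hz).differentiableAt.hasFDerivAt.rpow_const
    (p := (5 / 2 : ℝ)) (Or.inl hf)).const_smul σ).const_add 2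
  exact poissonBracket_eq_zero_of_fderiv_eq_smul
    ((hderiv.congr_of_eventuallyEq hσ).fderiv.trans (smul_smul _ _ _))

theorem curve_symm (h : IsLocalSolution γ G r c ε W f) (s : ℝ) :
    planeToComplex.symm (G s) = γ s := by
  simp [← h.curve]

theorem apply_curve (h : IsLocalSolution γ G r c ε W f) (s : ℝ) : f (γ s) = 0 := by
  rw [← h.curve_symm, h.eq _ (h.strip.abs_im_ofReal_lt s), h.ofReal, zero_pow two_ne_zero]

theorem fderiv_curve (h : IsLocalSolution γ G r c ε W f) (s : ℝ) : fderiv ℝ f (γ s) = 0 := by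
  rw [← h.curve_symm]
  exact h.fderiv_eq_zero (h.strip.abs_im_ofReal_lt s) (h.ofReal s)

theorem frequently_ne_zero (h : IsLocalSolution γ G r c ε W f) (s : ℝ) :
    ∃ᶠ x in 𝓝 (γ s), f x ≠ 0 := by
  intro hev
  have hzero : f =ᶠ[𝓝 (γ s)] fun _ => 0 := hev.mono fun x hx => not_not.1 hx
  have hlap := h.laplacian s (h.strip.abs_im_ofReal_lt s)
  rw [h.curve_symm, (InnerProductSpace.laplacian_congr_nhds hzero).self_of_nhds, h.ofReal] at hlap
  simp at hlap

theorem exists_isStripChart (h : IsLocalSolution γ G r c ε W f) :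
    ∃ r' κ, IsLocalSolution γ G r' c ε W f ∧ κ ≠ 0 ∧ IsStripChart (levelChart κ W) r' := by
  obtain ⟨r', hr', hle, hW⟩ := exists_strip_forall_lt_fderiv h.strip.pos h.periodic h.analytic
    h.lt_fderiv
  have h' := h.mono hr' hle
  exact ⟨r', c * (r' / 2), h', (mul_pos h.pos (half_pos hr')).ne',
    isStripChart_levelChart hr' h.pos h'.periodic h'.analytic h.ofReal hW⟩

theorem apply_tubeMap (h : IsLocalSolution γ G r c ε W f) (hκ : κ ≠ 0)
    (hH : IsStripChart (levelChart κ W) r) {q : ℝ × ℝ} (hq : q.2 ∈ Icc (-1) 1) :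
    f (tubeMap G (levelChart κ W) r q) = (κ * q.2) ^ 2 := by
  rw [tubeMap, h.eq _ (hH.abs_im_stripInverse_lt hq), hH.apply_stripInverse_levelChart hκ hq]

theorem laplacian_tubeMap (h : IsLocalSolution γ G r c ε W f) (hκ : κ ≠ 0)
    (hH : IsStripChart (levelChart κ W) r) {q : ℝ × ℝ} (hq : q.2 ∈ Icc (-1) 1) :
    Laplacian.laplacian f (tubeMap G (levelChart κ W) r q) = 2 + ε * (κ * q.2) ^ 5 := by
  rw [tubeMap, h.laplacian _ (hH.abs_im_stripInverse_lt hq), hH.apply_stripInverse_levelChart hκ hq]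

theorem apply_of_mem_frontier (h : IsLocalSolution γ G r c ε W f) (hκ : κ ≠ 0)
    (hH : IsStripChart (levelChart κ W) r) (hx : x ∈ frontier (tube G (levelChart κ W) r)) :
    f x = κ ^ 2 := by
  obtain ⟨⟨s, t⟩, ⟨-, ht | ht⟩, rfl⟩ := h.strip.frontier_tube_subset hH hx
  all_goals
    obtain rfl : t = _ := ht
    rw [h.apply_tubeMap hκ hH (by norm_num)]
    ring

theorem analyticOnNhd_closure_tube (h : IsLocalSolution γ G r c ε W f)
    (hH : IsStripChart (levelChart κ W) r) :
    AnalyticOnNhd ℝ f (closure (tube G (levelChart κ W) r)) := fun _ hx => by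
  obtain ⟨q, ⟨-, hq⟩, rfl⟩ := h.strip.closure_tube_subset hH hx
  exact h.analyticAt _ (hH.abs_im_stripInverse_lt hq)

/-- The points `t = ± 1/2` of the tube lie on the same level of `f` but on different levels of
`Δ f`. -/
theorem not_exists_laplacian_eq_comp (h : IsLocalSolution γ G r c ε W f) (hκ : κ ≠ 0)
    (hH : IsStripChart (levelChart κ W) r) :
    ¬ ∃ F : ℝ → ℝ, ∀ x ∈ tube G (levelChart κ W) r, Laplacian.laplacian f x = F (f x) := by
  rintro ⟨F, hF⟩
  have hlevel (t : ℝ) (ht : t ∈ Ioo (-1) 1) : 2 + ε * (κ * t) ^ 5 = F ((κ * t) ^ 2) := by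
    have ht' := Ioo_subset_Icc_self ht
    rw [← h.laplacian_tubeMap hκ hH (q := (0, t)) ht', ← h.apply_tubeMap hκ hH (q := (0, t)) ht']
    exact hF _ ⟨(0, t), ⟨mem_univ _, ht⟩, rfl⟩
  have hpos := hlevel (1 / 2) (by norm_num)
  have hneg := hlevel (-(1 / 2)) (by norm_num)
  rw [mul_neg, neg_sq, ← hpos] at hneg
  exact mul_ne_zero h.sign_ne_zero (pow_ne_zero 5 hκ) (by linear_combination -16 * hneg)

theorem curve_mem_tube (h : IsLocalSolution γ G r c ε W f)
    (hH : IsStripChart (levelChart κ W) r) (s : ℝ) : γ s ∈ tube G (levelChart κ W) r := by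
  rw [← h.curve_symm]
  exact h.strip.symm_mem_tube hH s

theorem not_simplyConnectedSpace_tube (h : IsLocalSolution γ G r c ε W f)
    (hH : IsStripChart (levelChart κ W) r) :
    ¬ SimplyConnectedSpace (tube G (levelChart κ W) r) :=
  h.strip.not_simplyConnectedSpace (h.strip.isOpen_tube hH) (h.strip.symm_mem_tube hH)
    fun _ => hH.exists_eq_of_mem_tube

theorem exists_range_eq_sphere_of_isRadialOn (h : IsLocalSolution γ G r c ε W f)
    (hγ : IsAnalyticJordanCurve γ) (hH : IsStripChart (levelChart κ W) r)
    (hrad : IsRadialOn f (tube G (levelChart κ W) r)) :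
    ∃ (c : Plane) (ρ : ℝ), range γ = Metric.sphere c ρ := by
  obtain ⟨p, ρ, hp⟩ := hrad.exists_curve_subset_sphere (h.strip.isOpen_tube hH) hγ.continuous
    (h.curve_mem_tube hH) h.apply_curve h.frequently_ne_zero
  exact ⟨p, ρ, hγ.range_eq_sphere hp⟩

end IsLocalSolution

end

theorem theorem4p11 (γ : ℝ → Plane) (hγ : IsAnalyticJordanCurve γ) :
    ∃ (Ω : Set Plane) (ψ : Plane → ℝ),
      IsTubularNeighborhood γ Ω ∧
      AnalyticOnNhd ℝ ψ (closure Ω) ∧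
      (∃ c : ℝ, ∀ x ∈ frontier Ω, ψ x = c) ∧
      (∀ x ∈ Ω, 0 ≤ ψ x) ∧
      (∀ x ∈ Ω ∩ jordanInterior (range γ), Laplacian.laplacian ψ x = 2 + ψ x ^ (5 / 2 : ℝ)) ∧
      (∀ x ∈ Ω ∩ jordanExterior (range γ), Laplacian.laplacian ψ x = 2 - ψ x ^ (5 / 2 : ℝ)) ∧
      (∀ s, ψ (γ s) = 0 ∧ fderiv ℝ ψ (γ s) (unitNormal γ s) = 0) ∧
      -- `ψ` is a steady Euler flow on the multiply connected domain `Ω`, for which the rigidity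
      -- valid on simply connected domains fails
      (∀ x ∈ Ω, poissonBracket ψ (Laplacian.laplacian ψ) x = 0) ∧
      ¬ SimplyConnectedSpace Ω ∧
      (¬ ∃ F : ℝ → ℝ, ∀ x ∈ Ω, Laplacian.laplacian ψ x = F (ψ x)) ∧
      ((¬ ∃ (c : Plane) (r : ℝ), range γ = Metric.sphere c r) → ¬ IsRadialOn ψ Ω) := by
  obtain ⟨G, r₀, c, ε, W, f, h₀⟩ := hγ.exists_isLocalSolution
  obtain ⟨r, κ, h, hκ, hH⟩ := h₀.exists_isStripChart
  have hstrip (x) (hx : x ∈ tube G (levelChart κ W) r) := hH.exists_eq_of_mem_tube hx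
  refine ⟨tube G (levelChart κ W) r, f, h.strip.isTubularNeighborhood_tube hH h.curve,
    h.analyticOnNhd_closure_tube hH, ⟨κ ^ 2, fun x hx => h.apply_of_mem_frontier hκ hH hx⟩,
    fun x hx => ?_, fun x hx => ?_, fun x hx => ?_,
    fun s => ⟨h.apply_curve s, by rw [h.fderiv_curve, zero_apply]⟩,
    fun x hx => ?_, h.not_simplyConnectedSpace_tube hH, h.not_exists_laplacian_eq_comp hκ hH,
    fun hsphere hrad => hsphere (h.exists_range_eq_sphere_of_isRadialOn hγ hH hrad)⟩
  · obtain ⟨z, hz, rfl⟩ := hstrip x hx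
    exact h.nonneg hz
  · obtain ⟨z, hz, rfl⟩ := hstrip x hx.1
    exact h.laplacian_of_nonneg hz ((h.side z hz).1 hx.2).le
  · obtain ⟨z, hz, rfl⟩ := hstrip x hx.1
    exact h.laplacian_of_nonpos hz ((h.side z hz).2 hx.2).le
  · obtain ⟨z, hz, rfl⟩ := hstrip x hx
    exact h.poissonBracket_laplacian hz
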